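/- Let $k$ be a field, $K$ an extension field of $k$, and let $\ell,m$ be positive integers. All algebras and homomorphisms are unital. For a $k$-algebra $A$, an $n$-dimensional representation of $A$ is a $k$-algebra homomorphism $\rho\colon A\to M_n(K)$; it is irreducible if $K\rho(A)=M_n(K)$ and semisimple if $K\rho(A)$ is a semisimple algebra. Let $$E_{(\ell,m)}(K)=\begin{bmatrix} M_\ell(K)& M_{\ell\times m}(K)\\ 0& M_m(K)\end{bmatrix}\subset M_{\ell+m}(K),$$ and let $\pi_\ell,\pi_m$ be the maps taking a block upper triangular $(\ell+m)\times(\ell+m)$ matrix to its diagonal blocks of sizes $\ell$ and $m$. A representation $\rho\colon A\to E_{(\ell,m)}(K)$ is an $(\ell,m)$-extension of irreducible representations if $\pi_\ell\rho$ and $\pi_m\rho$ are irreducible; such an extension is nonsplit if $\rho$, as a representation in $M_{\ell+m}(K)$, is not semisimple. Let $\mathrm{SupDiag}_n$ be the $n\times n$ matrix with $1$'s on the superdiagonal and $0$'s elsewhere. **(1) Splitting criterion.** Let $A$ be any $k$-algebra and $\rho\colon A\to E_{(\ell,m)}(K)$ a representation, with $\Lambda=K\rho(A)$. Below, $\tau$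 ranges over the inner $K$-algebra automorphisms of $M_{\ell+m}(K)$ with $\tau(E_{(\ell,m)}(K))\subseteq E_{(\ell,m)}(K)$. (i) If $\rho$ is semisimple, then $\mathrm{SupDiag}_{\ell+m}\notin\tau(\Lambda)$ for every such $\tau$. (ii) If $\rho$ is an $(\ell,m)$-extension of irreducible representations, then $\rho$ is nonsplit if and only if $\mathrm{SupDiag}_{\ell+m}\in\tau(\Lambda)$ for some such $\tau$. **(2) The test.** Assume that $K$ is the algebraic closure of $k$, and let $R=k\{X_1,\dots,X_s\}/\langle f_1,\dots,f_t\rangle$ be a finitely presented $k$-algebra. Let $P(n)$ be the least positive integer $p$ such that, for all $q\ge 1$ and all $a_1,\dots,a_q\in M_n(K)$, the $K$-algebra generated by $a_1,\dots,a_q$ is $K$-linearly spanned by the products of the $a_i$ of length at most $p$ (the empty product being the identity matrix). For $1\le r\le s$ let $b_r$ be the generic block upper triangular $(\ell+m)\times(\ell+m)$ matrix: its $(i,j)$ entry is an indeterminate $x_{ij}(r)$ if $i\le\ell$ or $j>\ell$, and is $0$ otherwise. One may, optionally, replace one of the $b_r$ by a generic upper triangular matrix (i.e. set $x_{ij}(r)=0$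 for $i>j$); the following holds with or without such a replacement. Let $U=U(\ell,m,s)$ be the set of all products $a_1^{i_1}\cdots a_p^{i_p}$ with $a_1,\dots,a_p\in\{I_{\ell+m},b_1,\dots,b_s\}$, $i_1+\cdots+i_p\le P(\ell+m)$ and $i_1,\dots,i_p<\ell+m$. Put $q=\ell^2+\ell m+m^2$, let $v,w,y_1,\dots,y_q$ be further indeterminates, and let $$s_\nu(a_1,\dots,a_\nu)=\sum_{\sigma\in S_\nu}\operatorname{sgn}(\sigma)\,a_{\sigma(1)}\cdots a_{\sigma(\nu)}\qquad(s_0=1)$$ be the standard polynomial. A *choice* consists of $\mathbf v_0\in\pi_\ell(U)$ and distinct $\mathbf v_1,\dots,\mathbf v_{2(\ell-1)}\in\pi_\ell(U)$, of $\mathbf w_0\in\pi_m(U)$ and distinct $\mathbf w_1,\dots,\mathbf w_{2(m-1)}\in\pi_m(U)$, and of distinct $\mathbf y_1,\dots,\mathbf y_q\in U$. Its system of commutative polynomials over $k$ consists of $$v\operatorname{trace}\bigl(\mathbf v_0\,s_{2(\ell-1)}(\mathbf v_1,\dots,\mathbf v_{2(\ell-1)})\bigr)-1,\qquad w\operatorname{trace}\bigl(\mathbf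 w_0\,s_{2(m-1)}(\mathbf w_1,\dots,\mathbf w_{2(m-1)})\bigr)-1,$$ the entries of $y_1\mathbf y_1+\cdots+y_q\mathbf y_q-\mathrm{SupDiag}_{\ell+m}$, and the entries of $f_j(b_1,\dots,b_s)$ for $1\le j\le t$. Then the set $U$ is finite, each of these systems is finite, and $R$ has a nonsplit $(\ell,m)$-extension of irreducible representations if and only if, for some choice, the system has a common zero with coordinates in $K$. **(3) Decidability.** Assume moreover that $k$ is a computable field. Then there is an algorithm which, given $s$, positive integers $\ell,m$ and a finite list $f_1,\dots,f_t\in k\{X_1,\dots,X_s\}$, each given as a finite list of terms (coefficient, word), decides whether $k\{X_1,\dots,X_s\}/\langle f_1,\dots,f_t\rangle$ has a nonsplit $(\ell,m)$-extension of irreducible representations over the algebraic closure $K$ of $k$. -/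

import Mathlib

namespace NonsplitTest

noncomputable section

/-! ### Block upper triangular matrices and representations -/

/-- The algebra of block upper triangular matrices with diagonal blocks of sizes `ℓ` and `m`. -/
def blockUpper (K : Type*) [Field K] (ℓ m : ℕ) :
    Subalgebra K (Matrix (Fin (ℓ + m)) (Fin (ℓ + m)) K) where
  carrier := {M | ∀ (i : Fin m) (j : Fin ℓ), M (Fin.natAdd ℓ i) (Fin.castAdd m j) = 0}
  mul_mem' := by
    intro M N hM hN i j
    rw [Matrix.mul_apply, Fin.sum_univ_add]
    simp only [Set.mem_ofPred_eq] at hM hN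
    simp [hM, hN]
  add_mem' := by
    intro M N hM hN i j
    simp only [Set.mem_ofPred_eq] at hM hN
    simp [hM, hN]
  algebraMap_mem' := by
    intro c i j
    rw [Matrix.algebraMap_matrix_apply, if_neg]
    intro h
    have := congrArg Fin.val h
    simp at this
    omega

/-- The upper left `ℓ × ℓ` block of a matrix of size `ℓ + m`. -/
def topLeft {S : Type*} {ℓ m : ℕ} (M : Matrix (Fin (ℓ + m)) (Fin (ℓ + m)) S) :
    Matrix (Fin ℓ) (Fin ℓ) S :=
  M.submatrix (Fin.castAdd m) (Fin.castAdd m)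

/-- The lower right `m × m` block of a matrix of size `ℓ + m`. -/
def bottomRight {S : Type*} {ℓ m : ℕ} (M : Matrix (Fin (ℓ + m)) (Fin (ℓ + m)) S) :
    Matrix (Fin m) (Fin m) S :=
  M.submatrix (Fin.natAdd ℓ) (Fin.natAdd ℓ)

theorem natAdd_ne_castAdd {ℓ m : ℕ} (i : Fin m) (j : Fin ℓ) :
    Fin.natAdd ℓ i ≠ Fin.castAdd m j := by
  intro h
  have := congrArg Fin.val h
  simp at this
  omega

/-- The projection of the block upper triangular algebra onto the upper left block. -/
def projTop (K : Type*) [Field K] (ℓ m : ℕ) :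
    blockUpper K ℓ m →ₐ[K] Matrix (Fin ℓ) (Fin ℓ) K :=
  AlgHom.ofLinearMap
    { toFun := fun M => topLeft M.1
      map_add' := fun _ _ => rfl
      map_smul' := fun _ _ => rfl }
    (by
      ext i j
      simp [topLeft, Matrix.one_apply])
    (by
      intro M N
      ext i j
      have hN : ∀ (i : Fin m) (j : Fin ℓ), N.1 (Fin.natAdd ℓ i) (Fin.castAdd m j) = 0 := N.2
      simp [topLeft, Matrix.mul_apply, Fin.sum_univ_add, hN])

/-- The projection of the block upper triangular algebra onto the lower right block. -/
def projBot (K : Type*) [Field K] (ℓ m : ℕ) :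
    blockUpper K ℓ m →ₐ[K] Matrix (Fin m) (Fin m) K :=
  AlgHom.ofLinearMap
    { toFun := fun M => bottomRight M.1
      map_add' := fun _ _ => rfl
      map_smul' := fun _ _ => rfl }
    (by
      ext i j
      simp [bottomRight, Matrix.one_apply])
    (by
      intro M N
      ext i j
      have hM : ∀ (i : Fin m) (j : Fin ℓ), M.1 (Fin.natAdd ℓ i) (Fin.castAdd m j) = 0 := M.2
      simp [bottomRight, Matrix.mul_apply, Fin.sum_univ_add, hM])

section Representations

variable {k K A : Type*} [Field k] [Field K] [Algebra k K] [Ring A] [Algebra k A]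

/-- `K ρ(A)`, the `K`-subalgebra of `M_n(K)` generated (equivalently `K`-linearly spanned, see
`imageAlgebra_toSubmodule`) by the image of the representation `ρ : A → M_n(K)`. -/
def imageAlgebra {n : ℕ} (ρ : A →ₐ[k] Matrix (Fin n) (Fin n) K) :
    Subalgebra K (Matrix (Fin n) (Fin n) K) :=
  Algebra.adjoin K (Set.range ρ)

theorem imageAlgebra_toSubmodule {n : ℕ} (ρ : A →ₐ[k] Matrix (Fin n) (Fin n) K) :
    Subalgebra.toSubmodule (imageAlgebra ρ) = Submodule.span K (Set.range ρ) := by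
  have h : (Submonoid.closure (Set.range ρ) : Set (Matrix (Fin n) (Fin n) K)) = Set.range ρ :=
    congrArg (fun S : Submonoid _ => (S : Set (Matrix (Fin n) (Fin n) K)))
      (Submonoid.closure_eq (MonoidHom.mrange (ρ : A →* Matrix (Fin n) (Fin n) K)))
  rw [imageAlgebra, Algebra.adjoin_eq_span, h]

/-- The representation `ρ : A → M_n(K)` is irreducible: `K ρ(A) = M_n(K)`. -/
def IsIrreducibleRep {n : ℕ} (ρ : A →ₐ[k] Matrix (Fin n) (Fin n) K) : Prop :=
  imageAlgebra ρ = ⊤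

/-- The representation `ρ : A → M_n(K)` is semisimple: `K ρ(A)` is a semisimple algebra. -/
def IsSemisimpleRep {n : ℕ} (ρ : A →ₐ[k] Matrix (Fin n) (Fin n) K) : Prop :=
  IsSemisimpleRing (imageAlgebra ρ)

variable {ℓ m : ℕ}

/-- A homomorphism into the block upper triangular algebra, as a representation in
`M_{ℓ+m}(K)`. -/
def toRep (ρ : A →ₐ[k] blockUpper K ℓ m) :
    A →ₐ[k] Matrix (Fin (ℓ + m)) (Fin (ℓ + m)) K :=
  ((blockUpper K ℓ m).val.restrictScalars k).comp ρ

/-- The representation afforded by the upper left block. -/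
def topRep (ρ : A →ₐ[k] blockUpper K ℓ m) : A →ₐ[k] Matrix (Fin ℓ) (Fin ℓ) K :=
  ((projTop K ℓ m).restrictScalars k).comp ρ

/-- The representation afforded by the lower right block. -/
def botRep (ρ : A →ₐ[k] blockUpper K ℓ m) : A →ₐ[k] Matrix (Fin m) (Fin m) K :=
  ((projBot K ℓ m).restrictScalars k).comp ρ

/-- `ρ` is an `(ℓ, m)`-extension of irreducible representations. -/
def IsExtensionOfIrreducibles (ρ : A →ₐ[k] blockUpper K ℓ m) : Prop :=
  IsIrreducibleRep (topRep ρ) ∧ IsIrreducibleRep (botRep ρ)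

end Representations

/-- `A` has a nonsplit `(ℓ, m)`-extension of irreducible representations over `K`. -/
def HasNonsplitExtension (k K A : Type*) [Field k] [Field K] [Algebra k K] [Ring A] [Algebra k A]
    (ℓ m : ℕ) : Prop :=
  ∃ ρ : A →ₐ[k] blockUpper K ℓ m, IsExtensionOfIrreducibles ρ ∧ ¬ IsSemisimpleRep (toRep ρ)

/-- The automorphism `τ` of `M_n(K)` is inner. -/
def IsInner {K : Type*} [Field K] {n : ℕ}
    (τ : Matrix (Fin n) (Fin n) K ≃ₐ[K] Matrix (Fin n) (Fin n) K) : Prop :=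
  ∃ Q : (Matrix (Fin n) (Fin n) K)ˣ, ∀ M, τ M = (Q : Matrix (Fin n) (Fin n) K) * M *
    ((Q⁻¹ : (Matrix (Fin n) (Fin n) K)ˣ) : Matrix (Fin n) (Fin n) K)

/-- The `n × n` matrix with ones on the superdiagonal and zeros elsewhere. -/
def supDiag (S : Type*) [Zero S] [One S] (n : ℕ) : Matrix (Fin n) (Fin n) S :=
  Matrix.of fun i j => if (i : ℕ) + 1 = (j : ℕ) then 1 else 0

/-- The finitely presented algebra `k{X_1, …, X_s} / ⟨f_1, …, f_t⟩`. -/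
abbrev FPAlgebra {k : Type*} [Field k] {s t : ℕ} (f : Fin t → FreeAlgebra k (Fin s)) : Type _ :=
  RingQuot (fun a b : FreeAlgebra k (Fin s) => (∃ j, a = f j) ∧ b = 0)

/-! ### The commutative polynomial systems -/

/-- Every `K`-algebra generated by finitely many matrices of size `n` is spanned by the products
of the generators that have length at most `P`. -/
def IsLengthBound (K : Type*) [Field K] (n P : ℕ) : Prop :=
  ∀ (q : ℕ) (_ : 0 < q) (a : Fin q → Matrix (Fin n) (Fin n) K),
    Submodule.span K {M | ∃ L : List (Fin q), L.length ≤ P ∧ M = (L.map a).prod} =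
      Subalgebra.toSubmodule (Algebra.adjoin K (Set.range a))

/-- The least positive length bound for `M_n(K)` (for `0 < n`, `max 1 (n ^ 2 - 1)` is one). -/
def lengthBound (K : Type*) [Field K] (n : ℕ) : ℕ :=
  sInf {P | 0 < P ∧ IsLengthBound K n P}

/-- The number `ℓ² + ℓm + m²`. -/
abbrev blockDim (ℓ m : ℕ) : ℕ := ℓ ^ 2 + ℓ * m + m ^ 2

/-- The commuting indeterminates: the entries `x_{ij}(r)` of the generic matrices, `v`, `w`, and
`y_1, …, y_q` with `q = ℓ² + ℓm + m²`. -/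
inductive Indet (ℓ m s : ℕ) : Type
  | x (r : Fin s) (i j : Fin (ℓ + m))
  | v
  | w
  | y (c : Fin (blockDim ℓ m))

/-- Matrices of size `n` over the commutative polynomial ring in the indeterminates above. -/
abbrev PolyMatrix (k : Type*) [Field k] (ℓ m s n : ℕ) : Type _ :=
  Matrix (Fin n) (Fin n) (MvPolynomial (Indet ℓ m s) k)

/-- The generic block upper triangular matrices `b_1, …, b_s` of size `ℓ + m`. If `r₀ = some r`,
then `b_r` is taken to be a generic upper triangular matrix instead. -/
def genericBlock (k : Type*) [Field k] (ℓ m s : ℕ) (r₀ : Option (Fin s)) (r : Fin s) :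
    PolyMatrix k ℓ m s (ℓ + m) :=
  Matrix.of fun i j =>
    if ((i : ℕ) < ℓ ∨ ℓ ≤ (j : ℕ)) ∧ (r₀ = some r → i ≤ j) then
      MvPolynomial.X (Indet.x r i j)
    else 0

/-- The set `U(ℓ, m, s)` of all products `a_1 ^ i_1 ⋯ a_p ^ i_p` with
`a_1, …, a_p ∈ {I, b_1, …, b_s}`, `i_1 + ⋯ + i_p ≤ P(ℓ + m)` and `i_1, …, i_p < ℓ + m`;
the list `L` consists of the pairs `(a_c, i_c)`. -/
def productSet (k K : Type*) [Field k] [Field K] (ℓ m s : ℕ) (r₀ : Option (Fin s)) :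
    Set (PolyMatrix k ℓ m s (ℓ + m)) :=
  {u | ∃ L : List (PolyMatrix k ℓ m s (ℓ + m) × ℕ),
    (∀ c ∈ L, c.1 ∈ insert 1 (Set.range (genericBlock k ℓ m s r₀)) ∧ c.2 < ℓ + m) ∧
    (L.map fun c => c.2).sum ≤ lengthBound K (ℓ + m) ∧
    u = (L.map fun c => c.1 ^ c.2).prod}

/-- The standard polynomial `s_ν` evaluated at `a_1, …, a_ν` (it is `1` for `ν = 0`). -/
def standardPoly {S : Type*} [Ring S] {ν : ℕ} (a : Fin ν → S) : S :=
  ∑ σ : Equiv.Perm (Fin ν), ((Equiv.Perm.sign σ : ℤˣ) : ℤ) • (List.ofFn fun i => a (σ i)).prod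

/-- The data chosen in one subtest: a product `v₀` and distinct products `v_1, …, v_{2(ℓ-1)}` in
`π_ℓ(U)`, a product `w₀` and distinct products `w_1, …, w_{2(m-1)}` in `π_m(U)`, and distinct
products `y_1, …, y_q` in `U`. -/
structure Choice (k K : Type*) [Field k] [Field K] (ℓ m s : ℕ) (r₀ : Option (Fin s)) where
  v₀ : PolyMatrix k ℓ m s ℓ
  v₀_mem : v₀ ∈ topLeft '' productSet k K ℓ m s r₀
  v : Fin (2 * (ℓ - 1)) → PolyMatrix k ℓ m s ℓ
  v_injective : Function.Injective v
  v_mem : ∀ i, v i ∈ topLeft '' productSet k K ℓ m s r₀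
  w₀ : PolyMatrix k ℓ m s m
  w₀_mem : w₀ ∈ bottomRight '' productSet k K ℓ m s r₀
  w : Fin (2 * (m - 1)) → PolyMatrix k ℓ m s m
  w_injective : Function.Injective w
  w_mem : ∀ i, w i ∈ bottomRight '' productSet k K ℓ m s r₀
  y : Fin (blockDim ℓ m) → PolyMatrix k ℓ m s (ℓ + m)
  y_injective : Function.Injective y
  y_mem : ∀ i, y i ∈ productSet k K ℓ m s r₀

/-- The set of entries of a matrix. -/
def entries {S : Type*} {n : ℕ} (M : Matrix (Fin n) (Fin n) S) : Set S :=
  {p | ∃ i j, p = M i j}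

/-- The system of commutative polynomials over `k` attached to a choice of products. -/
def testSystem {k K : Type*} [Field k] [Field K] {ℓ m s t : ℕ} {r₀ : Option (Fin s)}
    (f : Fin t → FreeAlgebra k (Fin s)) (c : Choice k K ℓ m s r₀) :
    Set (MvPolynomial (Indet ℓ m s) k) :=
  {MvPolynomial.X Indet.v * Matrix.trace (c.v₀ * standardPoly c.v) - 1} ∪
  {MvPolynomial.X Indet.w * Matrix.trace (c.w₀ * standardPoly c.w) - 1} ∪
  entries ((∑ i, (MvPolynomial.X (Indet.y i) : MvPolynomial (Indet ℓ m s) k) • c.y i) -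
    supDiag (MvPolynomial (Indet ℓ m s) k) (ℓ + m)) ∪
  ⋃ j, entries (FreeAlgebra.lift k (genericBlock k ℓ m s r₀) (f j))

/-- The polynomials in the set `F` have a common zero with coordinates in `K`. -/
def HasCommonZero {k : Type*} (K : Type*) [Field k] [Field K] [Algebra k K] {σ : Type*}
    (F : Set (MvPolynomial σ k)) : Prop :=
  ∃ z : σ → K, ∀ p ∈ F, MvPolynomial.aeval z p = 0

/-! ### Computable fields and encoded input -/

/-- A computable field: its elements are coded injectively by natural numbers in such a way that
addition and multiplication are computable. Negation and inversion are then computable as well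
(multiplication by `-1`, unbounded search). That the set of codes is primitive recursive, as
`Primcodable` asks, loses nothing: a coding with an infinite decidable set of codes can be
computably renumbered by all natural numbers, and a finite one by an initial segment. -/
structure IsComputableField (k : Type*) [Field k] [Primcodable k] : Prop where
  computable_add : Computable₂ (fun a b : k => a + b)
  computable_mul : Computable₂ (fun a b : k => a * b)

/-- The noncommutative polynomial `∑ a · X_{i_1} ⋯ X_{i_p}` given by the finite list of its terms
`(a, [i_1, …, i_p])`. -/
def ofTerms {k : Type*} [Field k] {s : ℕ} (F : List (k × List (Fin s))) :
    FreeAlgebra k (Fin s) :=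
  (F.map fun c => c.1 • (c.2.map (FreeAlgebra.ι k)).prod).sum

/-- Forgetting the bound `s` on the indices of the letters, so that inputs for all `s` lie in one
coded type. -/
def rawTerms {k : Type*} {s : ℕ} (F : List (List (k × List (Fin s)))) :
    List (List (k × List ℕ)) :=
  F.map fun g => g.map fun c => (c.1, c.2.map fun i => (i : ℕ))

end

end NonsplitTest

open NonsplitTest

/-! Splitting criterion. Let Λ be a subalgebra of E = E_(ℓ,m)(K) with full diagonal blocks. Its
elements with zero diagonal blocks form a sub-bimodule of the simple bimodule M_{ℓ×m}(K), so this
corner is 0 or everything (`corner_trivial_or_full`). If it is 0, then Λ embeds in M_ℓ(K) × M_m(K);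
it is isomorphic to M_ℓ(K) or to the whole product, hence semisimple. If it is everything, then Λ =
E, or the two diagonal blocks are tied by an isomorphism M_ℓ(K) ≅ M_m(K)
(`eq_blockUpper_or_twisted`). Such an isomorphism is a conjugation, so a block diagonal change of
basis makes the two blocks equal; as the diagonal blocks of SupDiag_{2ℓ} are equal, it lies in the
conjugated algebra (`exists_conj_supDiag_mem`). Conversely, suppose that Λ is semisimple and that
some conjugate of it lies in E and contains SupDiag. The span W of the first ℓ basis vectors then
has an invariant complement. A power of the shift SupDiag carries any nonzero vector of this
complement to a nonzero multiple of the first basis vector, which lies in W. So the complement is 0,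
which m > 0 forbids (`conj_ne_supDiag_of_isSemisimpleRing`).

The test. Over an algebraically closed field a proper subalgebra of M_n(K) has an invariant subspace
(Burnside). That subspace and its quotient have dimension at most n - 1, so s_{2(n-1)} vanishes on
both by Amitsur–Levitzki; then a₀ s_{2(n-1)}(a₁, …) is nilpotent and has trace 0. On a spanning set
of M_n(K) this trace is not identically zero, as the staircase e₀₀, e₀₁, e₁₁, … of matrix units
shows. Amitsur–Levitzki itself is proved by Rosset's argument in the exterior algebra
(`standardPoly_eq_zero_of_charZero`). The set U consists of the words of length at most P(ℓ+m) in
the b_r, so its values span the generated algebra. A common zero thus amounts to matrices that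
satisfy the relations, generate full diagonal blocks and have SupDiag in their algebra. The v_i and
w_i can be taken distinct because s_ν is alternating; finding q distinct y_i requires U to have at
least q elements (`blockDim_le_ncard`).

Decidability. A separate system is used here, with the entries of all words up to an explicit length
as variables; it needs neither P(n) nor a choice of products. Solvability of such systems over K is
decidable because it and its negation are both semidecidable. A zero with coordinates algebraic over
k yields commuting matrices over k through a regular representation, and commuting matrices yield a
zero by Zariski's lemma. If there is no zero, then 1 lies in the two-sided ideal of the free algebra
generated by the equations and the commutators of the letters, and an expression of 1 is a finite
certificate. -/

namespace NonsplitTest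

/-! ### Block triangular matrices and their blocks -/

section Blocks

variable {K : Type*} [Field K] {ℓ m : ℕ}

/-- The upper right `ℓ × m` block of a matrix of size `ℓ + m`. -/
def topRight {S : Type*} {ℓ m : ℕ} (M : Matrix (Fin (ℓ + m)) (Fin (ℓ + m)) S) :
    Matrix (Fin ℓ) (Fin m) S :=
  M.submatrix (Fin.castAdd m) (Fin.natAdd ℓ)

/-- The block upper triangular matrix with the given blocks. -/
def blockMatrix {S : Type*} [Zero S] {ℓ m : ℕ} (a : Matrix (Fin ℓ) (Fin ℓ) S)
    (b : Matrix (Fin ℓ) (Fin m) S) (d : Matrix (Fin m) (Fin m) S) :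
    Matrix (Fin (ℓ + m)) (Fin (ℓ + m)) S :=
  (Matrix.fromBlocks a b 0 d).submatrix finSumFinEquiv.symm finSumFinEquiv.symm

theorem topLeft_blockMatrix {S : Type*} [Zero S] (a : Matrix (Fin ℓ) (Fin ℓ) S)
    (b : Matrix (Fin ℓ) (Fin m) S) (d : Matrix (Fin m) (Fin m) S) :
    topLeft (blockMatrix a b d) = a := by
  ext i j; simp [topLeft, blockMatrix]

theorem topRight_blockMatrix {S : Type*} [Zero S] (a : Matrix (Fin ℓ) (Fin ℓ) S)
    (b : Matrix (Fin ℓ) (Fin m) S) (d : Matrix (Fin m) (Fin m) S) :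
    topRight (blockMatrix a b d) = b := by
  ext i j; simp [topRight, blockMatrix]

theorem bottomRight_blockMatrix {S : Type*} [Zero S] (a : Matrix (Fin ℓ) (Fin ℓ) S)
    (b : Matrix (Fin ℓ) (Fin m) S) (d : Matrix (Fin m) (Fin m) S) :
    bottomRight (blockMatrix a b d) = d := by
  ext i j; simp [bottomRight, blockMatrix]

theorem mem_blockUpper {M : Matrix (Fin (ℓ + m)) (Fin (ℓ + m)) K} :
    M ∈ blockUpper K ℓ m ↔
      ∀ (i : Fin m) (j : Fin ℓ), M (Fin.natAdd ℓ i) (Fin.castAdd m j) = 0 :=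
  Iff.rfl

theorem blockMatrix_mem (a : Matrix (Fin ℓ) (Fin ℓ) K) (b : Matrix (Fin ℓ) (Fin m) K)
    (d : Matrix (Fin m) (Fin m) K) : blockMatrix a b d ∈ blockUpper K ℓ m := by
  intro i j; simp [blockMatrix]

theorem ext_blocks {M N : Matrix (Fin (ℓ + m)) (Fin (ℓ + m)) K} (hM : M ∈ blockUpper K ℓ m)
    (hN : N ∈ blockUpper K ℓ m) (h₁ : topLeft M = topLeft N) (h₂ : topRight M = topRight N)
    (h₃ : bottomRight M = bottomRight N) : M = N := by
  ext i j
  refine Fin.addCases (fun i => ?_) (fun i => ?_) i <;>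
    refine Fin.addCases (fun j => ?_) (fun j => ?_) j
  · exact congrFun (congrFun h₁ i) j
  · exact congrFun (congrFun h₂ i) j
  · rw [mem_blockUpper.1 hM, mem_blockUpper.1 hN]
  · exact congrFun (congrFun h₃ i) j

theorem blockMatrix_eta {M : Matrix (Fin (ℓ + m)) (Fin (ℓ + m)) K} (hM : M ∈ blockUpper K ℓ m) :
    blockMatrix (topLeft M) (topRight M) (bottomRight M) = M :=
  ext_blocks (blockMatrix_mem _ _ _) hM (topLeft_blockMatrix _ _ _) (topRight_blockMatrix _ _ _)
    (bottomRight_blockMatrix _ _ _)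

theorem blockMatrix_mul (a a' : Matrix (Fin ℓ) (Fin ℓ) K) (b b' : Matrix (Fin ℓ) (Fin m) K)
    (d d' : Matrix (Fin m) (Fin m) K) :
    blockMatrix a b d * blockMatrix a' b' d' =
      blockMatrix (a * a') (a * b' + b * d') (d * d') := by
  simp [blockMatrix, Matrix.submatrix_mul_equiv, Matrix.fromBlocks_multiply]

theorem blockMatrix_one :
    blockMatrix (1 : Matrix (Fin ℓ) (Fin ℓ) K) 0 (1 : Matrix (Fin m) (Fin m) K) = 1 := by
  simp [blockMatrix]

theorem blockMatrix_smul (c : K) (a : Matrix (Fin ℓ) (Fin ℓ) K) (b : Matrix (Fin ℓ) (Fin m) K)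
    (d : Matrix (Fin m) (Fin m) K) :
    c • blockMatrix a b d = blockMatrix (c • a) (c • b) (c • d) := by
  ext i j
  refine Fin.addCases (fun i => ?_) (fun i => ?_) i <;>
    refine Fin.addCases (fun j => ?_) (fun j => ?_) j <;> simp [blockMatrix]

theorem blockMatrix_add (a a' : Matrix (Fin ℓ) (Fin ℓ) K) (b b' : Matrix (Fin ℓ) (Fin m) K)
    (d d' : Matrix (Fin m) (Fin m) K) :
    blockMatrix a b d + blockMatrix a' b' d' =
      blockMatrix (a + a') (b + b') (d + d') := by
  ext i j
  refine Fin.addCases (fun i => ?_) (fun i => ?_) i <;>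
    refine Fin.addCases (fun j => ?_) (fun j => ?_) j <;> simp [blockMatrix]

theorem topLeft_mul {M N : Matrix (Fin (ℓ + m)) (Fin (ℓ + m)) K}
    (hN : N ∈ blockUpper K ℓ m) : topLeft (M * N) = topLeft M * topLeft N := by
  ext i j
  simp [topLeft, Matrix.mul_apply, Fin.sum_univ_add, mem_blockUpper.1 hN]

theorem bottomRight_mul {M N : Matrix (Fin (ℓ + m)) (Fin (ℓ + m)) K}
    (hM : M ∈ blockUpper K ℓ m) : bottomRight (M * N) = bottomRight M * bottomRight N := by
  ext i j
  simp [bottomRight, Matrix.mul_apply, Fin.sum_univ_add, mem_blockUpper.1 hM]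

/-- The block diagonal unit with the given diagonal blocks. -/
def blockUnit (g : (Matrix (Fin ℓ) (Fin ℓ) K)ˣ) (h : (Matrix (Fin m) (Fin m) K)ˣ) :
    (Matrix (Fin (ℓ + m)) (Fin (ℓ + m)) K)ˣ where
  val := blockMatrix g.1 0 h.1
  inv := blockMatrix g⁻¹.1 0 h⁻¹.1
  val_inv := by rw [blockMatrix_mul]; simp [blockMatrix_one]
  inv_val := by rw [blockMatrix_mul]; simp [blockMatrix_one]

theorem blockUnit_conj (g : (Matrix (Fin ℓ) (Fin ℓ) K)ˣ) (h : (Matrix (Fin m) (Fin m) K)ˣ)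
    (a : Matrix (Fin ℓ) (Fin ℓ) K) (b : Matrix (Fin ℓ) (Fin m) K) (d : Matrix (Fin m) (Fin m) K) :
    (blockUnit g h).1 * blockMatrix a b d * (blockUnit g h)⁻¹.1 =
      blockMatrix (g.1 * a * g⁻¹.1) (g.1 * b * h⁻¹.1) (h.1 * d * h⁻¹.1) := by
  change blockMatrix g.1 0 h.1 * blockMatrix a b d * blockMatrix g⁻¹.1 0 h⁻¹.1 = _
  rw [blockMatrix_mul, blockMatrix_mul]
  simp

theorem supDiag_mem_blockUpper : supDiag K (ℓ + m) ∈ blockUpper K ℓ m := by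
  intro i j
  have := j.2
  simp only [supDiag, Matrix.of_apply, Fin.val_natAdd, Fin.val_castAdd, ite_eq_right_iff]
  omega

/-- A set of matrices stable under multiplication on both sides is everything once it contains
a nonzero matrix. -/
theorem eq_top_of_stable {p q : ℕ} (S : Submodule K (Matrix (Fin p) (Fin q) K))
    (hl : ∀ a : Matrix (Fin p) (Fin p) K, ∀ x ∈ S, a * x ∈ S)
    (hr : ∀ a : Matrix (Fin q) (Fin q) K, ∀ x ∈ S, x * a ∈ S)
    {x : Matrix (Fin p) (Fin q) K} (hx : x ∈ S) (hx0 : x ≠ 0) : S = ⊤ := by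
  obtain ⟨i, j, hij⟩ : ∃ i j, x i j ≠ 0 := by
    by_contra! h
    exact hx0 (Matrix.ext h)
  rw [eq_top_iff]
  intro y _
  rw [Matrix.matrix_eq_sum_single y]
  refine S.sum_mem fun u _ => S.sum_mem fun v _ => ?_
  -- Sandwiching between matrix units isolates one entry: e_{ui} x e_{jv} = x_{ij} e_{uv}.
  have h := S.smul_mem (y u v * (x i j)⁻¹)
    (hr (Matrix.single j v 1) _ (hl (Matrix.single u i 1) x hx))
  rw [Matrix.single_mul_mul_single, Matrix.smul_single] at h
  simpa [hij] using h

end Blocks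

end NonsplitTest

namespace NonsplitTest

/-! ### Subalgebras of the block triangular algebra with full diagonal blocks -/

section Structure

variable {K : Type*} [Field K] {ℓ m : ℕ}
  {Λ : Subalgebra K (Matrix (Fin (ℓ + m)) (Fin (ℓ + m)) K)}

/-- An element of Λ acts on a corner matrix from the left through its upper left block and from the
right through its lower right block. Both blocks are arbitrary, so the corner of Λ is a sub-bimodule
of the simple bimodule M_{ℓ×m}(K). -/
theorem corner_trivial_or_full (hΛ : Λ ≤ blockUpper K ℓ m)
    (hT : ∀ a, ∃ M ∈ Λ, topLeft M = a) (hB : ∀ d, ∃ M ∈ Λ, bottomRight M = d) :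
    (∀ M ∈ Λ, topLeft M = 0 → bottomRight M = 0 → M = 0) ∨
      ∀ x : Matrix (Fin ℓ) (Fin m) K, blockMatrix 0 x 0 ∈ Λ := by
  let S : Submodule K (Matrix (Fin ℓ) (Fin m) K) :=
    { carrier := {x | blockMatrix 0 x 0 ∈ Λ}
      add_mem' := fun {x y} hx hy => by
        simpa [blockMatrix_add] using Λ.add_mem hx hy
      zero_mem' := by
        have : blockMatrix (0 : Matrix (Fin ℓ) (Fin ℓ) K) 0 (0 : Matrix (Fin m) (Fin m) K) = 0 := by
          simp [blockMatrix]
        simp [this]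
      smul_mem' := fun c x hx => by
        simpa [blockMatrix_smul] using Λ.smul_mem hx c }
  have hS : ∀ x, x ∈ S ↔ blockMatrix 0 x 0 ∈ Λ := fun x => Iff.rfl
  by_cases h : ∃ M ∈ Λ, topLeft M = 0 ∧ bottomRight M = 0 ∧ M ≠ 0
  · right
    obtain ⟨M, hM, h₁, h₂, h₃⟩ := h
    have hM' := blockMatrix_eta (hΛ hM)
    rw [h₁, h₂] at hM'
    have htop : S = ⊤ := by
      refine eq_top_of_stable S ?_ ?_ (x := topRight M) ?_ ?_
      · intro a x hx
        obtain ⟨N, hN, rfl⟩ := hT a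
        have := Λ.mul_mem hN hx
        rw [← blockMatrix_eta (hΛ hN), blockMatrix_mul] at this
        simpa [hS] using this
      · intro a x hx
        obtain ⟨N, hN, rfl⟩ := hB a
        have := Λ.mul_mem hx hN
        rw [← blockMatrix_eta (hΛ hN), blockMatrix_mul] at this
        simpa [hS] using this
      · rw [hS, hM']; exact hM
      · intro h0
        rw [h0] at hM'
        exact h₃ (by rw [← hM']; simp [blockMatrix])
    intro x
    rw [← hS, htop]
    trivial
  · left
    push Not at h
    exact h

/-- The kernel of the first block projection maps onto a two-sided ideal of the simple algebra
M_m(K). -/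
theorem bottom_determined_or_free (hΛ : Λ ≤ blockUpper K ℓ m)
    (hB : ∀ d, ∃ M ∈ Λ, bottomRight M = d) :
    (∀ M ∈ Λ, topLeft M = 0 → bottomRight M = 0) ∨
      ∀ d, ∃ M ∈ Λ, topLeft M = 0 ∧ bottomRight M = d := by
  let S : Submodule K (Matrix (Fin m) (Fin m) K) :=
    { carrier := {d | ∃ M ∈ Λ, topLeft M = 0 ∧ bottomRight M = d}
      add_mem' := by
        rintro x y ⟨M, hM, h₁, rfl⟩ ⟨N, hN, h₂, rfl⟩
        refine ⟨M + N, Λ.add_mem hM hN, ?_, rfl⟩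
        change topLeft M + topLeft N = 0
        rw [h₁, h₂, add_zero]
      zero_mem' := ⟨0, Λ.zero_mem, rfl, rfl⟩
      smul_mem' := by
        rintro c x ⟨M, hM, h₁, rfl⟩
        refine ⟨c • M, Λ.smul_mem hM c, ?_, rfl⟩
        change c • topLeft M = 0
        rw [h₁, smul_zero] }
  by_cases h : ∃ M ∈ Λ, topLeft M = 0 ∧ bottomRight M ≠ 0
  · right
    obtain ⟨M, hM, h₁, h₂⟩ := h
    have htop : S = ⊤ := by
      refine eq_top_of_stable S ?_ ?_ (x := bottomRight M) ⟨M, hM, h₁, rfl⟩ h₂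
      · rintro a x ⟨L, hL, h₁, rfl⟩
        obtain ⟨N, hN, rfl⟩ := hB a
        refine ⟨N * L, Λ.mul_mem hN hL, ?_, bottomRight_mul (hΛ hN)⟩
        rw [topLeft_mul (hΛ hL), h₁, mul_zero]
      · rintro a x ⟨L, hL, h₁, rfl⟩
        obtain ⟨N, hN, rfl⟩ := hB a
        refine ⟨L * N, Λ.mul_mem hL hN, ?_, bottomRight_mul (hΛ hL)⟩
        rw [topLeft_mul (hΛ hN), h₁, zero_mul]
    intro d
    have : d ∈ S := by rw [htop]; trivial
    exact this
  · left
    push Not at h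
    exact h

/-- With trivial corner the two block projections are jointly injective. By the preceding dichotomy,
either the first projection alone is an isomorphism onto M_ℓ(K), or both together give M_ℓ(K) ×
M_m(K). -/
theorem isSemisimpleRing_of_corner_trivial (hΛ : Λ ≤ blockUpper K ℓ m)
    (hT : ∀ a, ∃ M ∈ Λ, topLeft M = a) (hB : ∀ d, ∃ M ∈ Λ, bottomRight M = d)
    (h : ∀ M ∈ Λ, topLeft M = 0 → bottomRight M = 0 → M = 0) : IsSemisimpleRing Λ := by
  let pT : Λ →ₐ[K] Matrix (Fin ℓ) (Fin ℓ) K := (projTop K ℓ m).comp (Subalgebra.inclusion hΛ)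
  let pB : Λ →ₐ[K] Matrix (Fin m) (Fin m) K := (projBot K ℓ m).comp (Subalgebra.inclusion hΛ)
  have hpT : ∀ M : Λ, pT M = topLeft M.1 := fun _ => rfl
  have hpB : ∀ M : Λ, pB M = bottomRight M.1 := fun _ => rfl
  rcases bottom_determined_or_free hΛ hB with h' | h'
  · have hbij : Function.Bijective pT := by
      refine ⟨(injective_iff_map_eq_zero pT).2 fun M hM => ?_, fun a => ?_⟩
      · exact Subtype.ext (h M.1 M.2 hM (h' M.1 M.2 hM))
      · obtain ⟨M, hM, rfl⟩ := hT a
        exact ⟨⟨M, hM⟩, rfl⟩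
    exact (RingEquiv.ofBijective pT hbij).symm.isSemisimpleRing
  · have hbij : Function.Bijective (pT.prod pB) := by
      refine ⟨(injective_iff_map_eq_zero _).2 fun M hM => ?_, fun ⟨a, d⟩ => ?_⟩
      · have h1 : pT M = 0 := congrArg Prod.fst hM
        have h2 : pB M = 0 := congrArg Prod.snd hM
        exact Subtype.ext (h M.1 M.2 h1 h2)
      · obtain ⟨M, hM, rfl⟩ := hT a
        obtain ⟨N, hN, h₁, h₂⟩ := h' (d - bottomRight M)
        refine ⟨⟨M + N, Λ.add_mem hM hN⟩, Prod.ext ?_ ?_⟩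
        · change topLeft M + topLeft N = topLeft M
          rw [h₁, add_zero]
        · change bottomRight M + bottomRight N = d
          rw [h₂, add_sub_cancel]
    exact (RingEquiv.ofBijective (pT.prod pB) hbij).symm.isSemisimpleRing

/-- A subalgebra of the block triangular algebra that has full diagonal blocks and is not
semisimple is the whole block triangular algebra, or consists of all block triangular matrices
whose second diagonal block is determined by the first one through an isomorphism. -/
theorem eq_blockUpper_or_twisted (hℓ : 0 < ℓ) (hm : 0 < m) (hΛ : Λ ≤ blockUpper K ℓ m)
    (hT : ∀ a, ∃ M ∈ Λ, topLeft M = a) (hB : ∀ d, ∃ M ∈ Λ, bottomRight M = d)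
    (hns : ¬ IsSemisimpleRing Λ) :
    Λ = blockUpper K ℓ m ∨
      ∃ e : Matrix (Fin ℓ) (Fin ℓ) K ≃ₐ[K] Matrix (Fin m) (Fin m) K,
        ∀ M, M ∈ Λ ↔ M ∈ blockUpper K ℓ m ∧ bottomRight M = e (topLeft M) := by
  have hJ : ∀ x : Matrix (Fin ℓ) (Fin m) K, blockMatrix 0 x 0 ∈ Λ :=
    (corner_trivial_or_full hΛ hT hB).resolve_left fun h =>
      hns (isSemisimpleRing_of_corner_trivial hΛ hT hB h)
  -- As the whole corner lies in Λ, membership in Λ depends on the diagonal blocks only.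
  have key : ∀ M ∈ blockUpper K ℓ m, ∀ N ∈ Λ, topLeft N = topLeft M →
      bottomRight N = bottomRight M → M ∈ Λ := by
    intro M hM N hN h₁ h₂
    have : M = N + blockMatrix 0 (topRight M - topRight N) 0 := by
      rw [← blockMatrix_eta (hΛ hN), blockMatrix_add, topRight_blockMatrix, ← blockMatrix_eta hM,
        topRight_blockMatrix, h₁, h₂]
      simp
    rw [this]
    exact Λ.add_mem hN (hJ _)
  rcases bottom_determined_or_free hΛ hB with h' | h'
  · right
    choose f hfΛ hf using hT
    have hdet : ∀ M ∈ Λ, ∀ N ∈ Λ, topLeft M = topLeft N → bottomRight M = bottomRight N := by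
      intro M hM N hN h
      refine sub_eq_zero.1 (h' (M - N) (Λ.sub_mem hM hN) ?_)
      change topLeft M - topLeft N = 0
      rw [h, sub_self]
    -- `f a` is an arbitrary lift of `a`. Since `hdet` makes its lower block independent of the
    -- lift, sums and products of lifts may be used to verify the axioms.
    let e₀ : Matrix (Fin ℓ) (Fin ℓ) K →ₐ[K] Matrix (Fin m) (Fin m) K :=
      AlgHom.ofLinearMap
        { toFun := fun a => bottomRight (f a)
          map_add' := fun a b => hdet (f (a + b)) (hfΛ _) (f a + f b)
            (Λ.add_mem (hfΛ _) (hfΛ _)) (by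
              change _ = topLeft (f a) + topLeft (f b)
              rw [hf, hf, hf])
          map_smul' := fun c a => hdet (f (c • a)) (hfΛ _) (c • f a)
            (Λ.smul_mem (hfΛ _) c) (by
              change _ = c • topLeft (f a)
              rw [hf, hf]) }
        ((hdet (f 1) (hfΛ _) 1 Λ.one_mem (by
          rw [hf]; exact (map_one (projTop K ℓ m)).symm)).trans (map_one (projBot K ℓ m)))
        (fun a b => (hdet (f (a * b)) (hfΛ _) (f a * f b) (Λ.mul_mem (hfΛ _) (hfΛ _)) (by
          rw [topLeft_mul (hΛ (hfΛ _)), hf, hf, hf])).trans (bottomRight_mul (hΛ (hfΛ _))))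
    have he₀ : ∀ M ∈ Λ, e₀ (topLeft M) = bottomRight M := fun M hM =>
      hdet _ (hfΛ _) M hM (hf _)
    have : NeZero ℓ := ⟨hℓ.ne'⟩
    have : NeZero m := ⟨hm.ne'⟩
    have hbij : Function.Bijective e₀ := by
      refine ⟨RingHom.injective e₀.toRingHom, fun d => ?_⟩
      obtain ⟨M, hM, rfl⟩ := hB d
      exact ⟨_, he₀ M hM⟩
    refine ⟨AlgEquiv.ofBijective e₀ hbij, fun M => ⟨fun hM => ⟨hΛ hM, (he₀ M hM).symm⟩, ?_⟩⟩
    rintro ⟨hM, h⟩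
    exact key M hM (f (topLeft M)) (hfΛ _) (hf _) h.symm
  · left
    refine le_antisymm hΛ fun M hM => ?_
    obtain ⟨N, hN, h₁⟩ := hT (topLeft M)
    obtain ⟨L, hL, h₂, h₃⟩ := h' (bottomRight M - bottomRight N)
    refine key M hM (N + L) (Λ.add_mem hN hL) ?_ ?_
    · change topLeft N + topLeft L = _
      rw [h₁, h₂, add_zero]
    · change bottomRight N + bottomRight L = _
      rw [h₃, add_sub_cancel]

/-- Isomorphic matrix algebras have the same size, and the isomorphism is a conjugation. -/
theorem algEquiv_matrix_eq_conj {p q : ℕ}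
    (e : Matrix (Fin p) (Fin p) K ≃ₐ[K] Matrix (Fin q) (Fin q) K) :
    ∃ (A : Matrix (Fin q) (Fin p) K) (B : Matrix (Fin p) (Fin q) K),
      A * B = 1 ∧ B * A = 1 ∧ p = q ∧ ∀ M, e M = A * M * B := by
  -- Transported to endomorphism algebras, an isomorphism is conjugation by a linear equivalence `T`
  -- (Skolem–Noether); A and B are the matrices of `T` and its inverse.
  obtain ⟨T, hT⟩ := AlgEquiv.eq_linearEquivConjAlgEquiv
    ((Matrix.toLinAlgEquiv' (R := K) (n := Fin p)).symm.trans
      (e.trans (Matrix.toLinAlgEquiv' (R := K) (n := Fin q))))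
  refine ⟨LinearMap.toMatrix' T.toLinearMap, LinearMap.toMatrix' T.symm.toLinearMap, ?_, ?_, ?_, ?_⟩
  · rw [← LinearMap.toMatrix'_comp]; simp
  · rw [← LinearMap.toMatrix'_comp]; simp
  · simpa using T.finrank_eq
  · intro M
    have h := congrArg (fun F => F (Matrix.toLinAlgEquiv' M)) hT
    simp only [AlgEquiv.trans_apply, AlgEquiv.symm_apply_apply] at h
    apply (Matrix.toLinAlgEquiv' (R := K) (n := Fin q)).injective
    rw [h]
    change _ = Matrix.toLin' _
    rw [Matrix.toLin'_mul, Matrix.toLin'_mul, Matrix.toLin'_toMatrix', Matrix.toLin'_toMatrix']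
    rfl

/-- A nonsemisimple subalgebra with full diagonal blocks contains the superdiagonal matrix after a
block diagonal change of basis, which may be chosen so as to bring the diagonal blocks of one
given element to any form available by conjugation. -/
theorem exists_conj_supDiag_mem (hℓ : 0 < ℓ) (hm : 0 < m) (hΛ : Λ ≤ blockUpper K ℓ m)
    (hT : ∀ a, ∃ M ∈ Λ, topLeft M = a) (hB : ∀ d, ∃ M ∈ Λ, bottomRight M = d)
    (hns : ¬ IsSemisimpleRing Λ) (P : ∀ n : ℕ, Matrix (Fin n) (Fin n) K → Prop)
    (hP : ∀ (n : ℕ) (M : Matrix (Fin n) (Fin n) K),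
      ∃ g : (Matrix (Fin n) (Fin n) K)ˣ, P n (g.1 * M * g⁻¹.1))
    {X : Matrix (Fin (ℓ + m)) (Fin (ℓ + m)) K} (hX : X ∈ Λ) :
    ∃ (g : (Matrix (Fin ℓ) (Fin ℓ) K)ˣ) (h : (Matrix (Fin m) (Fin m) K)ˣ),
      (∃ M ∈ Λ, (blockUnit g h).1 * M * (blockUnit g h)⁻¹.1 = supDiag K (ℓ + m)) ∧
      P ℓ (g.1 * topLeft X * g⁻¹.1) ∧ P m (h.1 * bottomRight X * h⁻¹.1) := by
  rcases eq_blockUpper_or_twisted hℓ hm hΛ hT hB hns with h | ⟨e, he⟩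
  · obtain ⟨g, hg⟩ := hP ℓ (topLeft X)
    obtain ⟨h', hh'⟩ := hP m (bottomRight X)
    refine ⟨g, h', ⟨(blockUnit g h')⁻¹.1 * supDiag K (ℓ + m) * (blockUnit g h').1, ?_, ?_⟩, hg, hh'⟩
    · rw [h]
      refine (blockUpper K ℓ m).mul_mem ((blockUpper K ℓ m).mul_mem ?_ supDiag_mem_blockUpper) ?_
      · exact blockMatrix_mem _ _ _
      · exact blockMatrix_mem _ _ _
    · simp [mul_assoc]
  · obtain ⟨A, B, hAB, hBA, rfl, hconj⟩ := algEquiv_matrix_eq_conj e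
    obtain ⟨g, hg⟩ := hP ℓ (topLeft X)
    let Q : (Matrix (Fin ℓ) (Fin ℓ) K)ˣ := ⟨A, B, hAB, hBA⟩
    have hQ : Q⁻¹.1 = B := rfl
    have hQ' : Q⁻¹⁻¹.1 = A := rfl
    -- Here the lower block is Q a Q⁻¹ when the upper one is a. Conjugating it by g Q⁻¹ gives g a
    -- g⁻¹, so the two diagonal blocks of the conjugated algebra agree. This puts SupDiag in that
    -- algebra and makes one choice of g serve both instances of `P`.
    refine ⟨g, g * Q⁻¹, ⟨(blockUnit g (g * Q⁻¹))⁻¹.1 * supDiag K (ℓ + ℓ) *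
      (blockUnit g (g * Q⁻¹)).1, ?_, by simp [mul_assoc]⟩, hg, ?_⟩
    · have hS := blockMatrix_eta (supDiag_mem_blockUpper (K := K) (ℓ := ℓ) (m := ℓ))
      have hSS : bottomRight (supDiag K (ℓ + ℓ)) = topLeft (ℓ := ℓ) (m := ℓ) (supDiag K (ℓ + ℓ)) := by
        ext i j
        simp only [bottomRight, topLeft, supDiag, Matrix.submatrix_apply, Matrix.of_apply,
          Fin.val_natAdd, Fin.val_castAdd]
        congr 1
        simp only [eq_iff_iff]
        omega
      rw [hSS] at hS
      have hinv : (blockUnit g (g * Q⁻¹))⁻¹ = blockUnit g⁻¹ (Q * g⁻¹) := by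
        rw [inv_eq_iff_mul_eq_one]
        apply Units.ext
        change blockMatrix _ _ _ * blockMatrix _ _ _ = 1
        rw [blockMatrix_mul]
        have h1 : g * Q⁻¹ * (Q * g⁻¹) = 1 := by group
        rw [← Units.val_mul, ← Units.val_mul, h1]
        simp [blockMatrix_one]
      have hdouble : (blockUnit g (g * Q⁻¹)).1 = ((blockUnit g⁻¹ (Q * g⁻¹))⁻¹).1 := by
        rw [← hinv, inv_inv]
      rw [he, hinv, hdouble, ← hS, blockUnit_conj]
      refine ⟨blockMatrix_mem _ _ _, ?_⟩
      rw [topLeft_blockMatrix, bottomRight_blockMatrix, hconj]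
      simp [Q, mul_assoc]
    · have h := ((he X).1 hX).2
      rw [h, hconj]
      have : (g * Q⁻¹).1 * (A * topLeft X * B) * (g * Q⁻¹)⁻¹.1 = g.1 * topLeft X * g⁻¹.1 := by
        rw [mul_inv_rev, Units.val_mul, Units.val_mul, hQ, hQ']
        calc _ = g.1 * (B * A) * topLeft X * (B * A) * g⁻¹.1 := by simp only [mul_assoc]
          _ = _ := by rw [hBA]; simp [mul_assoc]
      rw [this]
      exact hg

end Structure

end NonsplitTest

namespace NonsplitTest

/-! ### The splitting criterion -/

section Splitting

variable {k K A : Type*} [Field k] [Field K] [Algebra k K] [Ring A] [Algebra k A] {ℓ m : ℕ}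

theorem supDiag_pow_mulVec {n : ℕ} (v : Fin n → K) (i : ℕ) (j : Fin n) :
    ((supDiag K n) ^ i).mulVec v j = if h : (j : ℕ) + i < n then v ⟨j + i, h⟩ else 0 := by
  induction i generalizing j with
  | zero => simp
  | succ i ih =>
    rw [pow_succ', ← Matrix.mulVec_mulVec, Matrix.mulVec, dotProduct]
    simp only [supDiag, Matrix.of_apply, ite_mul, one_mul, zero_mul]
    by_cases hj : (j : ℕ) + 1 < n
    · rw [Finset.sum_eq_single ⟨j + 1, hj⟩]
      · simp only [if_true]
        rw [← supDiag, ih]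
        simp only [add_assoc, add_comm 1 i]
      · intro b _ hb
        rw [if_neg]
        intro h
        exact hb (Fin.ext h.symm)
      · simp
    · rw [Finset.sum_eq_zero, dif_neg (by omega)]
      intro b _
      rw [if_neg]
      have := b.2
      omega

/-- A subspace stable under the action of a semisimple ring has a stable complement. -/
theorem exists_stable_isCompl {R V : Type*} [Ring R] [IsSemisimpleRing R] [AddCommGroup V]
    [Module K V] (φ : R →+* Module.End K V) (W : AddSubgroup V)
    (hW : ∀ r, ∀ v ∈ W, φ r v ∈ W) :
    ∃ W' : AddSubgroup V, (∀ r, ∀ v ∈ W', φ r v ∈ W') ∧ W ⊓ W' = ⊥ ∧ W ⊔ W' = ⊤ := by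
  let _ : Module R V := Module.compHom V φ
  let S : Submodule R V := { W with smul_mem' := fun r v hv => hW r v hv }
  obtain ⟨S', hS'⟩ := exists_isCompl S
  refine ⟨S'.toAddSubgroup, fun r v hv => S'.smul_mem r hv, ?_, ?_⟩
  · rw [eq_bot_iff]
    rintro v ⟨h₁, h₂⟩
    exact Submodule.disjoint_def.1 hS'.disjoint v h₁ h₂
  · rw [eq_top_iff]
    intro v _
    have : v ∈ S ⊔ S' := by rw [hS'.sup_eq_top]; trivial
    obtain ⟨y, hy, z, hz, rfl⟩ := Submodule.mem_sup.1 this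
    exact AddSubgroup.add_mem_sup hy hz

/-- A semisimple algebra of matrices cannot, in any basis, both consist of block upper triangular
matrices and contain the superdiagonal matrix. -/
theorem conj_ne_supDiag_of_isSemisimpleRing (hℓ : 0 < ℓ) (hm : 0 < m)
    {Λ : Subalgebra K (Matrix (Fin (ℓ + m)) (Fin (ℓ + m)) K)} (hs : IsSemisimpleRing Λ)
    (Q : (Matrix (Fin (ℓ + m)) (Fin (ℓ + m)) K)ˣ)
    (hQ : ∀ M ∈ Λ, Q.1 * M * Q⁻¹.1 ∈ blockUpper K ℓ m)
    {M : Matrix (Fin (ℓ + m)) (Fin (ℓ + m)) K} (hM : M ∈ Λ) :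
    Q.1 * M * Q⁻¹.1 ≠ supDiag K (ℓ + m) := by
  intro hMS
  let φ : Λ →+* Module.End K (Fin (ℓ + m) → K) :=
    { toFun := fun N => Matrix.toLin' (Q.1 * N.1 * Q⁻¹.1)
      map_one' := by
        simp only [OneMemClass.coe_one, mul_one, Units.mul_inv, Matrix.toLin'_one]
        rfl
      map_mul' := fun N L => by
        have : Q.1 * (N.1 * L.1) * Q⁻¹.1 = (Q.1 * N.1 * Q⁻¹.1) * (Q.1 * L.1 * Q⁻¹.1) := by
          simp [mul_assoc]
        change Matrix.toLin' (Q.1 * (N.1 * L.1) * Q⁻¹.1) = _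
        rw [this, Matrix.toLin'_mul]
        rfl
      map_zero' := by simp
      map_add' := fun N L => by
        change Matrix.toLin' (Q.1 * (N.1 + L.1) * Q⁻¹.1) = _
        rw [mul_add, add_mul, map_add] }
  have hφ : ∀ (N : Λ) (v : Fin (ℓ + m) → K), φ N v = (Q.1 * N.1 * Q⁻¹.1).mulVec v :=
    fun N v => Matrix.toLin'_apply (Q.1 * N.1 * Q⁻¹.1) v
  -- The span of the first ℓ basis vectors, invariant under all block upper triangular matrices.
  let W : AddSubgroup (Fin (ℓ + m) → K) :=
    { carrier := {v | ∀ i : Fin m, v (Fin.natAdd ℓ i) = 0}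
      add_mem' := fun {v w} hv hw i => by
        rw [Pi.add_apply, hv i, hw i, add_zero]
      zero_mem' := fun i => rfl
      neg_mem' := fun {v} hv i => by
        rw [Pi.neg_apply, hv i, neg_zero] }
  obtain ⟨W', hstab, hinf, hsup⟩ := exists_stable_isCompl φ W fun N v hv i => by
    rw [hφ, Matrix.mulVec, dotProduct, Fin.sum_univ_add]
    have h1 := mem_blockUpper.1 (hQ N.1 N.2)
    have h2 : ∀ i : Fin m, v (Fin.natAdd ℓ i) = 0 := hv
    simp only [h1, h2, zero_mul, mul_zero, Finset.sum_const_zero, add_zero]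
  have hW'0 : W' = ⊥ := by
    rw [AddSubgroup.eq_bot_iff_forall]
    intro v hv
    by_contra hv0
    have hex : ∃ i, ∃ h : i < ℓ + m, v ⟨i, h⟩ ≠ 0 := by
      by_contra! h
      exact hv0 (funext fun i => h i.1 i.2)
    let p : ℕ → Prop := fun i => ∃ h : i < ℓ + m, v ⟨i, h⟩ ≠ 0
    classical
    obtain ⟨i, hi⟩ := hex
    -- The last nonzero coordinate of v. The a-th power of the shift brings it to position 0 and
    -- kills everything after it; since ℓ > 0, the result lies in W.
    let a := Nat.findGreatest p (ℓ + m)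
    have ha : p a := Nat.findGreatest_spec (P := p) (le_of_lt hi.1) hi
    have hmax : ∀ j, a < j → ∀ h : j < ℓ + m, v ⟨j, h⟩ = 0 := by
      intro j hj h
      by_contra hne
      exact Nat.findGreatest_is_greatest (P := p) hj (le_of_lt h) ⟨h, hne⟩
    have hpow : φ ((⟨M, hM⟩ : Λ) ^ a) v = ((supDiag K (ℓ + m)) ^ a).mulVec v := by
      rw [hφ]
      congr 1
      rw [← hMS]
      exact (Units.conj_pow Q M a).symm
    have h1 : φ ((⟨M, hM⟩ : Λ) ^ a) v ∈ W' := hstab _ _ hv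
    have h2 : φ ((⟨M, hM⟩ : Λ) ^ a) v ∈ W := by
      intro j
      rw [hpow, supDiag_pow_mulVec]
      split_ifs with h
      · refine hmax _ ?_ _
        simp only [Fin.val_natAdd]
        omega
      · rfl
    have h3 : φ ((⟨M, hM⟩ : Λ) ^ a) v = 0 := by
      have h : _ ∈ W ⊓ W' := ⟨h2, h1⟩
      rwa [hinf] at h
    rw [hpow] at h3
    obtain ⟨ha', ha⟩ := ha
    have h4 := congrFun h3 ⟨0, by omega⟩
    rw [supDiag_pow_mulVec, dif_pos (by simpa using ha')] at h4
    simp only [zero_add, Pi.zero_apply] at h4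
    exact ha h4
  have hWtop : W = ⊤ := by
    rwa [hW'0, sup_bot_eq] at hsup
  have : (Pi.single (Fin.natAdd ℓ ⟨0, hm⟩) 1 : Fin (ℓ + m) → K) ∈ W := by rw [hWtop]; trivial
  have := this ⟨0, hm⟩
  simp at this

theorem imageAlgebra_toRep_le (ρ : A →ₐ[k] blockUpper K ℓ m) :
    imageAlgebra (toRep ρ) ≤ blockUpper K ℓ m := by
  refine Algebra.adjoin_le ?_
  rintro _ ⟨a, rfl⟩
  exact (ρ a).2

theorem range_subset_imageAlgebra {n : ℕ} (ρ : A →ₐ[k] Matrix (Fin n) (Fin n) K) (a : A) :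
    ρ a ∈ imageAlgebra ρ :=
  Algebra.subset_adjoin ⟨a, rfl⟩

/-- The block projections are multiplicative only on block triangular matrices, so `f` is defined on
the image algebra alone; inside itself that algebra is still generated by the values of `ρ`. -/
theorem map_imageAlgebra_eq {n p : ℕ} (ρ : A →ₐ[k] Matrix (Fin n) (Fin n) K)
    (ρ' : A →ₐ[k] Matrix (Fin p) (Fin p) K)
    (f : imageAlgebra ρ →ₐ[K] Matrix (Fin p) (Fin p) K)
    (hf : ∀ a, f ⟨ρ a, range_subset_imageAlgebra ρ a⟩ = ρ' a) :
    f.range = imageAlgebra ρ' := by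
  have h : (⊤ : Subalgebra K (imageAlgebra ρ)) =
      Algebra.adjoin K (Set.range fun a => ⟨ρ a, range_subset_imageAlgebra ρ a⟩) := by
    have := Algebra.adjoin_adjoin_coe_preimage (R := K) (s := Set.range ρ)
    refine this.symm.trans ?_
    congr 1
    ext ⟨x, hx⟩
    constructor
    · rintro ⟨a, rfl⟩
      exact ⟨a, rfl⟩
    · rintro ⟨a, h⟩
      exact ⟨a, congrArg Subtype.val h⟩
  rw [← Algebra.map_top, h, AlgHom.map_adjoin]
  change _ = Algebra.adjoin K (Set.range ρ')
  congr 1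
  ext x
  simp [hf]

theorem exists_topLeft_eq_iff (ρ : A →ₐ[k] blockUpper K ℓ m) (a : Matrix (Fin ℓ) (Fin ℓ) K) :
    (∃ M ∈ imageAlgebra (toRep ρ), topLeft M = a) ↔ a ∈ imageAlgebra (topRep ρ) := by
  rw [← map_imageAlgebra_eq (toRep ρ) (topRep ρ)
    ((projTop K ℓ m).comp (Subalgebra.inclusion (imageAlgebra_toRep_le ρ))) fun _ => rfl]
  constructor
  · rintro ⟨M, hM, rfl⟩
    exact ⟨⟨M, hM⟩, rfl⟩
  · rintro ⟨⟨M, hM⟩, rfl⟩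
    exact ⟨M, hM, rfl⟩

theorem exists_bottomRight_eq_iff (ρ : A →ₐ[k] blockUpper K ℓ m)
    (d : Matrix (Fin m) (Fin m) K) :
    (∃ M ∈ imageAlgebra (toRep ρ), bottomRight M = d) ↔ d ∈ imageAlgebra (botRep ρ) := by
  rw [← map_imageAlgebra_eq (toRep ρ) (botRep ρ)
    ((projBot K ℓ m).comp (Subalgebra.inclusion (imageAlgebra_toRep_le ρ))) fun _ => rfl]
  constructor
  · rintro ⟨M, hM, rfl⟩
    exact ⟨⟨M, hM⟩, rfl⟩
  · rintro ⟨⟨M, hM⟩, rfl⟩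
    exact ⟨M, hM, rfl⟩

theorem supDiag_notMem_of_isSemisimpleRep (hℓ : 0 < ℓ) (hm : 0 < m)
    (ρ : A →ₐ[k] blockUpper K ℓ m) (hρ : IsSemisimpleRep (toRep ρ))
    (τ : Matrix (Fin (ℓ + m)) (Fin (ℓ + m)) K ≃ₐ[K] Matrix (Fin (ℓ + m)) (Fin (ℓ + m)) K)
    (hτ : IsInner τ) (hE : ∀ M ∈ blockUpper K ℓ m, τ M ∈ blockUpper K ℓ m) :
    ¬ ∃ M ∈ imageAlgebra (toRep ρ), τ M = supDiag K (ℓ + m) := by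
  rintro ⟨M, hM, h⟩
  obtain ⟨Q, hQ⟩ := hτ
  refine conj_ne_supDiag_of_isSemisimpleRing hℓ hm hρ Q (fun N hN => ?_) hM (by rw [← hQ, h])
  rw [← hQ]
  exact hE _ (imageAlgebra_toRep_le ρ hN)

theorem not_isSemisimpleRep_iff (hℓ : 0 < ℓ) (hm : 0 < m)
    (ρ : A →ₐ[k] blockUpper K ℓ m) (hρ : IsExtensionOfIrreducibles ρ) :
    ¬ IsSemisimpleRep (toRep ρ) ↔
      ∃ τ : Matrix (Fin (ℓ + m)) (Fin (ℓ + m)) K ≃ₐ[K] Matrix (Fin (ℓ + m)) (Fin (ℓ + m)) K,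
        IsInner τ ∧ (∀ M ∈ blockUpper K ℓ m, τ M ∈ blockUpper K ℓ m) ∧
          ∃ M ∈ imageAlgebra (toRep ρ), τ M = supDiag K (ℓ + m) := by
  constructor
  · intro hns
    obtain ⟨g, h, ⟨M, hM, hMS⟩, -, -⟩ := exists_conj_supDiag_mem hℓ hm (imageAlgebra_toRep_le ρ)
      (fun a => (exists_topLeft_eq_iff ρ a).2 (by rw [hρ.1]; trivial))
      (fun d => (exists_bottomRight_eq_iff ρ d).2 (by rw [hρ.2]; trivial)) hns
      -- No normal form is needed here; the predicate serves only for making a chosen generator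
      -- triangular in the test.
      (fun _ _ => True) (fun _ _ => ⟨1, trivial⟩) (one_mem _)
    refine ⟨MulSemiringAction.toAlgEquiv K _ (ConjAct.toConjAct (blockUnit g h)),
      ⟨blockUnit g h, fun N => rfl⟩, ?_, M, hM, hMS⟩
    intro N hN
    rw [← blockMatrix_eta hN]
    change (blockUnit g h).1 * _ * (blockUnit g h)⁻¹.1 ∈ _
    rw [blockUnit_conj]
    exact blockMatrix_mem _ _ _
  · rintro ⟨τ, hτ, hE, h⟩ hss
    exact supDiag_notMem_of_isSemisimpleRep hℓ hm ρ hss τ hτ hE h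

end Splitting

end NonsplitTest

namespace NonsplitTest

/-! ### The Amitsur–Levitzki theorem -/

section AmitsurLevitzki

open Matrix Polynomial

/-- Differentiating det(X - B) column by column replaces the i-th column by the i-th basis vector,
which leaves the i-th diagonal entry of the adjugate. -/
theorem derivative_charpoly_eq_trace_adjugate {S : Type*} [CommRing S] {n : ℕ}
    (B : Matrix (Fin n) (Fin n) S) :
    derivative B.charpoly = trace (adjugate (charmatrix B)) := by
  have hadj : ∀ i, adjugate (charmatrix B) i i =
      det ((charmatrix B).updateCol i (Pi.single i 1)) := by
    intro i
    have h : adjugate (charmatrix B) i i = adjugate (charmatrix B)ᵀ i i := by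
      rw [← adjugate_transpose]; rfl
    rw [h, adjugate_def, of_apply, cramer_apply, transpose_transpose]
  rw [trace, charpoly, det_apply']
  simp only [diag_apply, hadj, det_apply']
  rw [Finset.sum_comm, derivative_sum]
  refine Finset.sum_congr rfl fun σ _ => ?_
  rw [← Finset.mul_sum, derivative_mul, derivative_intCast, zero_mul, zero_add,
    derivative_prod_finset]
  congr 1
  refine Finset.sum_congr rfl fun i _ => ?_
  rw [← Finset.mul_prod_erase _ _ (Finset.mem_univ i), mul_comm]
  congr 1
  · rw [updateCol_self, charmatrix_apply]
    by_cases h : σ i = i <;> simp [h, diagonal]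
  · refine Finset.prod_congr rfl fun j hj => ?_
    rw [updateCol_ne (Finset.ne_of_mem_erase hj)]

/-- Over a torsion-free commutative ring, a matrix all of whose powers have trace zero is
nilpotent. -/
theorem pow_eq_zero_of_trace_pow_eq_zero {S : Type*} [CommRing S]
    (htf : ∀ a : ℕ, a ≠ 0 → ∀ x : S, (a : S) * x = 0 → x = 0) {n : ℕ}
    (B : Matrix (Fin n) (Fin n) S) (hB : ∀ a, 0 < a → trace (B ^ a) = 0) : B ^ n = 0 := by
  nontriviality S
  -- The adjugate of X - B as a polynomial with matrix coefficients. Comparing coefficients in (X -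
  -- B) · adj(X - B) = χ_B gives the recursion `hsucc` and its end `hzero`.
  set p : (Matrix (Fin n) (Fin n) S)[X] := matPolyEquiv (adjugate (charmatrix B)) with hp
  have hmul : (X - C B) * p = B.charpoly.map (algebraMap S (Matrix (Fin n) (Fin n) S)) := by
    rw [← matPolyEquiv_charmatrix, hp, ← map_mul, mul_adjugate, ← matPolyEquiv_smul_one]
    rfl
  have hsucc : ∀ a, p.coeff a = B * p.coeff (a + 1) + algebraMap S _ (B.charpoly.coeff (a + 1)) := by
    intro a
    have h := congrArg (fun q => q.coeff (a + 1)) hmul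
    simp only [sub_mul, coeff_sub, coeff_X_mul, coeff_C_mul, coeff_map] at h
    rw [← h]
    abel
  have hzero : B * p.coeff 0 + algebraMap S _ (B.charpoly.coeff 0) = 0 := by
    have h := congrArg (fun q => q.coeff 0) hmul
    simp only [sub_mul, coeff_sub, mul_coeff_zero, coeff_X_zero, zero_mul, coeff_C_zero,
      coeff_map] at h
    rw [← h]
    abel
  have htr : ∀ a, trace (p.coeff a) = ((a + 1 : ℕ) : S) * B.charpoly.coeff (a + 1) := by
    intro a
    have h := congrArg (fun q => q.coeff a) (derivative_charpoly_eq_trace_adjugate B)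
    simp only [coeff_derivative, trace, diag_apply, finsetSum_coeff] at h
    rw [trace]
    simp only [diag_apply, hp, matPolyEquiv_coeff_apply]
    rw [← h]
    push_cast
    ring
  -- Descending induction on `a` along the recursion, starting above the degree; each step adds a
  -- multiple of the trace of a positive power of B.
  have htr' : ∀ a b, 0 < b → trace (B ^ b * p.coeff a) = 0 := by
    suffices h : ∀ d a, p.natDegree < a + d → ∀ b, 0 < b → trace (B ^ b * p.coeff a) = 0 from
      fun a => h (p.natDegree + 1) a (by omega)
    intro d
    induction d with
    | zero =>
      intro a ha b _
      rw [coeff_eq_zero_of_natDegree_lt (by omega : p.natDegree < a)]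
      simp
    | succ d ih =>
      intro a ha b hb
      rw [hsucc, mul_add, ← mul_assoc, ← pow_succ, trace_add,
        ih (a + 1) (by omega) _ (Nat.succ_pos _), ← Algebra.commutes, ← Algebra.smul_def,
        trace_smul, hB b hb, smul_zero, add_zero]
  have hcoeff : ∀ a, a ≠ n → B.charpoly.coeff a = 0 := by
    intro a han
    rcases lt_or_gt_of_ne han with h | h
    -- Newton's identity: the trace of the coefficient of X^(a-1) in the adjugate is a c_a by the
    -- derivative formula and n c_a by the recursion. For a = 0 the recursion's last equation takes
    -- its place.
    · have key : ((n - a : ℕ) : S) * B.charpoly.coeff a = 0 := by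
        cases a with
        | zero =>
          have h1 := congrArg trace hzero
          rw [trace_add, Algebra.algebraMap_eq_smul_one, trace_smul, trace_one,
            Fintype.card_fin, trace_zero] at h1
          have h2 := htr' 0 1 one_pos
          rw [pow_one] at h2
          rw [h2, zero_add, smul_eq_mul, mul_comm] at h1
          simpa using h1
        | succ a =>
          have h1 := congrArg trace (hsucc a)
          rw [htr a, trace_add, Algebra.algebraMap_eq_smul_one, trace_smul, trace_one,
            Fintype.card_fin] at h1
          have h2 := htr' (a + 1) 1 one_pos
          rw [pow_one] at h2
          rw [h2, zero_add, smul_eq_mul] at h1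
          rw [Nat.cast_sub h.le, sub_mul, h1]
          ring
      exact htf _ (by omega) _ key
    · exact coeff_eq_zero_of_natDegree_lt (by rw [charpoly_natDegree_eq_dim]; simpa using h)
  have hX : B.charpoly = X ^ n := by
    ext a
    rw [coeff_X_pow]
    split_ifs with h
    · have h1 := B.charpoly_monic.coeff_natDegree
      rw [charpoly_natDegree_eq_dim, Fintype.card_fin] at h1
      rw [h, h1]
    · exact hcoeff a h
  have := aeval_self_charpoly B
  rwa [hX, map_pow, aeval_X] at this

/-- Meant for even elements of the exterior algebra: the ambient ring is not commutative, but the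
subalgebra that holds the entries becomes a commutative ring to which the previous statement
applies. -/
theorem pow_eq_zero_of_trace_pow_eq_zero_of_mem {R G : Type*} [CommRing R] [Ring G] [Algebra R G]
    (htf : ∀ a : ℕ, a ≠ 0 → ∀ x : G, (a : G) * x = 0 → x = 0) (S : Subalgebra R G)
    (hcomm : ∀ x ∈ S, ∀ y ∈ S, x * y = y * x) {n : ℕ} (B : Matrix (Fin n) (Fin n) G)
    (hmem : ∀ i j, B i j ∈ S) (hB : ∀ a, 0 < a → trace (B ^ a) = 0) : B ^ n = 0 := by
  let _ : CommRing S := { (inferInstance : Ring S) with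
    mul_comm := fun x y => Subtype.ext (hcomm x.1 x.2 y.1 y.2) }
  let f : S →+* G := S.val.toRingHom
  let B' : Matrix (Fin n) (Fin n) S := Matrix.of fun i j => ⟨B i j, hmem i j⟩
  have hB' : f.mapMatrix B' = B := rfl
  have h : B' ^ n = 0 := by
    refine pow_eq_zero_of_trace_pow_eq_zero ?_ B' ?_
    · intro a ha x hx
      apply Subtype.ext
      refine htf a ha _ ?_
      have := congrArg f hx
      rwa [map_mul, map_natCast, map_zero] at this
    · intro a ha
      apply Subtype.ext
      have := hB a ha
      rw [← hB', ← map_pow] at this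
      have h : f (trace (B' ^ a)) = 0 := (map_sum f _ _).trans this
      exact h
  rw [← hB', ← map_pow, h, map_zero]

/-! ### Even elements of the exterior algebra and matrices of degree one elements -/

section Exterior

variable {R V : Type*} [CommRing R] [AddCommGroup V] [Module R V]

theorem ι_mul_ι_eq_neg (x y : V) :
    ExteriorAlgebra.ι R x * ExteriorAlgebra.ι R y =
      -(ExteriorAlgebra.ι R y * ExteriorAlgebra.ι R x) :=
  eq_neg_of_add_eq_zero_left (ExteriorAlgebra.ι_add_mul_swap x y)

/-- The subalgebra of even elements of the exterior algebra. -/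
def evenPart (R V : Type*) [CommRing R] [AddCommGroup V] [Module R V] :
    Subalgebra R (ExteriorAlgebra R V) :=
  Algebra.adjoin R {g | ∃ x y, g = ExteriorAlgebra.ι R x * ExteriorAlgebra.ι R y}

theorem ι_mul_ι_mem_evenPart (x y : V) :
    ExteriorAlgebra.ι R x * ExteriorAlgebra.ι R y ∈ evenPart R V :=
  Algebra.subset_adjoin ⟨x, y, rfl⟩

/-- Moving a vector past a product of two vectors changes the sign twice. -/
theorem commute_ι_of_mem_evenPart {e : ExteriorAlgebra R V} (he : e ∈ evenPart R V) (x : V) :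
    ExteriorAlgebra.ι R x * e = e * ExteriorAlgebra.ι R x := by
  have h : evenPart R V ≤ Subalgebra.centralizer R {ExteriorAlgebra.ι R x} := by
    refine Algebra.adjoin_le ?_
    rintro _ ⟨y, z, rfl⟩
    rw [SetLike.mem_coe, Subalgebra.mem_centralizer_iff]
    rintro _ rfl
    rw [← mul_assoc, ι_mul_ι_eq_neg x y, neg_mul, mul_assoc, ι_mul_ι_eq_neg x z, mul_neg, neg_neg,
      mul_assoc]
  exact (Subalgebra.mem_centralizer_iff R).1 (h he) _ rfl

theorem commute_of_mem_evenPart {e f : ExteriorAlgebra R V} (he : e ∈ evenPart R V)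
    (hf : f ∈ evenPart R V) : e * f = f * e := by
  have h : evenPart R V ≤ Subalgebra.centralizer R {f} := by
    refine Algebra.adjoin_le ?_
    rintro _ ⟨y, z, rfl⟩
    rw [SetLike.mem_coe, Subalgebra.mem_centralizer_iff]
    rintro _ rfl
    rw [← mul_assoc, ← commute_ι_of_mem_evenPart hf, mul_assoc, ← commute_ι_of_mem_evenPart hf,
      mul_assoc]
  exact ((Subalgebra.mem_centralizer_iff R).1 (h he) _ rfl).symm

/-- A square matrix of size `n` whose entries lie in the degree one part of the exterior algebra of
a free module over a domain of characteristic zero has vanishing `2n`-th power. -/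
theorem pow_two_mul_eq_zero_of_ι [IsDomain R] [CharZero R] [Module.Free R (ExteriorAlgebra R V)]
    {n : ℕ} (v : Fin n → Fin n → V) :
    (Matrix.of fun i j => ExteriorAlgebra.ι R (v i j)) ^ (2 * n) = 0 := by
  set A : Matrix (Fin n) (Fin n) (ExteriorAlgebra R V) :=
    Matrix.of fun i j => ExteriorAlgebra.ι R (v i j) with hA
  have htf : ∀ a : ℕ, a ≠ 0 → ∀ x : ExteriorAlgebra R V, (a : ExteriorAlgebra R V) * x = 0 →
      x = 0 := by
    intro a ha x hx
    rw [← nsmul_eq_mul, ← Nat.cast_smul_eq_nsmul R, smul_eq_zero] at hx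
    simpa [ha] using hx
  have hsq : ∀ i j, (A ^ 2) i j ∈ evenPart R V := by
    intro i j
    rw [sq, mul_apply]
    exact Subalgebra.sum_mem _ fun c _ => ι_mul_ι_mem_evenPart _ _
  have hpow : ∀ a i j, ((A ^ 2) ^ a) i j ∈ evenPart R V := by
    intro a
    induction a with
    | zero =>
      intro i j
      rw [pow_zero, one_apply]
      split_ifs
      · exact Subalgebra.one_mem _
      · exact Subalgebra.zero_mem _
    | succ a ih =>
      intro i j
      rw [pow_succ, mul_apply]
      exact Subalgebra.sum_mem _ fun c _ => Subalgebra.mul_mem _ (ih _ _) (hsq _ _)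
  rw [pow_mul]
  refine pow_eq_zero_of_trace_pow_eq_zero_of_mem htf (evenPart R V)
    (fun x hx y hy => commute_of_mem_evenPart hx hy) _ hsq fun a ha => ?_
  obtain ⟨b, rfl⟩ : ∃ b, a = b + 1 := ⟨a - 1, by omega⟩
  -- The entries of A are odd and those of A · (A²)^b are odd times even, so exchanging them under
  -- the trace costs a sign. Both products equal A^(2b+2), hence twice its trace is 0.
  have h1 : trace (A * (A * (A ^ 2) ^ b)) = -trace ((A * (A ^ 2) ^ b) * A) := by
    simp only [trace, diag_apply, mul_apply (M := A) (N := A * (A ^ 2) ^ b),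
      mul_apply (M := A * (A ^ 2) ^ b) (N := A)]
    rw [Finset.sum_comm, ← Finset.sum_neg_distrib]
    refine Finset.sum_congr rfl fun i _ => ?_
    rw [← Finset.sum_neg_distrib]
    refine Finset.sum_congr rfl fun j _ => ?_
    rw [mul_apply, Finset.mul_sum, Finset.sum_mul, ← Finset.sum_neg_distrib]
    refine Finset.sum_congr rfl fun c _ => ?_
    simp only [hA, of_apply]
    rw [← hA, ← mul_assoc, ι_mul_ι_eq_neg, neg_mul, mul_assoc,
      commute_ι_of_mem_evenPart (hpow _ _ _), mul_assoc]
  have h2 : A * (A ^ 2) ^ b * A = A * (A * (A ^ 2) ^ b) := by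
    rw [← pow_mul, ← pow_succ', ← pow_succ, ← pow_succ']
  have h3 : (A ^ 2) ^ (b + 1) = A * (A * (A ^ 2) ^ b) := by
    rw [pow_succ', sq, mul_assoc]
  rw [h2, eq_neg_iff_add_eq_zero, ← two_mul] at h1
  rw [h3]
  exact htf 2 two_ne_zero _ (by exact_mod_cast h1)

end Exterior

theorem list_prod_map_smul {R G : Type*} [CommRing R] [Ring G] [Algebra R G] {n ν : ℕ}
    (a : Fin ν → Matrix (Fin n) (Fin n) R) (e : Fin ν → G) (L : List (Fin ν)) (i j : Fin n) :
    (L.map fun c => (Matrix.of fun p q => a c p q • e c : Matrix (Fin n) (Fin n) G)).prod i j =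
      (L.map a).prod i j • (L.map e).prod := by
  induction L generalizing i j with
  | nil => by_cases h : i = j <;> simp [one_apply, h]
  | cons c L ih =>
    simp only [List.map_cons, List.prod_cons]
    rw [mul_apply, mul_apply, Finset.sum_smul]
    refine Finset.sum_congr rfl fun b _ => ?_
    rw [ih, of_apply, smul_mul_smul_comm]

/-- Rosset's argument. Multiply a_c by the basis vector e_c and raise the sum to the ν-th power.
Terms with a repeated index vanish, and a permutation σ contributes its sign, so the coefficient of
e_1 ∧ … ∧ e_ν is s_ν(a). The power itself is 0, as the sum is an n × n matrix of degree one elements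
and 2n ≤ ν. -/
theorem standardPoly_eq_zero_of_charZero {R : Type*} [CommRing R] [IsDomain R] [CharZero R]
    {n ν : ℕ} (h : 2 * n ≤ ν) (a : Fin ν → Matrix (Fin n) (Fin n) R) : standardPoly a = 0 := by
  have : Module.Free R (ExteriorAlgebra R (Fin ν → R)) :=
    Module.Free.of_basis (Pi.basisFun R (Fin ν)).ExteriorAlgebra
  let e : Fin ν → (Fin ν → R) := fun i => Pi.single i 1
  let x : Fin ν → Matrix (Fin n) (Fin n) (ExteriorAlgebra R (Fin ν → R)) :=
    fun c => Matrix.of fun p q => a c p q • ExteriorAlgebra.ι R (e c)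
  have hsum : (Matrix.of fun i j => ExteriorAlgebra.ι R (fun c => a c i j)) = ∑ c, x c := by
    ext i j
    rw [Matrix.sum_apply]
    simp only [x, of_apply]
    simp only [← map_smul, ← map_sum]
    congr 1
    ext c
    simp [e, Finset.sum_apply, Pi.single_apply]
  have hzero : (∑ c, x c) ^ ν = 0 := by
    rw [← hsum]
    exact pow_eq_zero_of_le h (pow_two_mul_eq_zero_of_ι _)
  have hexp : (∑ c, x c) ^ ν = ∑ f : Fin ν → Fin ν, (List.ofFn fun i => x (f i)).prod := by
    have h1 := (MultilinearMap.mkPiAlgebraFin R ν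
      (Matrix (Fin n) (Fin n) (ExteriorAlgebra R (Fin ν → R)))).map_sum (fun _ c => x c)
    simpa [MultilinearMap.mkPiAlgebraFin_apply, List.ofFn_const] using h1
  have hterm : ∀ (f : Fin ν → Fin ν) i j, (List.ofFn fun c => x (f c)).prod i j =
      (List.ofFn fun c => a (f c)).prod i j • ExteriorAlgebra.ιMulti R ν (e ∘ f) := by
    intro f i j
    have h1 := list_prod_map_smul a (fun c => ExteriorAlgebra.ι R (e c)) (List.ofFn f) i j
    simp only [List.map_ofFn] at h1
    rw [ExteriorAlgebra.ιMulti_apply]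
    exact h1
  ext i j
  have h0 : ∑ f : Fin ν → Fin ν,
      (List.ofFn fun c => a (f c)).prod i j • ExteriorAlgebra.ιMulti R ν (e ∘ f) = 0 := by
    simp only [← hterm]
    rw [← Matrix.sum_apply, ← hexp, hzero]
    rfl
  have h1 : ∑ σ : Equiv.Perm (Fin ν), (List.ofFn fun c => a (σ c)).prod i j •
      ExteriorAlgebra.ιMulti R ν (e ∘ σ) = 0 := by
    rw [← h0]
    refine Finset.sum_of_injOn (fun σ : Equiv.Perm (Fin ν) => (σ : Fin ν → Fin ν))
      (fun _ _ _ _ h => DFunLike.coe_injective h) (by simp) ?_ (fun _ _ => rfl)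
    intro f _ hf
    rw [ExteriorAlgebra.ιMulti_eq_zero_of_not_inj, smul_zero]
    intro hinj
    have hf' : Function.Injective f := fun p q hpq => hinj (congrArg e hpq)
    refine hf ⟨Equiv.ofBijective f (Finite.injective_iff_bijective.1 hf'), by simp, rfl⟩
  -- The determinant in degree ν, extended by 0 to the other degrees, reads off the coefficient of
  -- e_1 ∧ … ∧ e_ν.
  let φ : ExteriorAlgebra R (Fin ν → R) →ₗ[R] R :=
    ExteriorAlgebra.liftAlternating (R := R) (Pi.single ν Matrix.detRowAlternating)
  have hφ : φ (ExteriorAlgebra.ιMulti R ν e) = 1 := by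
    rw [ExteriorAlgebra.liftAlternating_apply_ιMulti, Pi.single_eq_same]
    have : Matrix.of e = 1 := by
      ext p q
      simp [e, Matrix.one_apply, Pi.single_apply, eq_comm]
    change Matrix.det (Matrix.of e) = 1
    rw [this, det_one]
  have h2 := congrArg φ h1
  rw [map_sum, map_zero] at h2
  rw [standardPoly, Matrix.sum_apply, Matrix.zero_apply, ← h2]
  refine Finset.sum_congr rfl fun σ _ => ?_
  rw [AlternatingMap.map_perm, map_smul, Units.smul_def, map_zsmul, hφ]
  simp [Matrix.smul_apply, mul_comm]

theorem map_standardPoly {S T : Type*} [Ring S] [Ring T] (f : S →+* T) {ν : ℕ} (a : Fin ν → S) :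
    f (standardPoly a) = standardPoly fun i => f (a i) := by
  simp only [standardPoly, map_sum, map_zsmul, map_list_prod, List.map_ofFn]
  rfl

/-- The **Amitsur–Levitzki theorem**: the standard polynomial of degree at least `2n` vanishes on
matrices of size `n` over a commutative ring. -/
theorem standardPoly_eq_zero {R : Type*} [CommRing R] {n ν : ℕ} (h : 2 * n ≤ ν)
    (a : Fin ν → Matrix (Fin n) (Fin n) R) : standardPoly a = 0 := by
  -- Generic matrices over ℤ[x], a domain of characteristic zero, specialize to the given ones.
  let g : Fin ν → Matrix (Fin n) (Fin n) (MvPolynomial (Fin ν × Fin n × Fin n) ℤ) :=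
    fun c => Matrix.of fun i j => MvPolynomial.X (c, i, j)
  let f : MvPolynomial (Fin ν × Fin n × Fin n) ℤ →+* R :=
    (MvPolynomial.aeval fun c => a c.1 c.2.1 c.2.2).toRingHom
  have hfg : ∀ c, f.mapMatrix (g c) = a c := by
    intro c
    ext i j
    simp [f, g]
  have h1 := congrArg f.mapMatrix (standardPoly_eq_zero_of_charZero h g)
  rw [map_standardPoly, map_zero] at h1
  simpa only [hfg] using h1

end AmitsurLevitzki

end NonsplitTest

namespace NonsplitTest

/-! ### Burnside's theorem and detection of proper subalgebras by the standard polynomial -/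

section Burnside

variable {K : Type*} [Field K]

theorem standardPoly_end_eq_zero {V : Type*} [AddCommGroup V] [Module K V]
    [FiniteDimensional K V] {ν : ℕ} (h : 2 * Module.finrank K V ≤ ν)
    (a : Fin ν → Module.End K V) : standardPoly a = 0 := by
  let e : Module.End K V ≃ₐ[K] Matrix (Fin (Module.finrank K V)) (Fin (Module.finrank K V)) K :=
    LinearMap.toMatrixAlgEquiv (Module.finBasis K V)
  apply e.injective
  rw [map_zero]
  exact (map_standardPoly e.toAlgHom.toRingHom a).trans (standardPoly_eq_zero h _)

/-- **Burnside's theorem**: over an algebraically closed field, an algebra of endomorphisms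
without proper nonzero invariant subspaces contains all endomorphisms. -/
theorem surjective_of_isSimpleModule [IsAlgClosed K] {R V : Type*} [Ring R] [Algebra K R]
    [AddCommGroup V] [Module K V] [FiniteDimensional K V] [Module R V] [IsScalarTower K R V]
    [IsSimpleModule R V] (f : Module.End K V) : ∃ r : R, ∀ v : V, r • v = f v := by
  have : Nontrivial V := IsSimpleModule.nontrivial R V
  -- Schur's lemma: e minus an eigenvalue is not injective, hence 0.
  have hschur : ∀ e : Module.End R V, ∃ μ : K, ∀ v, e v = μ • v := by
    intro e
    obtain ⟨μ, hμ⟩ := Module.End.exists_eigenvalue (e.restrictScalars K)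
    obtain ⟨v, hv⟩ := hμ.exists_hasEigenvector
    refine ⟨μ, fun w => ?_⟩
    have h := (LinearMap.bijective_or_eq_zero (e - μ • (1 : Module.End R V))).resolve_left
      fun hbij => hv.2 (hbij.1 (by
        have : e v = μ • v := hv.apply_eq_smul
        simp [this]))
    have := LinearMap.congr_fun h w
    simpa [sub_eq_zero] using this
  -- Since the commutant consists of scalars, every K-linear map commutes with it, and the density
  -- theorem matches f on a basis.
  let F : Module.End (Module.End R V) V :=
    { toFun := f
      map_add' := map_add f
      map_smul' := fun e v => by
        obtain ⟨μ, hμ⟩ := hschur e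
        change f (e v) = e (f v)
        rw [hμ, hμ, map_smul] }
  classical
  obtain ⟨r, hr⟩ := jacobson_density F (Finset.univ.image (Module.finBasis K V))
  refine ⟨r, fun v => ?_⟩
  have h : f = Algebra.lsmul K K V r := by
    refine (Module.finBasis K V).ext fun i => ?_
    exact hr _ (Finset.mem_image_of_mem _ (Finset.mem_univ i))
  rw [h]
  rfl

/-- By Burnside there is an invariant subspace W with 0 ≠ W ≠ V. Both W and V/W have dimension at
most dim V - 1, so s_ν(a) kills W and maps V into W. Hence a₀ s_ν(a) squares to 0. -/
theorem trace_mul_standardPoly_eq_zero_of_not_surjective [IsAlgClosed K] {R V : Type*} [Ring R]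
    [Algebra K R] [AddCommGroup V] [Module K V] [FiniteDimensional K V] (φ : R →ₐ[K] Module.End K V)
    (hφ : ¬ Function.Surjective φ) {ν : ℕ} (hν : 2 * (Module.finrank K V - 1) ≤ ν) (a₀ : R)
    (a : Fin ν → R) : LinearMap.trace K V (φ (a₀ * standardPoly a)) = 0 := by
  let _ : Module R V := Module.compHom V φ.toRingHom
  have hsmul : ∀ (r : R) (v : V), r • v = φ r v := fun _ _ => rfl
  have : IsScalarTower K R V := ⟨fun c r v => by rw [hsmul, hsmul, map_smul]; rfl⟩
  have hns : ¬ IsSimpleModule R V := fun _ => hφ fun f => by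
    obtain ⟨r, hr⟩ := surjective_of_isSimpleModule (R := R) f
    exact ⟨r, LinearMap.ext hr⟩
  have hnt : Nontrivial V := by
    by_contra h
    rw [not_nontrivial_iff_subsingleton] at h
    exact hφ fun f => ⟨0, LinearMap.ext fun v => Subsingleton.elim _ _⟩
  obtain ⟨W, hW0, hW1⟩ : ∃ W : Submodule R V, W ≠ ⊥ ∧ W ≠ ⊤ := by
    by_contra! h
    refine hns ((isSimpleModule_iff R V).2 ⟨fun W => ?_⟩)
    by_cases hW : W = ⊥
    · exact Or.inl hW
    · exact Or.inr (h W hW)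
  let WK : Submodule K V := W.restrictScalars K
  have hWK0 : WK ≠ ⊥ := by simpa [WK] using hW0
  have hWK1 : WK ≠ ⊤ := by simpa [WK] using hW1
  have hlt : Module.finrank K WK < Module.finrank K V := Submodule.finrank_lt hWK1
  have hpos : 0 < Module.finrank K WK := by
    rw [Module.finrank_pos_iff]
    exact (Submodule.nontrivial_iff_ne_bot).2 hWK0
  have hquot := Submodule.finrank_quotient_add_finrank WK
  have h1 : ∀ w ∈ W, standardPoly a • w = 0 := by
    intro w hw
    have h := map_standardPoly (Algebra.lsmul K K W : R →ₐ[K] Module.End K W).toRingHom a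
    have hz : standardPoly (fun i => (Algebra.lsmul K K W : R →ₐ[K] Module.End K W).toRingHom (a i))
        = 0 := by
      have : FiniteDimensional K W := inferInstanceAs (FiniteDimensional K WK)
      refine standardPoly_end_eq_zero ?_ _
      change 2 * Module.finrank K WK ≤ ν
      omega
    rw [hz] at h
    exact congrArg Subtype.val (LinearMap.congr_fun h ⟨w, hw⟩)
  have h2 : ∀ v : V, standardPoly a • v ∈ W := by
    intro v
    have h := map_standardPoly
      (Algebra.lsmul K K (V ⧸ W) : R →ₐ[K] Module.End K (V ⧸ W)).toRingHom a
    have hz : standardPoly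
        (fun i => (Algebra.lsmul K K (V ⧸ W) : R →ₐ[K] Module.End K (V ⧸ W)).toRingHom (a i)) = 0 := by
      have : FiniteDimensional K (V ⧸ W) := inferInstanceAs (FiniteDimensional K (V ⧸ WK))
      refine standardPoly_end_eq_zero ?_ _
      change 2 * Module.finrank K (V ⧸ WK) ≤ ν
      omega
    rw [hz] at h
    have h' := LinearMap.congr_fun h (Submodule.Quotient.mk v)
    exact (Submodule.Quotient.mk_eq_zero W).1 h'
  have hnil : IsNilpotent (φ (a₀ * standardPoly a)) := by
    refine ⟨2, LinearMap.ext fun v => ?_⟩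
    have h3 : standardPoly a • a₀ • standardPoly a • v = 0 := h1 _ (W.smul_mem _ (h2 v))
    rw [sq, ← map_mul]
    change (a₀ * standardPoly a * (a₀ * standardPoly a)) • v = 0
    simp only [mul_smul, h3, smul_zero]
  exact (LinearMap.isNilpotent_trace_of_isNilpotent hnil).eq_zero

/-- A subalgebra of `M_n(K)` on which the central-type form `a₀ s_ν(a₁, …, a_ν)` has a nonzero
trace for some `ν ≥ 2 (n - 1)` is the whole matrix algebra. -/
theorem eq_top_of_trace_mul_standardPoly_ne_zero [IsAlgClosed K] {n ν : ℕ}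
    (S : Subalgebra K (Matrix (Fin n) (Fin n) K)) (hν : 2 * (n - 1) ≤ ν)
    {a₀ : Matrix (Fin n) (Fin n) K} (ha₀ : a₀ ∈ S) {a : Fin ν → Matrix (Fin n) (Fin n) K}
    (ha : ∀ i, a i ∈ S) (h : Matrix.trace (a₀ * standardPoly a) ≠ 0) : S = ⊤ := by
  by_contra hS
  apply h
  let φ : S →ₐ[K] Module.End K (Fin n → K) := Matrix.toLinAlgEquiv'.toAlgHom.comp S.val
  have hφ : ¬ Function.Surjective φ := by
    intro hsurj
    refine hS (eq_top_iff.2 fun M _ => ?_)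
    obtain ⟨N, hN⟩ := hsurj (Matrix.toLinAlgEquiv' M)
    have : N.1 = M := Matrix.toLinAlgEquiv'.injective hN
    rw [← this]
    exact N.2
  have key := trace_mul_standardPoly_eq_zero_of_not_surjective φ hφ (ν := ν) (by simpa using hν)
    ⟨a₀, ha₀⟩ fun i => ⟨a i, ha i⟩
  have hmap : S.val (⟨a₀, ha₀⟩ * standardPoly fun i => (⟨a i, ha i⟩ : S)) = a₀ * standardPoly a := by
    rw [map_mul]
    congr 1
    exact map_standardPoly S.val.toRingHom _
  change LinearMap.trace K _ (Matrix.toLin' (S.val _)) = 0 at key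
  rwa [hmap, Matrix.trace_toLin'_eq] at key

end Burnside

/-! ### Triangularization of a single matrix -/

section Triangularization

variable {K : Type*} [Field K]

theorem exists_unit_last_row {n : ℕ} {v : Fin (n + 1) → K} (hv : v ≠ 0) :
    ∃ g : (Matrix (Fin (n + 1)) (Fin (n + 1)) K)ˣ, g.1 (Fin.last n) = v := by
  obtain ⟨i, hi⟩ := Function.ne_iff.1 hv
  -- Put v into row i of the identity, where v_i ≠ 0, and exchange that row with the last one; the
  -- determinant is ± v_i.
  let M : Matrix (Fin (n + 1)) (Fin (n + 1)) K :=
    (Matrix.updateRow 1 i v).submatrix (Equiv.swap i (Fin.last n)) id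
  have hdet : IsUnit M.det := by
    rw [Matrix.det_permute]
    have : (Matrix.updateRow (1 : Matrix (Fin (n + 1)) (Fin (n + 1)) K) i v).det = v i := by
      rw [← Matrix.det_transpose, ← Matrix.updateCol_transpose, Matrix.transpose_one,
        ← Matrix.cramer_apply, Matrix.cramer_one]
      rfl
    rw [this]
    refine IsUnit.mul ?_ (isUnit_iff_ne_zero.2 hi)
    exact (Units.isUnit _).map (Int.castRingHom K)
  refine ⟨Matrix.nonsingInvUnit M hdet, ?_⟩
  ext j
  change M (Fin.last n) j = v j
  simp [M]

/-- Every square matrix over an algebraically closed field can be triangularized. -/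
theorem exists_conj_upperTriangular [IsAlgClosed K] (n : ℕ) (M : Matrix (Fin n) (Fin n) K) :
    ∃ g : (Matrix (Fin n) (Fin n) K)ˣ, ∀ i j, j < i → (g.1 * M * g⁻¹.1) i j = 0 := by
  induction n with
  | zero => exact ⟨1, fun i => i.elim0⟩
  | succ n ih =>
    -- A left eigenvector of M as the last row of g makes the last row of g M g⁻¹ equal to μ times
    -- the last unit vector, which leaves a matrix of block type (n, 1).
    obtain ⟨μ, hμ⟩ := Module.End.exists_eigenvalue (Matrix.toLin' M.transpose)
    obtain ⟨v, hv⟩ := hμ.exists_hasEigenvector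
    have hvM : Matrix.vecMul v M = μ • v := by
      rw [← Matrix.mulVec_transpose]
      simpa using hv.apply_eq_smul
    obtain ⟨g, hg⟩ := exists_unit_last_row hv.2
    have hE : g.1 * M * g⁻¹.1 ∈ blockUpper K n 1 := by
      intro i j
      have hi : Fin.natAdd n i = Fin.last n := by
        ext; simp
      have h1 : (g.1 * M) (Fin.last n) = μ • g.1 (Fin.last n) := by
        rw [Matrix.mul_apply_eq_vecMul, hg, hvM]
      have h2 : (g.1 * M * g⁻¹.1) (Fin.last n) = μ • (1 : Matrix _ _ K) (Fin.last n) := by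
        rw [Matrix.mul_apply_eq_vecMul, h1, Matrix.smul_vecMul, ← Matrix.mul_apply_eq_vecMul,
          Units.mul_inv]
      rw [hi, h2, Pi.smul_apply, Matrix.one_apply_ne, smul_zero]
      rw [← hi]
      exact natAdd_ne_castAdd i j
    obtain ⟨h, hh⟩ := ih (topLeft (ℓ := n) (m := 1) (g.1 * M * g⁻¹.1))
    refine ⟨blockUnit (ℓ := n) (m := 1) h 1 * g, ?_⟩
    have hconj : (blockUnit (ℓ := n) (m := 1) h 1 * g).1 * M * (blockUnit (ℓ := n) (m := 1) h 1 * g)⁻¹.1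
        = (blockUnit (ℓ := n) (m := 1) h 1).1 * (g.1 * M * g⁻¹.1) *
          (blockUnit (ℓ := n) (m := 1) h 1)⁻¹.1 := by
      rw [mul_inv_rev, Units.val_mul, Units.val_mul]
      simp only [mul_assoc]
    rw [hconj, ← blockMatrix_eta hE, blockUnit_conj]
    intro i j hij
    revert hij
    refine Fin.addCases (m := n) (n := 1) (fun i hij => ?_) (fun i hij => ?_) i
    · obtain ⟨j, rfl⟩ : ∃ j' : Fin n, j = Fin.castAdd 1 j' := by
        refine ⟨⟨j, ?_⟩, rfl⟩
        have : (j : ℕ) < i := hij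
        omega
      exact (congrFun (congrFun (topLeft_blockMatrix _ _ _) i) j).trans (hh i j hij)
    · obtain ⟨j, rfl⟩ : ∃ j' : Fin n, j = Fin.castAdd 1 j' := by
        refine ⟨⟨j, ?_⟩, rfl⟩
        have : (j : ℕ) < n + i := hij
        omega
      exact blockMatrix_mem _ _ _ i j

end Triangularization

end NonsplitTest

namespace NonsplitTest

/-! ### Spans of words of bounded length -/

section Words

variable {K : Type*} [Field K] {n q : ℕ}

/-- The span of the products of length at most `p` of the given matrices. -/
def wordSpan (a : Fin q → Matrix (Fin n) (Fin n) K) (p : ℕ) :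
    Submodule K (Matrix (Fin n) (Fin n) K) :=
  Submodule.span K {M | ∃ L : List (Fin q), L.length ≤ p ∧ M = (L.map a).prod}

theorem list_prod_mem_wordSpan (a : Fin q → Matrix (Fin n) (Fin n) K) {p : ℕ} {L : List (Fin q)}
    (hL : L.length ≤ p) : (L.map a).prod ∈ wordSpan a p :=
  Submodule.subset_span ⟨L, hL, rfl⟩

theorem wordSpan_mono (a : Fin q → Matrix (Fin n) (Fin n) K) : Monotone (wordSpan a) := by
  intro p p' h
  refine Submodule.span_mono ?_
  rintro _ ⟨L, hL, rfl⟩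
  exact ⟨L, hL.trans h, rfl⟩

theorem mul_mem_wordSpan (a : Fin q → Matrix (Fin n) (Fin n) K) {p : ℕ} (i : Fin q)
    {M : Matrix (Fin n) (Fin n) K} (hM : M ∈ wordSpan a p) : a i * M ∈ wordSpan a (p + 1) := by
  have h : wordSpan a p ≤ (wordSpan a (p + 1)).comap (LinearMap.mulLeft K (a i)) := by
    refine Submodule.span_le.2 ?_
    rintro _ ⟨L, hL, rfl⟩
    exact list_prod_mem_wordSpan a (L := i :: L) (by simpa using hL)
  exact h hM

theorem wordSpan_le_adjoin (a : Fin q → Matrix (Fin n) (Fin n) K) (p : ℕ) :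
    wordSpan a p ≤ Subalgebra.toSubmodule (Algebra.adjoin K (Set.range a)) := by
  refine Submodule.span_le.2 ?_
  rintro _ ⟨L, -, rfl⟩
  refine Subalgebra.list_prod_mem _ fun x hx => ?_
  obtain ⟨i, -, rfl⟩ := List.mem_map.1 hx
  exact Algebra.subset_adjoin ⟨i, rfl⟩

/-- If allowing one more letter adds nothing, the span is closed under left multiplication by the
generators, hence by the algebra; it contains 1, the empty word. -/
theorem wordSpan_eq_adjoin_of_stable (a : Fin q → Matrix (Fin n) (Fin n) K) {p : ℕ}
    (hp : wordSpan a p = wordSpan a (p + 1)) :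
    wordSpan a p = Subalgebra.toSubmodule (Algebra.adjoin K (Set.range a)) := by
  refine le_antisymm (wordSpan_le_adjoin a p) fun M hM => ?_
  have key : ∀ x ∈ Algebra.adjoin K (Set.range a), ∀ y ∈ wordSpan a p, x * y ∈ wordSpan a p := by
    intro x hx
    induction hx using Algebra.adjoin_induction with
    | mem x hx =>
      obtain ⟨i, rfl⟩ := hx
      intro y hy
      rw [hp]
      exact mul_mem_wordSpan a i hy
    | algebraMap c =>
      intro y hy
      rw [← Algebra.smul_def]
      exact Submodule.smul_mem _ c hy
    | add x x' _ _ h h' =>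
      intro y hy
      rw [add_mul]
      exact Submodule.add_mem _ (h y hy) (h' y hy)
    | mul x x' _ _ h h' =>
      intro y hy
      rw [mul_assoc]
      exact h _ (h' y hy)
  have h1 : (1 : Matrix (Fin n) (Fin n) K) ∈ wordSpan a p :=
    list_prod_mem_wordSpan a (L := []) (Nat.zero_le _)
  simpa using key M hM 1 h1

/-- Products of length at most `n²` span the algebra generated by the given `n × n` matrices. -/
theorem wordSpan_eq_adjoin (a : Fin q → Matrix (Fin n) (Fin n) K) {p : ℕ} (hp : n ^ 2 ≤ p) :
    wordSpan a p = Subalgebra.toSubmodule (Algebra.adjoin K (Set.range a)) := by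
  obtain ⟨r, hr, hstab⟩ : ∃ r ≤ n ^ 2, wordSpan a r = wordSpan a (r + 1) := by
    by_contra! h
    -- If every inclusion up to length n² + 1 were strict, the dimension would exceed n².
    have hdim : ∀ r ≤ n ^ 2 + 1, r ≤ Module.finrank K (wordSpan a r) := by
      intro r
      induction r with
      | zero => intro _; exact Nat.zero_le _
      | succ r ih =>
        intro hr
        have h1 := ih (by omega)
        have h2 := Submodule.finrank_lt_finrank_of_lt
          (lt_of_le_of_ne (wordSpan_mono a (Nat.le_add_right r 1)) (h r (by omega)))
        omega
    have h1 := hdim (n ^ 2 + 1) le_rfl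
    have h2 := Submodule.finrank_le (wordSpan a (n ^ 2 + 1))
    rw [Module.finrank_matrix] at h2
    simp only [Fintype.card_fin, Module.finrank_self, mul_one, ← sq] at h2
    omega
  refine le_antisymm (wordSpan_le_adjoin a p) ?_
  rw [← wordSpan_eq_adjoin_of_stable a hstab]
  exact wordSpan_mono a (hr.trans hp)

theorem lengthBound_spec (K : Type*) [Field K] {n : ℕ} (hn : 0 < n) :
    0 < lengthBound K n ∧ IsLengthBound K n (lengthBound K n) :=
  Nat.sInf_mem (s := {P | 0 < P ∧ IsLengthBound K n P})
    ⟨n ^ 2, by positivity, fun _ _ a => wordSpan_eq_adjoin a le_rfl⟩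

theorem wordSpan_lengthBound (hn : 0 < n) (a : Fin q → Matrix (Fin n) (Fin n) K) :
    wordSpan a (lengthBound K n) = Subalgebra.toSubmodule (Algebra.adjoin K (Set.range a)) := by
  -- The definition of P(n) speaks of at least one generator. With none, the empty word is the only
  -- word, and the span is stable at once.
  rcases Nat.eq_zero_or_pos q with rfl | hq
  · refine wordSpan_eq_adjoin_of_stable a (le_antisymm (wordSpan_mono a (Nat.le_succ _)) ?_)
    refine Submodule.span_mono ?_
    rintro _ ⟨L, -, rfl⟩
    refine ⟨[], Nat.zero_le _, ?_⟩
    cases L with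
    | nil => rfl
    | cons i L => exact i.elim0
  · exact (lengthBound_spec K hn).2 q hq a

/-- For e₀₁ and e₁₀, the words of length at most 1 have equal diagonal entries, whereas e₀₁ e₁₀ =
e₀₀ does not. This makes room for the three words 1, b, b² when ℓ = m = 1 and s = 1. -/
theorem two_le_lengthBound_two (K : Type*) [Field K] : 2 ≤ lengthBound K 2 := by
  obtain ⟨hpos, hbound⟩ := lengthBound_spec K (n := 2) two_pos
  by_contra! hlt
  have h1 : lengthBound K 2 = 1 := by omega
  rw [h1] at hbound
  let a : Fin 2 → Matrix (Fin 2) (Fin 2) K := ![!![0, 1; 0, 0], !![0, 0; 1, 0]]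
  have h := hbound 2 two_pos a
  let φ : Matrix (Fin 2) (Fin 2) K →ₗ[K] K :=
    { toFun := fun M => M 0 0 - M 1 1
      map_add' := fun M N => by simp; ring
      map_smul' := fun c M => by simp; ring }
  have hle : Submodule.span K {M | ∃ L : List (Fin 2), L.length ≤ 1 ∧ M = (L.map a).prod} ≤
      LinearMap.ker φ := by
    refine Submodule.span_le.2 ?_
    rintro _ ⟨L, hL, rfl⟩
    rw [SetLike.mem_coe, LinearMap.mem_ker]
    match L, hL with
    | [], _ => simp [φ]
    | [i], _ => fin_cases i <;> simp [φ, a]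
  rw [h] at hle
  have hmem : a 0 * a 1 ∈ Algebra.adjoin K (Set.range a) :=
    mul_mem (Algebra.subset_adjoin ⟨0, rfl⟩) (Algebra.subset_adjoin ⟨1, rfl⟩)
  have h0 : φ (a 0 * a 1) = 0 := hle hmem
  simp [φ, a] at h0

end Words

/-! ### The set U as a set of words, and finiteness of the systems -/

section ProductSet

variable {k K : Type*} [Field k] [Field K] {ℓ m s : ℕ} {r₀ : Option (Fin s)}

/-- The bound on the exponents is harmless: a power can be spelled out as a word with exponents 1,
and 1 < ℓ + m. Factors I contribute no letter. -/
theorem mem_productSet_iff (h : 2 ≤ ℓ + m) {u : PolyMatrix k ℓ m s (ℓ + m)} :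
    u ∈ productSet k K ℓ m s r₀ ↔
      ∃ L : List (Fin s), L.length ≤ lengthBound K (ℓ + m) ∧
        u = (L.map (genericBlock k ℓ m s r₀)).prod := by
  constructor
  · rintro ⟨L, hL, hsum, rfl⟩
    suffices hw : ∃ w : List (Fin s), w.length ≤ (L.map fun c => c.2).sum ∧
        (L.map fun c => c.1 ^ c.2).prod = (w.map (genericBlock k ℓ m s r₀)).prod by
      obtain ⟨w, hw, h⟩ := hw
      exact ⟨w, hw.trans hsum, h⟩
    clear hsum
    induction L with
    | nil => exact ⟨[], le_rfl, rfl⟩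
    | cons c L ih =>
      obtain ⟨w, hw, hprod⟩ := ih fun c hc => hL c (List.mem_cons_of_mem _ hc)
      rcases (hL c List.mem_cons_self).1 with h1 | ⟨r, hr⟩
      · refine ⟨w, ?_, ?_⟩
        · simp only [List.map_cons, List.sum_cons]
          omega
        · simp only [List.map_cons, List.prod_cons, h1, one_pow, one_mul, hprod]
      · refine ⟨List.replicate c.2 r ++ w, ?_, ?_⟩
        · simp only [List.map_cons, List.sum_cons, List.length_append, List.length_replicate]
          omega
        · simp only [List.map_cons, List.prod_cons, hprod, List.map_append, List.map_replicate,
            List.prod_append, List.prod_replicate, hr]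
  · rintro ⟨L, hL, rfl⟩
    refine ⟨L.map fun r => (genericBlock k ℓ m s r₀ r, 1), ?_, ?_, ?_⟩
    · intro c hc
      obtain ⟨r, -, rfl⟩ := List.mem_map.1 hc
      exact ⟨Or.inr ⟨r, rfl⟩, by omega⟩
    · simpa [Function.comp_def] using hL
    · simp [Function.comp_def]

theorem productSet_finite (h : 2 ≤ ℓ + m) : (productSet k K ℓ m s r₀).Finite := by
  refine ((List.finite_length_le (Fin s) (lengthBound K (ℓ + m))).image
    fun L => (L.map (genericBlock k ℓ m s r₀)).prod).subset ?_
  intro u hu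
  obtain ⟨L, hL, rfl⟩ := (mem_productSet_iff h).1 hu
  exact ⟨L, hL, rfl⟩

theorem entries_finite {S : Type*} {n : ℕ} (M : Matrix (Fin n) (Fin n) S) : (entries M).Finite := by
  refine (Set.finite_range fun c : Fin n × Fin n => M c.1 c.2).subset ?_
  rintro _ ⟨i, j, rfl⟩
  exact ⟨(i, j), rfl⟩

theorem testSystem_finite {t : ℕ} (f : Fin t → FreeAlgebra k (Fin s)) (c : Choice k K ℓ m s r₀) :
    (testSystem f c).Finite :=
  (((Set.finite_singleton _).union (Set.finite_singleton _)).union (entries_finite _)).union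
    (Set.finite_iUnion fun _ => entries_finite _)

end ProductSet

end NonsplitTest

namespace NonsplitTest

/-! ### The standard polynomial of degree `2 (n - 1)` on matrices of size `n` -/

section StandardPolynomial

variable {K : Type*} [Field K]

/-- Makes multilinearity and the alternating property of s_ν available: the first allows checking on
a basis, the second yields distinct arguments. -/
theorem standardPoly_eq_alternatization {S : Type*} [Ring S] [Algebra K S] {ν : ℕ}
    (a : Fin ν → S) :
    standardPoly a = MultilinearMap.alternatization (MultilinearMap.mkPiAlgebraFin K ν S) a := by
  rw [MultilinearMap.alternatization_apply, standardPoly]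
  refine Finset.sum_congr rfl fun σ _ => ?_
  rw [MultilinearMap.domDomCongr_apply, MultilinearMap.mkPiAlgebraFin_apply, Units.smul_def]

theorem isChain_of_prod_ne_zero {ι S : Type*} [Ring S] (a : ι → S) (L : List ι)
    (h : (L.map a).prod ≠ 0) : L.IsChain fun c d => a c * a d ≠ 0 := by
  induction L with
  | nil => exact List.isChain_nil
  | cons c L ih =>
    cases L with
    | nil => exact List.isChain_singleton _
    | cons d L =>
      rw [List.isChain_cons_cons]
      refine ⟨fun h0 => h ?_, ih fun h0 => h ?_⟩
      · simp only [List.map_cons, List.prod_cons, ← mul_assoc, h0, zero_mul]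
      · rw [List.map_cons, List.prod_cons, h0, mul_zero]

/-- The staircase `e₀₀, e₀₁, e₁₁, e₁₂, …` of matrix units. -/
def staircase (K : Type*) [Field K] (n : ℕ) [NeZero n] (c : ℕ) : Matrix (Fin n) (Fin n) K :=
  Matrix.single (Fin.ofNat n (c / 2)) (Fin.ofNat n ((c + 1) / 2)) 1

theorem prod_staircase (n : ℕ) [NeZero n] (c : ℕ) :
    ((List.range (c + 1)).map (staircase K n)).prod =
      Matrix.single 0 (Fin.ofNat n ((c + 1) / 2)) 1 := by
  induction c with
  | zero => simp [staircase]
  | succ c ih =>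
    rw [List.range_succ, List.map_append, List.prod_append, ih]
    simp [staircase]

/-- A product of two distinct members c, d of the staircase is nonzero only if d = c + 1, because
the column index of c must be the row index of d. So only the identity permutation contributes. The
largest index that occurs is n - 1, so `Fin.ofNat` never wraps around. -/
theorem standardPoly_staircase_ne_zero (n : ℕ) [NeZero n] :
    standardPoly (fun c : Fin (2 * (n - 1)) => staircase K n c) ≠ 0 := by
  rw [standardPoly, Finset.sum_eq_single 1]
  · simp only [Equiv.Perm.sign_one, Units.val_one, one_smul, Equiv.Perm.one_apply]
    have h : (List.ofFn fun c : Fin (2 * (n - 1)) => staircase K n c) =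
        (List.range (2 * (n - 1))).map (staircase K n) := by
      apply List.ext_getElem <;> simp
    rw [h]
    rcases Nat.eq_zero_or_pos (2 * (n - 1)) with h0 | h0
    · rw [h0]
      simp
    · obtain ⟨c, hc⟩ : ∃ c, 2 * (n - 1) = c + 1 := ⟨_, (Nat.succ_pred_eq_of_pos h0).symm⟩
      rw [hc, prod_staircase]
      intro h
      have := congrFun (congrFun h 0) (Fin.ofNat n ((c + 1) / 2))
      simp at this
  · intro σ _ hσ
    suffices h : (List.ofFn fun c => staircase K n (σ c : Fin (2 * (n - 1)))).prod = 0 by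
      rw [h, smul_zero]
    by_contra hne
    apply hσ
    have h1 : (List.ofFn fun c => staircase K n (σ c : Fin (2 * (n - 1)))) =
        (List.ofFn σ).map fun c : Fin (2 * (n - 1)) => staircase K n c := by
      rw [List.map_ofFn]; rfl
    rw [h1] at hne
    have hchain := isChain_of_prod_ne_zero _ _ hne
    have hnd : (List.ofFn σ).Nodup := List.nodup_ofFn.2 σ.injective
    have hlt : (List.ofFn σ).IsChain (· < ·) := by
      rw [List.isChain_iff_getElem] at hchain ⊢
      intro i hi
      have h2 := hchain i hi
      have hne' : (List.ofFn σ)[i] ≠ (List.ofFn σ)[i + 1] := by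
        intro h
        have := (List.Nodup.getElem_inj_iff hnd).1 h
        omega
      generalize (List.ofFn σ)[i] = c at h2 hne' ⊢
      generalize (List.ofFn σ)[i + 1] = d at h2 hne' ⊢
      have hcd : (c.1 + 1) / 2 = d.1 / 2 := by
        by_contra hcd
        apply h2
        rw [staircase, staircase, Matrix.single_mul_single_of_ne]
        intro h
        apply hcd
        have := congrArg Fin.val h
        have hc := c.2
        have hd := d.2
        simp only [Fin.val_ofNat] at this
        rwa [Nat.mod_eq_of_lt (by omega), Nat.mod_eq_of_lt (by omega)] at this
      rw [Fin.lt_def]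
      have : c.1 ≠ d.1 := fun h => hne' (Fin.ext h)
      omega
    have hmono : StrictMono σ := by
      have := List.pairwise_ofFn.1 (List.isChain_iff_pairwise.1 hlt)
      exact fun i j h => this h
    ext i
    have : (σ : Fin (2 * (n - 1)) → Fin (2 * (n - 1))) = id :=
      (StrictMono.range_inj hmono strictMono_id).1 (by simp [σ.surjective.range_eq])
    simp [this]
  · simp

/-- On a spanning set of the matrix algebra of size `n`, the trace form built from the standard
polynomial of degree `2 (n - 1)` does not vanish identically. -/
theorem exists_trace_mul_standardPoly_ne_zero {n : ℕ} (hn : 0 < n)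
    {T : Set (Matrix (Fin n) (Fin n) K)} (hT : Submodule.span K T = ⊤) :
    ∃ a₀ ∈ T, ∃ a : Fin (2 * (n - 1)) → Matrix (Fin n) (Fin n) K, (∀ i, a i ∈ T) ∧
      Matrix.trace (a₀ * standardPoly a) ≠ 0 := by
  have : NeZero n := ⟨hn.ne'⟩
  let b := Module.Basis.ofSpan hT.ge
  have hb : ∀ i, b i ∈ T := fun i => Module.Basis.ofSpan_subset hT.ge ⟨i, rfl⟩
  -- A multilinear map that vanishes on all tuples of basis vectors is 0, which the staircase
  -- excludes.
  obtain ⟨f, hf⟩ : ∃ f : Fin (2 * (n - 1)) → _, standardPoly (fun c => b (f c)) ≠ 0 := by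
    by_contra! h
    apply standardPoly_staircase_ne_zero (K := K) n
    rw [standardPoly_eq_alternatization (K := K)]
    have h0 : (MultilinearMap.alternatization (MultilinearMap.mkPiAlgebraFin K (2 * (n - 1))
        (Matrix (Fin n) (Fin n) K))).toMultilinearMap = 0 := by
      refine Module.Basis.ext_multilinear (fun _ => b) fun v => ?_
      have := h v
      rwa [standardPoly_eq_alternatization (K := K)] at this
    exact congrArg (fun F => F fun c : Fin (2 * (n - 1)) => staircase K n c) h0
  -- The trace form is nondegenerate.
  obtain ⟨i, hi⟩ : ∃ i, Matrix.trace (b i * standardPoly fun c => b (f c)) ≠ 0 := by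
    by_contra! h
    apply hf
    rw [Matrix.ext_iff_trace_mul_left]
    intro x
    rw [mul_zero, Matrix.trace_zero]
    let φ : Matrix (Fin n) (Fin n) K →ₗ[K] K :=
      (Matrix.traceLinearMap (Fin n) K K).comp
        (LinearMap.mulRight K (standardPoly fun c => b (f c)))
    have hφ : φ = 0 := b.ext fun i => h i
    exact LinearMap.congr_fun hφ x
  exact ⟨b i, hb i, fun c => b (f c), fun c => hb _, hi⟩

/-- Supplies the distinctness that a choice demands of its products in the diagonal blocks. -/
theorem injective_of_standardPoly_ne_zero {S : Type*} [Ring S] [Algebra K S] {ν : ℕ}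
    {a : Fin ν → S} (h : standardPoly a ≠ 0) : Function.Injective a := by
  by_contra hinj
  apply h
  rw [standardPoly_eq_alternatization (K := K)]
  exact AlternatingMap.map_eq_zero_of_not_injective _ _ hinj

end StandardPolynomial

end NonsplitTest

namespace NonsplitTest

/-! ### Evaluation of the generic matrices and the number of products -/

section Evaluation

variable {k K : Type*} [Field k] [Field K] [Algebra k K] {ℓ m s : ℕ} {r₀ : Option (Fin s)}

theorem finrank_blockUpper (K : Type*) [Field K] (ℓ m : ℕ) :
    Module.finrank K (blockUpper K ℓ m) = blockDim ℓ m := by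
  let e : blockUpper K ℓ m ≃ₗ[K]
      Matrix (Fin ℓ) (Fin ℓ) K × Matrix (Fin ℓ) (Fin m) K × Matrix (Fin m) (Fin m) K :=
    { toFun := fun M => (topLeft M.1, topRight M.1, bottomRight M.1)
      map_add' := fun _ _ => rfl
      map_smul' := fun _ _ => rfl
      invFun := fun c => ⟨blockMatrix c.1 c.2.1 c.2.2, blockMatrix_mem _ _ _⟩
      left_inv := fun M => Subtype.ext (blockMatrix_eta M.2)
      right_inv := fun c => by
        simp [topLeft_blockMatrix, topRight_blockMatrix, bottomRight_blockMatrix] }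
  rw [e.finrank_eq, Module.finrank_prod, Module.finrank_prod]
  simp only [Module.finrank_matrix, Fintype.card_fin, Module.finrank_self]
  ring

theorem blockUpper_apply_eq_zero {M : Matrix (Fin (ℓ + m)) (Fin (ℓ + m)) K}
    (hM : M ∈ blockUpper K ℓ m) {i j : Fin (ℓ + m)} (h : ¬ ((i : ℕ) < ℓ ∨ ℓ ≤ (j : ℕ))) :
    M i j = 0 := by
  push Not at h
  obtain ⟨j, rfl⟩ : ∃ j' : Fin ℓ, j = Fin.castAdd m j' := ⟨⟨j, h.2⟩, rfl⟩
  obtain ⟨i, rfl⟩ : ∃ i' : Fin m, i = Fin.natAdd ℓ i' :=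
    ⟨⟨i - ℓ, by omega⟩, by ext; simp; omega⟩
  exact hM i j

theorem mem_blockUpper_iff {M : Matrix (Fin (ℓ + m)) (Fin (ℓ + m)) K} :
    M ∈ blockUpper K ℓ m ↔ ∀ i j : Fin (ℓ + m), ¬ ((i : ℕ) < ℓ ∨ ℓ ≤ (j : ℕ)) → M i j = 0 := by
  refine ⟨fun hM i j => blockUpper_apply_eq_zero hM, fun h i j => h _ _ ?_⟩
  simp

/-- Substitution of values for the indeterminates in a matrix of polynomials. -/
noncomputable def evalMatrix {n : ℕ} (z : Indet ℓ m s → K) :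
    PolyMatrix k ℓ m s n →ₐ[k] Matrix (Fin n) (Fin n) K :=
  (MvPolynomial.aeval z).mapMatrix

theorem evalMatrix_apply {n : ℕ} (z : Indet ℓ m s → K) (M : PolyMatrix k ℓ m s n) (i j : Fin n) :
    evalMatrix z M i j = MvPolynomial.aeval z (M i j) :=
  rfl

/-- The point with the given coordinates. -/
def point (Y : Fin s → Matrix (Fin (ℓ + m)) (Fin (ℓ + m)) K) (v w : K)
    (y : Fin (blockDim ℓ m) → K) : Indet ℓ m s → K
  | .x r i j => Y r i j
  | .v => v
  | .w => w
  | .y c => y c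

/-- The matrices `Y r` have the shape of the generic block triangular matrices. -/
def HasGenericShape (r₀ : Option (Fin s)) (Y : Fin s → Matrix (Fin (ℓ + m)) (Fin (ℓ + m)) K) :
    Prop :=
  (∀ r, Y r ∈ blockUpper K ℓ m) ∧ ∀ r, r₀ = some r → ∀ i j, j < i → Y r i j = 0

theorem evalMatrix_point_genericBlock {Y : Fin s → Matrix (Fin (ℓ + m)) (Fin (ℓ + m)) K}
    (hY : HasGenericShape r₀ Y) (v w : K) (y : Fin (blockDim ℓ m) → K) (r : Fin s) :
    evalMatrix (point Y v w y) (genericBlock k ℓ m s r₀ r) = Y r := by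
  ext i j
  rw [evalMatrix_apply, genericBlock, Matrix.of_apply]
  split_ifs with h
  · rw [MvPolynomial.aeval_X]
    rfl
  · rw [map_zero]
    rw [not_and_or] at h
    rcases h with h | h
    · exact (blockUpper_apply_eq_zero (hY.1 r) h).symm
    · push Not at h
      exact (hY.2 r h.1 i j h.2).symm

theorem evalMatrix_list_prod {Y : Fin s → Matrix (Fin (ℓ + m)) (Fin (ℓ + m)) K}
    (hY : HasGenericShape r₀ Y) (v w : K) (y : Fin (blockDim ℓ m) → K) (L : List (Fin s)) :
    evalMatrix (point Y v w y) (L.map (genericBlock k ℓ m s r₀)).prod = (L.map Y).prod := by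
  rw [map_list_prod, List.map_map]
  congr 2
  ext1 r
  exact evalMatrix_point_genericBlock hY v w y r

/-- Elements of U involve only the indeterminates x_{ij}(r), so v, w and the y_c may be assigned
after the products have been chosen. -/
theorem evalMatrix_mem_productSet {Y : Fin s → Matrix (Fin (ℓ + m)) (Fin (ℓ + m)) K}
    (h : 2 ≤ ℓ + m) (hY : HasGenericShape r₀ Y) (v w : K) (y : Fin (blockDim ℓ m) → K)
    {u : PolyMatrix k ℓ m s (ℓ + m)} (hu : u ∈ productSet k K ℓ m s r₀) :
    evalMatrix (point Y v w y) u = evalMatrix (point Y 0 0 0) u := by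
  obtain ⟨L, -, rfl⟩ := (mem_productSet_iff h).1 hu
  rw [evalMatrix_list_prod hY, evalMatrix_list_prod hY]

theorem span_evalMatrix_productSet {Y : Fin s → Matrix (Fin (ℓ + m)) (Fin (ℓ + m)) K}
    (h : 2 ≤ ℓ + m) (hY : HasGenericShape r₀ Y) :
    Submodule.span K (evalMatrix (point Y 0 0 0) '' productSet k K ℓ m s r₀) =
      Subalgebra.toSubmodule (Algebra.adjoin K (Set.range Y)) := by
  rw [← wordSpan_lengthBound (by omega), wordSpan]
  congr 1
  ext M
  constructor
  · rintro ⟨u, hu, rfl⟩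
    obtain ⟨L, hL, rfl⟩ := (mem_productSet_iff h).1 hu
    exact ⟨L, hL, evalMatrix_list_prod hY 0 0 0 L⟩
  · rintro ⟨L, hL, rfl⟩
    exact ⟨_, (mem_productSet_iff h).2 ⟨L, hL, rfl⟩, evalMatrix_list_prod hY 0 0 0 L⟩

/-- A diagonal matrix with distinct entries and the block triangular matrix of ones generate the
algebra of block triangular matrices. -/
theorem blockUpper_le_of_diagonal_mem {S : Subalgebra K (Matrix (Fin (ℓ + m)) (Fin (ℓ + m)) K)}
    {d : Fin (ℓ + m) → K} (hd : Function.Injective d) (hdS : Matrix.diagonal d ∈ S)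
    (hN : (Matrix.of fun i j : Fin (ℓ + m) => if (i : ℕ) < ℓ ∨ ℓ ≤ (j : ℕ) then 1 else 0) ∈ S) :
    blockUpper K ℓ m ≤ S := by
  have hunit : ∀ i, Matrix.single i i (1 : K) ∈ S := by
    intro i
    -- Interpolation at the distinct diagonal entries gives e_{ii} as a polynomial in the diagonal
    -- matrix; then e_{ii} N e_{jj} = e_{ij} at every allowed position.
    let p := Lagrange.interpolate Finset.univ d (Pi.single i 1)
    have hp : Polynomial.aeval (Matrix.diagonal d) p = Matrix.single i i (1 : K) := by
      change Polynomial.aeval (Matrix.diagonalAlgHom K d) p = _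
      rw [Polynomial.aeval_algHom_apply]
      have : Polynomial.aeval d p = Pi.single i 1 := by
        ext j
        have h1 := Polynomial.aeval_algHom_apply (Pi.evalAlgHom K (fun _ : Fin (ℓ + m) => K) j) d p
        rw [Pi.evalAlgHom_apply, Pi.evalAlgHom_apply] at h1
        rw [← h1, Polynomial.coe_aeval_eq_eval]
        exact Lagrange.eval_interpolate_at_node _ hd.injOn (Finset.mem_univ j)
      rw [this]
      exact Matrix.diagonal_single i 1
    rw [← hp]
    exact Algebra.adjoin_le (Set.singleton_subset_iff.2 hdS) (Polynomial.aeval_mem_adjoin_singleton K _)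
  intro M hM
  rw [Matrix.matrix_eq_sum_single M]
  refine S.sum_mem fun i _ => S.sum_mem fun j _ => ?_
  by_cases h : (i : ℕ) < ℓ ∨ ℓ ≤ (j : ℕ)
  · have h1 := S.smul_mem (S.mul_mem (S.mul_mem (hunit i) hN) (hunit j)) (M i j)
    rw [Matrix.single_mul_mul_single, Matrix.smul_single, Matrix.of_apply, if_pos h] at h1
    simpa using h1
  · rw [blockUpper_apply_eq_zero hM h, Matrix.single_zero]
    exact S.zero_mem

/-- With two generators the b_r specialize to matrices that generate all of E. The values of U then
span a space of dimension q, so U has at least q elements. -/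
theorem blockDim_le_ncard_of_two_le [Infinite K] (hℓ : 0 < ℓ) (hm : 0 < m) (hs : 2 ≤ s) :
    blockDim ℓ m ≤ (productSet k K ℓ m s r₀).ncard := by
  have hn : 2 ≤ ℓ + m := by omega
  -- The generator required to be upper triangular, if there is one, is the one to be specialized to
  -- a diagonal matrix.
  obtain ⟨r, hr⟩ : ∃ r : Fin s, ∀ r', r₀ = some r' → r' = r := by
    cases r₀ with
    | none => exact ⟨⟨0, by omega⟩, by simp⟩
    | some r => exact ⟨r, fun r' h => (Option.some.inj h).symm⟩
  have : Nontrivial (Fin s) := Fin.nontrivial_iff_two_le.2 hs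
  obtain ⟨r', hr'⟩ := exists_ne r
  let d : Fin (ℓ + m) → K := fun i => Infinite.natEmbedding K i
  have hd : Function.Injective d := fun i j h =>
    Fin.ext ((Infinite.natEmbedding K).injective h)
  let Y : Fin s → Matrix (Fin (ℓ + m)) (Fin (ℓ + m)) K := fun c =>
    if c = r then Matrix.diagonal d
    else Matrix.of fun i j : Fin (ℓ + m) => if (i : ℕ) < ℓ ∨ ℓ ≤ (j : ℕ) then 1 else 0
  have hY : HasGenericShape r₀ Y := by
    constructor
    · intro c
      rw [mem_blockUpper_iff]
      intro i j hij
      by_cases hc : c = r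
      · have : i ≠ j := by
          rintro rfl
          omega
        simp [Y, hc, this]
      · simp only [Y, hc, if_false, Matrix.of_apply, if_neg hij]
    · intro c hc i j hij
      simp [Y, hr c hc, hij.ne']
  have hspan := span_evalMatrix_productSet (k := k) hn hY
  have hle : blockUpper K ℓ m ≤ Algebra.adjoin K (Set.range Y) :=
    blockUpper_le_of_diagonal_mem hd (Algebra.subset_adjoin ⟨r, by simp [Y]⟩)
      (Algebra.subset_adjoin ⟨r', by simp [Y, hr']⟩)
  have hfin := productSet_finite (k := k) (K := K) (s := s) (r₀ := r₀) hn
  have h1 : blockDim ℓ m ≤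
      Module.finrank K (Subalgebra.toSubmodule (Algebra.adjoin K (Set.range Y))) := by
    rw [← finrank_blockUpper K]
    exact Submodule.finrank_mono
      (s := Subalgebra.toSubmodule (blockUpper K ℓ m)) hle
  rw [← hspan] at h1
  refine h1.trans ?_
  have := (hfin.image (evalMatrix (point Y 0 0 0))).fintype
  refine (finrank_span_le_card _).trans ?_
  rw [← Set.ncard_eq_toFinset_card']
  exact Set.ncard_image_le hfin

/-- Here q = 3, and 1, b, b² are distinct: specialize b to a scalar c outside {0, 1, -1}, for which
1, c, c² differ. -/
theorem three_le_ncard_productSet [Infinite K] (r₀ : Option (Fin 1)) :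
    3 ≤ (productSet k K 1 1 1 r₀).ncard := by
  have hn : 2 ≤ 1 + 1 := le_rfl
  classical
  obtain ⟨c, hc⟩ := Infinite.exists_notMem_finset ({0, 1, -1} : Finset K)
  simp only [Finset.mem_insert, Finset.mem_singleton, not_or] at hc
  let Y : Fin 1 → Matrix (Fin (1 + 1)) (Fin (1 + 1)) K := fun _ => Matrix.diagonal fun _ => c
  have hY : HasGenericShape r₀ Y := by
    constructor
    · intro r i j
      exact Matrix.diagonal_apply_ne _ (natAdd_ne_castAdd i j)
    · intro r _ i j hij
      exact Matrix.diagonal_apply_ne _ hij.ne'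
  let g : Fin 3 → PolyMatrix k 1 1 1 (1 + 1) := fun i =>
    ((List.replicate i 0).map (genericBlock k 1 1 1 r₀)).prod
  have hg : ∀ i : Fin 3, evalMatrix (point Y 0 0 0) (g i) 0 0 = c ^ (i : ℕ) := by
    intro i
    rw [evalMatrix_list_prod hY]
    simp [Y, Matrix.diagonal_pow]
  have hinj : Function.Injective g := by
    have h1 : c ^ 2 ≠ 1 := by
      rw [sq]
      intro h
      rcases mul_self_eq_one_iff.1 h with h | h
      · exact hc.2.1 h
      · exact hc.2.2 h
    have h2 : c ^ 2 ≠ c := by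
      intro h
      rw [sq] at h
      exact hc.2.1 (mul_right_cancel₀ hc.1 (by rw [h, one_mul]))
    have hinj' : Function.Injective fun i : Fin 3 => c ^ (i : ℕ) := by
      intro i j h
      fin_cases i <;> fin_cases j <;> simp at h <;> first | rfl | exfalso
      · exact hc.2.1 h.symm
      · exact h1 h.symm
      · exact hc.2.1 h
      · exact h2 h.symm
      · exact h.elim hc.2.1 hc.2.2
      · exact h2 h
    intro i j h
    apply hinj'
    simp only [← hg, h]
  have hsub : Set.range g ⊆ productSet k K 1 1 1 r₀ := by
    rintro _ ⟨i, rfl⟩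
    refine (mem_productSet_iff hn).2 ⟨List.replicate i 0, ?_, rfl⟩
    have := two_le_lengthBound_two K
    have hi := i.2
    rw [List.length_replicate]
    change (i : ℕ) ≤ lengthBound K 2
    omega
  have hcard : (Set.range g).ncard = 3 := by
    rw [← Set.image_univ, Set.ncard_image_of_injective _ hinj, Set.ncard_univ]
    simp
  rw [← hcard]
  exact Set.ncard_le_ncard hsub (productSet_finite hn)

theorem le_one_of_matrix_commute {n : ℕ} (h : ∀ a b : Matrix (Fin n) (Fin n) K, a * b = b * a) :
    n ≤ 1 := by
  by_contra! hn
  have h1 := h (Matrix.single ⟨0, by omega⟩ ⟨1, hn⟩ 1) (Matrix.single ⟨1, hn⟩ ⟨0, by omega⟩ 1)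
  have h2 := congrFun (congrFun h1 ⟨0, by omega⟩) ⟨0, by omega⟩
  simp at h2

/-- There are at least `ℓ² + ℓm + m²` products as soon as some matrices generate an algebra with
full diagonal blocks that contains the superdiagonal matrix. -/
theorem blockDim_le_ncard [Infinite K] (hℓ : 0 < ℓ) (hm : 0 < m)
    {Y : Fin s → Matrix (Fin (ℓ + m)) (Fin (ℓ + m)) K} (hY : ∀ r, Y r ∈ blockUpper K ℓ m)
    (hT : ∀ a, ∃ M ∈ Algebra.adjoin K (Set.range Y), topLeft M = a)
    (hB : ∀ d, ∃ M ∈ Algebra.adjoin K (Set.range Y), bottomRight M = d)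
    (hS : supDiag K (ℓ + m) ∈ Algebra.adjoin K (Set.range Y)) :
    blockDim ℓ m ≤ (productSet k K ℓ m s r₀).ncard := by
  rcases lt_or_ge s 2 with hs | hs
  · obtain rfl | rfl : s = 0 ∨ s = 1 := by omega
    -- Without generators the algebra consists of scalars, and ℓ + m ≥ 2 makes SupDiag nonscalar.
    · exfalso
      rw [Set.range_eq_empty, Algebra.adjoin_empty] at hS
      obtain ⟨c, hc⟩ := Algebra.mem_bot.1 hS
      have := congrFun (congrFun hc ⟨0, by omega⟩) ⟨1, by omega⟩
      simp [supDiag, Matrix.algebraMap_matrix_apply] at this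
    · have hle : Algebra.adjoin K (Set.range Y) ≤ blockUpper K ℓ m := by
        refine Algebra.adjoin_le ?_
        rintro _ ⟨r, rfl⟩
        exact hY r
      -- A single generator gives a commutative algebra, which has full diagonal blocks only for ℓ =
      -- m = 1.
      have hcomm : ∀ M ∈ Algebra.adjoin K (Set.range Y), ∀ N ∈ Algebra.adjoin K (Set.range Y),
          M * N = N * M := by
        intro M hM N hN
        refine Algebra.commute_of_mem_adjoin_of_forall_mem_commute hN fun b hb => ?_
        refine (Algebra.commute_of_mem_adjoin_of_forall_mem_commute hM fun c hc => ?_).symm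
        obtain ⟨i, rfl⟩ := hb
        obtain ⟨j, rfl⟩ := hc
        rw [Subsingleton.elim i j]
        exact Commute.refl _
      obtain rfl : ℓ = 1 := by
        have := le_one_of_matrix_commute (K := K) (n := ℓ) fun a b => by
          obtain ⟨M, hM, rfl⟩ := hT a
          obtain ⟨N, hN, rfl⟩ := hT b
          rw [← topLeft_mul (hle hN), ← topLeft_mul (hle hM), hcomm M hM N hN]
        omega
      obtain rfl : m = 1 := by
        have := le_one_of_matrix_commute (K := K) (n := m) fun a b => by
          obtain ⟨M, hM, rfl⟩ := hB a
          obtain ⟨N, hN, rfl⟩ := hB b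
          rw [← bottomRight_mul (hle hN), ← bottomRight_mul (hle hM), hcomm M hM N hN]
        omega
      exact three_le_ncard_productSet r₀
  · exact blockDim_le_ncard_of_two_le hℓ hm hs

end Evaluation

end NonsplitTest

namespace NonsplitTest

/-! ### The test -/

section Test

variable {k K : Type*} [Field k] [Field K] [Algebra k K] {ℓ m s t : ℕ} {r₀ : Option (Fin s)}

/-- The generators of a finitely presented algebra. -/
noncomputable def fpGen (f : Fin t → FreeAlgebra k (Fin s)) (r : Fin s) : FPAlgebra f :=
  RingQuot.mkAlgHom k _ (FreeAlgebra.ι k r)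

theorem mkAlgHom_eq_lift {B : Type*} [Ring B] [Algebra k B] (f : Fin t → FreeAlgebra k (Fin s))
    (ρ : FPAlgebra f →ₐ[k] B) (x : FreeAlgebra k (Fin s)) :
    ρ (RingQuot.mkAlgHom k _ x) = FreeAlgebra.lift k (fun r => ρ (fpGen f r)) x := by
  have h : ρ.comp (RingQuot.mkAlgHom k _) = FreeAlgebra.lift k (fun r => ρ (fpGen f r)) :=
    FreeAlgebra.hom_ext (by ext r; simp [fpGen])
  exact DFunLike.congr_fun h x

theorem lift_relation_eq_zero {B : Type*} [Ring B] [Algebra k B]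
    (f : Fin t → FreeAlgebra k (Fin s)) (ρ : FPAlgebra f →ₐ[k] B) (j : Fin t) :
    FreeAlgebra.lift k (fun r => ρ (fpGen f r)) (f j) = 0 := by
  rw [← mkAlgHom_eq_lift, RingQuot.mkAlgHom_rel k ⟨⟨j, rfl⟩, rfl⟩, map_zero, map_zero]

/-- The representation of a finitely presented algebra with prescribed values at the generators. -/
noncomputable def fpLift {B : Type*} [Ring B] [Algebra k B] (f : Fin t → FreeAlgebra k (Fin s))
    (Y : Fin s → B) (h : ∀ j, FreeAlgebra.lift k Y (f j) = 0) : FPAlgebra f →ₐ[k] B :=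
  RingQuot.liftAlgHom k ⟨FreeAlgebra.lift k Y, by
    rintro _ _ ⟨⟨j, rfl⟩, rfl⟩
    rw [h j, map_zero]⟩

theorem fpLift_fpGen {B : Type*} [Ring B] [Algebra k B] (f : Fin t → FreeAlgebra k (Fin s))
    (Y : Fin s → B) (h : ∀ j, FreeAlgebra.lift k Y (f j) = 0) (r : Fin s) :
    fpLift f Y h (fpGen f r) = Y r := by
  rw [fpLift, fpGen, RingQuot.liftAlgHom_mkAlgHom_apply, FreeAlgebra.lift_ι_apply]

theorem lift_mem_adjoin {n : ℕ} (Y : Fin s → Matrix (Fin n) (Fin n) K)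
    (x : FreeAlgebra k (Fin s)) : FreeAlgebra.lift k Y x ∈ Algebra.adjoin K (Set.range Y) := by
  induction x using FreeAlgebra.induction with
  | grade0 c =>
    rw [AlgHom.commutes, IsScalarTower.algebraMap_apply k K (Matrix (Fin n) (Fin n) K)]
    exact Subalgebra.algebraMap_mem _ _
  | grade1 r =>
    rw [FreeAlgebra.lift_ι_apply]
    exact Algebra.subset_adjoin ⟨r, rfl⟩
  | mul x y hx hy =>
    rw [map_mul]
    exact mul_mem hx hy
  | add x y hx hy =>
    rw [map_add]
    exact add_mem hx hy

theorem imageAlgebra_eq_adjoin {n : ℕ} (f : Fin t → FreeAlgebra k (Fin s))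
    (ρ : FPAlgebra f →ₐ[k] Matrix (Fin n) (Fin n) K) :
    imageAlgebra ρ = Algebra.adjoin K (Set.range fun r => ρ (fpGen f r)) := by
  refine le_antisymm (Algebra.adjoin_le ?_) (Algebra.adjoin_mono ?_)
  · rintro _ ⟨a, rfl⟩
    obtain ⟨x, rfl⟩ := RingQuot.mkAlgHom_surjective k _ a
    rw [mkAlgHom_eq_lift]
    exact lift_mem_adjoin _ x
  · rintro _ ⟨r, rfl⟩
    exact ⟨_, rfl⟩

/-- Existence of a nonsplit extension in terms of the matrices that represent the generators. -/
theorem hasNonsplitExtension_of_matrices (hℓ : 0 < ℓ) (hm : 0 < m)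
    (f : Fin t → FreeAlgebra k (Fin s)) {Y : Fin s → Matrix (Fin (ℓ + m)) (Fin (ℓ + m)) K}
    (hY : ∀ r, Y r ∈ blockUpper K ℓ m) (hf : ∀ j, FreeAlgebra.lift k Y (f j) = 0)
    (hT : Algebra.adjoin K (Set.range fun r => topLeft (Y r)) = ⊤)
    (hB : Algebra.adjoin K (Set.range fun r => bottomRight (Y r)) = ⊤)
    (hS : supDiag K (ℓ + m) ∈ Algebra.adjoin K (Set.range Y)) :
    HasNonsplitExtension k K (FPAlgebra f) ℓ m := by
  let Y' : Fin s → blockUpper K ℓ m := fun r => ⟨Y r, hY r⟩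
  have hf' : ∀ j, FreeAlgebra.lift k Y' (f j) = 0 := by
    intro j
    apply Subtype.ext
    have h : (((blockUpper K ℓ m).val.restrictScalars k).comp (FreeAlgebra.lift k Y')) =
        FreeAlgebra.lift k Y := FreeAlgebra.hom_ext (by ext r : 1; simp [Y'])
    exact (DFunLike.congr_fun h (f j)).trans (hf j)
  let ρ := fpLift f Y' hf'
  have hρ : ∀ r, ρ (fpGen f r) = Y' r := fpLift_fpGen f Y' hf'
  refine ⟨ρ, ⟨?_, ?_⟩, ?_⟩
  · rw [IsIrreducibleRep, imageAlgebra_eq_adjoin, ← hT]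
    congr 3
    ext1 r
    change topLeft (ρ (fpGen f r)).1 = _
    rw [hρ]
  · rw [IsIrreducibleRep, imageAlgebra_eq_adjoin, ← hB]
    congr 3
    ext1 r
    change bottomRight (ρ (fpGen f r)).1 = _
    rw [hρ]
  · have hΛ : imageAlgebra (toRep ρ) = Algebra.adjoin K (Set.range Y) := by
      rw [imageAlgebra_eq_adjoin]
      congr 3
      ext1 r
      change (ρ (fpGen f r)).1 = _
      rw [hρ]
    intro hss
    -- The first half of the splitting criterion with τ the identity.
    refine supDiag_notMem_of_isSemisimpleRep hℓ hm ρ hss AlgEquiv.refl ⟨1, fun M => by simp⟩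
      (fun M hM => hM) ⟨_, ?_, rfl⟩
    rw [hΛ]
    exact hS

/-- A nonsplit extension can be brought to a form in which the superdiagonal matrix lies in the
image algebra, and a given generator is represented by an upper triangular matrix. -/
theorem HasNonsplitExtension.exists_matrices [IsAlgClosed K] (hℓ : 0 < ℓ) (hm : 0 < m)
    {f : Fin t → FreeAlgebra k (Fin s)} (h : HasNonsplitExtension k K (FPAlgebra f) ℓ m)
    (r₀ : Option (Fin s)) :
    ∃ Y : Fin s → Matrix (Fin (ℓ + m)) (Fin (ℓ + m)) K, HasGenericShape r₀ Y ∧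
      (∀ j, FreeAlgebra.lift k Y (f j) = 0) ∧
      (∀ a, ∃ M ∈ Algebra.adjoin K (Set.range Y), topLeft M = a) ∧
      (∀ d, ∃ M ∈ Algebra.adjoin K (Set.range Y), bottomRight M = d) ∧
      supDiag K (ℓ + m) ∈ Algebra.adjoin K (Set.range Y) := by
  obtain ⟨ρ, ⟨hirrT, hirrB⟩, hns⟩ := h
  set Λ := imageAlgebra (toRep ρ) with hΛ
  have hΛE : Λ ≤ blockUpper K ℓ m := imageAlgebra_toRep_le ρ
  have hT : ∀ a, ∃ M ∈ Λ, topLeft M = a := fun a =>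
    (exists_topLeft_eq_iff ρ a).2 (by rw [hirrT]; trivial)
  have hB : ∀ d, ∃ M ∈ Λ, bottomRight M = d := fun d =>
    (exists_bottomRight_eq_iff ρ d).2 (by rw [hirrB]; trivial)
  -- X is the matrix to be triangularized; the identity stands in when none is prescribed.
  obtain ⟨X, hXΛ, hX⟩ : ∃ X ∈ Λ, ∀ r, r₀ = some r → X = toRep ρ (fpGen f r) := by
    cases r₀ with
    | none => exact ⟨1, one_mem _, by simp⟩
    | some r =>
      refine ⟨toRep ρ (fpGen f r), range_subset_imageAlgebra _ _, ?_⟩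
      rintro r' h
      rw [Option.some.inj h]
  obtain ⟨g, h, ⟨M, hM, hMS⟩, hg, hh⟩ := exists_conj_supDiag_mem hℓ hm hΛE hT hB hns
    (fun n M => ∀ i j : Fin n, j < i → M i j = 0) exists_conj_upperTriangular hXΛ
  let c : Matrix (Fin (ℓ + m)) (Fin (ℓ + m)) K →ₐ[K] Matrix (Fin (ℓ + m)) (Fin (ℓ + m)) K :=
    (MulSemiringAction.toAlgEquiv K _ (ConjAct.toConjAct (blockUnit g h))).toAlgHom
  have hc : ∀ N, c N = (blockUnit g h).1 * N * (blockUnit g h)⁻¹.1 := fun _ => rfl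
  have hcE : ∀ N ∈ Λ, c N = blockMatrix (g.1 * topLeft N * g⁻¹.1) (g.1 * topRight N * h⁻¹.1)
      (h.1 * bottomRight N * h⁻¹.1) := by
    intro N hN
    rw [hc, ← blockUnit_conj, blockMatrix_eta (hΛE hN)]
  let ρ' : FPAlgebra f →ₐ[k] Matrix (Fin (ℓ + m)) (Fin (ℓ + m)) K :=
    (c.restrictScalars k).comp (toRep ρ)
  have hmap : Algebra.adjoin K (Set.range fun r => ρ' (fpGen f r)) = Λ.map c := by
    rw [hΛ, imageAlgebra_eq_adjoin, AlgHom.map_adjoin, ← Set.range_comp]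
    rfl
  refine ⟨fun r => ρ' (fpGen f r), ⟨?_, ?_⟩, lift_relation_eq_zero f ρ', ?_, ?_, ?_⟩
  · intro r
    change c (toRep ρ (fpGen f r)) ∈ _
    rw [hcE _ (range_subset_imageAlgebra _ _)]
    exact blockMatrix_mem _ _ _
  · intro r hr i j hij
    change c (toRep ρ (fpGen f r)) i j = 0
    rw [← hX r hr, hcE X hXΛ]
    -- A block upper triangular matrix is upper triangular as soon as both diagonal blocks are.
    revert hij
    refine Fin.addCases (fun i => ?_) (fun i => ?_) i <;>
      refine Fin.addCases (fun j => ?_) (fun j => ?_) j <;> intro hij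
    · exact (congrFun (congrFun (topLeft_blockMatrix _ _ _) i) j).trans (hg i j hij)
    · exfalso
      have : ℓ + (j : ℕ) < i := hij
      omega
    · exact blockMatrix_mem _ _ _ i j
    · refine (congrFun (congrFun (bottomRight_blockMatrix _ _ _) i) j).trans (hh i j ?_)
      have : ℓ + (j : ℕ) < ℓ + i := hij
      rw [Fin.lt_def]
      omega
  · intro a
    obtain ⟨N, hN, hNa⟩ := hT (g⁻¹.1 * a * g.1)
    refine ⟨c N, by rw [hmap]; exact ⟨N, hN, rfl⟩, ?_⟩
    rw [hcE N hN, topLeft_blockMatrix, hNa]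
    simp [mul_assoc]
  · intro d
    obtain ⟨N, hN, hNd⟩ := hB (h⁻¹.1 * d * h.1)
    refine ⟨c N, by rw [hmap]; exact ⟨N, hN, rfl⟩, ?_⟩
    rw [hcE N hN, bottomRight_blockMatrix, hNd]
    simp [mul_assoc]
  · rw [hmap]
    exact ⟨M, hM, hMS⟩

/-- The block is multiplicative only on E, so generation is compared inside E before projecting. -/
theorem topLeft_mem_adjoin {Y : Fin s → Matrix (Fin (ℓ + m)) (Fin (ℓ + m)) K}
    (hY : ∀ r, Y r ∈ blockUpper K ℓ m) {M : Matrix (Fin (ℓ + m)) (Fin (ℓ + m)) K}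
    (hM : M ∈ Algebra.adjoin K (Set.range Y)) :
    topLeft M ∈ Algebra.adjoin K (Set.range fun r => topLeft (Y r)) := by
  let Y' : Fin s → blockUpper K ℓ m := fun r => ⟨Y r, hY r⟩
  have h1 : Algebra.adjoin K (Set.range Y) =
      (Algebra.adjoin K (Set.range Y')).map (blockUpper K ℓ m).val := by
    rw [AlgHom.map_adjoin, ← Set.range_comp]
    rfl
  rw [h1] at hM
  obtain ⟨N, hN, rfl⟩ := hM
  have h2 : Algebra.adjoin K (Set.range fun r => topLeft (Y r)) =
      (Algebra.adjoin K (Set.range Y')).map (projTop K ℓ m) := by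
    rw [AlgHom.map_adjoin, ← Set.range_comp]
    rfl
  rw [h2]
  exact ⟨N, hN, rfl⟩

theorem bottomRight_mem_adjoin {Y : Fin s → Matrix (Fin (ℓ + m)) (Fin (ℓ + m)) K}
    (hY : ∀ r, Y r ∈ blockUpper K ℓ m) {M : Matrix (Fin (ℓ + m)) (Fin (ℓ + m)) K}
    (hM : M ∈ Algebra.adjoin K (Set.range Y)) :
    bottomRight M ∈ Algebra.adjoin K (Set.range fun r => bottomRight (Y r)) := by
  let Y' : Fin s → blockUpper K ℓ m := fun r => ⟨Y r, hY r⟩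
  have h1 : Algebra.adjoin K (Set.range Y) =
      (Algebra.adjoin K (Set.range Y')).map (blockUpper K ℓ m).val := by
    rw [AlgHom.map_adjoin, ← Set.range_comp]
    rfl
  rw [h1] at hM
  obtain ⟨N, hN, rfl⟩ := hM
  have h2 : Algebra.adjoin K (Set.range fun r => bottomRight (Y r)) =
      (Algebra.adjoin K (Set.range Y')).map (projBot K ℓ m) := by
    rw [AlgHom.map_adjoin, ← Set.range_comp]
    rfl
  rw [h2]
  exact ⟨N, hN, rfl⟩

theorem evalMatrix_trace {n : ℕ} (z : Indet ℓ m s → K) (M : PolyMatrix k ℓ m s n) :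
    MvPolynomial.aeval z M.trace = (evalMatrix z M).trace :=
  map_sum _ _ _

theorem evalMatrix_standardPoly {n ν : ℕ} (z : Indet ℓ m s → K) (M₀ : PolyMatrix k ℓ m s n)
    (M : Fin ν → PolyMatrix k ℓ m s n) :
    evalMatrix z (M₀ * standardPoly M) =
      evalMatrix z M₀ * standardPoly fun i => evalMatrix z (M i) := by
  rw [map_mul]
  congr 1
  exact map_standardPoly (evalMatrix (k := k) z).toRingHom M

theorem evalMatrix_lift (z : Indet ℓ m s → K) (x : FreeAlgebra k (Fin s)) :
    evalMatrix z (FreeAlgebra.lift k (genericBlock k ℓ m s r₀) x) =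
      FreeAlgebra.lift k (fun r => evalMatrix z (genericBlock k ℓ m s r₀ r)) x := by
  have h : (evalMatrix z).comp (FreeAlgebra.lift k (genericBlock k ℓ m s r₀)) =
      FreeAlgebra.lift k (fun r => evalMatrix z (genericBlock k ℓ m s r₀ r)) :=
    FreeAlgebra.hom_ext (by ext r : 1; simp)
  exact DFunLike.congr_fun h x

theorem evalMatrix_supDiag (z : Indet ℓ m s → K) :
    evalMatrix z (supDiag (MvPolynomial (Indet ℓ m s) k) (ℓ + m)) = supDiag K (ℓ + m) := by
  ext i j
  rw [evalMatrix_apply, supDiag, supDiag, Matrix.of_apply, Matrix.of_apply]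
  split_ifs <;> simp

theorem evalMatrix_smul {n : ℕ} (z : Indet ℓ m s → K) (p : MvPolynomial (Indet ℓ m s) k)
    (M : PolyMatrix k ℓ m s n) :
    evalMatrix z (p • M) = MvPolynomial.aeval z p • evalMatrix z M := by
  ext i j
  simp [evalMatrix_apply]

/-- The common zeros of the system attached to a choice. -/
theorem isZero_testSystem_iff (f : Fin t → FreeAlgebra k (Fin s)) (c : Choice k K ℓ m s r₀)
    (z : Indet ℓ m s → K) :
    (∀ p ∈ testSystem f c, MvPolynomial.aeval z p = 0) ↔
      z .v * (evalMatrix z c.v₀ * standardPoly fun i => evalMatrix z (c.v i)).trace = 1 ∧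
      z .w * (evalMatrix z c.w₀ * standardPoly fun i => evalMatrix z (c.w i)).trace = 1 ∧
      ∑ i, z (.y i) • evalMatrix z (c.y i) = supDiag K (ℓ + m) ∧
      ∀ j, FreeAlgebra.lift k (fun r => evalMatrix z (genericBlock k ℓ m s r₀ r)) (f j) = 0 := by
  have hent : ∀ {n : ℕ} (M : PolyMatrix k ℓ m s n),
      (∀ p ∈ entries M, MvPolynomial.aeval z p = 0) ↔ evalMatrix z M = 0 := by
    intro n M
    constructor
    · intro h
      ext i j
      exact h _ ⟨i, j, rfl⟩
    · rintro h _ ⟨i, j, rfl⟩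
      exact congrFun (congrFun h i) j
  have h3 := hent ((∑ i, (MvPolynomial.X (Indet.y i) : MvPolynomial (Indet ℓ m s) k) • c.y i) -
    supDiag (MvPolynomial (Indet ℓ m s) k) (ℓ + m))
  rw [map_sub, map_sum, evalMatrix_supDiag, sub_eq_zero] at h3
  simp only [evalMatrix_smul, MvPolynomial.aeval_X] at h3
  have h4 : (∀ p ∈ ⋃ j, entries (FreeAlgebra.lift k (genericBlock k ℓ m s r₀) (f j)),
      MvPolynomial.aeval z p = 0) ↔
      ∀ j, FreeAlgebra.lift k (fun r => evalMatrix z (genericBlock k ℓ m s r₀ r)) (f j) = 0 := by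
    simp only [← evalMatrix_lift, ← hent, Set.mem_iUnion]
    exact ⟨fun h j p hp => h p ⟨j, hp⟩, fun h p ⟨j, hp⟩ => h j p hp⟩
  rw [testSystem]
  simp only [Set.mem_union, or_imp, forall_and, Set.mem_singleton_iff, forall_eq]
  rw [h3, h4, map_sub, map_mul, MvPolynomial.aeval_X, evalMatrix_trace, evalMatrix_standardPoly,
    map_one, sub_eq_zero, map_sub, map_mul, MvPolynomial.aeval_X, evalMatrix_trace,
    evalMatrix_standardPoly, map_one, sub_eq_zero, and_assoc, and_assoc]

/-- The equations for v and w make the two traces nonzero, which forces full diagonal blocks; the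
equations for the y_c put SupDiag into the generated algebra. -/
theorem hasNonsplitExtension_of_hasCommonZero [IsAlgClosed K] (hℓ : 0 < ℓ) (hm : 0 < m)
    (f : Fin t → FreeAlgebra k (Fin s)) (c : Choice k K ℓ m s r₀)
    (h : HasCommonZero K (testSystem f c)) : HasNonsplitExtension k K (FPAlgebra f) ℓ m := by
  obtain ⟨z, hz⟩ := h
  rw [isZero_testSystem_iff] at hz
  obtain ⟨hv, hw, hy, hf⟩ := hz
  set Y : Fin s → Matrix (Fin (ℓ + m)) (Fin (ℓ + m)) K :=
    fun r => evalMatrix z (genericBlock k ℓ m s r₀ r) with hYdef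
  have hY : ∀ r, Y r ∈ blockUpper K ℓ m := by
    intro r
    rw [mem_blockUpper_iff]
    intro i j hij
    change evalMatrix z (genericBlock k ℓ m s r₀ r) i j = 0
    rw [evalMatrix_apply, genericBlock, Matrix.of_apply, if_neg (fun h => hij h.1), map_zero]
  have hU : ∀ u ∈ productSet k K ℓ m s r₀, evalMatrix z u ∈ Algebra.adjoin K (Set.range Y) := by
    intro u hu
    obtain ⟨L, -, rfl⟩ := (mem_productSet_iff (by omega)).1 hu
    rw [map_list_prod, List.map_map]
    refine Subalgebra.list_prod_mem _ fun x hx => ?_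
    obtain ⟨r, -, rfl⟩ := List.mem_map.1 hx
    exact Algebra.subset_adjoin ⟨r, rfl⟩
  have hUT : ∀ u ∈ topLeft '' productSet k K ℓ m s r₀,
      evalMatrix z u ∈ Algebra.adjoin K (Set.range fun r => topLeft (Y r)) := by
    rintro _ ⟨u, hu, rfl⟩
    exact topLeft_mem_adjoin hY (hU u hu)
  have hUB : ∀ u ∈ bottomRight '' productSet k K ℓ m s r₀,
      evalMatrix z u ∈ Algebra.adjoin K (Set.range fun r => bottomRight (Y r)) := by
    rintro _ ⟨u, hu, rfl⟩
    exact bottomRight_mem_adjoin hY (hU u hu)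
  refine hasNonsplitExtension_of_matrices hℓ hm f hY hf ?_ ?_ ?_
  · exact eq_top_of_trace_mul_standardPoly_ne_zero _ le_rfl (hUT _ c.v₀_mem)
      (fun i => hUT _ (c.v_mem i)) fun h0 => by simp [h0] at hv
  · exact eq_top_of_trace_mul_standardPoly_ne_zero _ le_rfl (hUB _ c.w₀_mem)
      (fun i => hUB _ (c.w_mem i)) fun h0 => by simp [h0] at hw
  · rw [← hy]
    exact Subalgebra.sum_mem _ fun i _ => Subalgebra.smul_mem _ (hU _ (c.y_mem i)) _

/-- A vector in the span of the image of a finite set is a combination of the images of exactly `q`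
distinct elements, if the set is large enough and the span small enough. -/
theorem exists_injective_sum_smul_eq {X V : Type*} [AddCommGroup V] [Module K V]
    [FiniteDimensional K V] {U : Set X} (hU : U.Finite) (g : X → V) {q : ℕ} (hq : q ≤ U.ncard)
    (hspan : Module.finrank K (Submodule.span K (g '' U)) ≤ q) {T : V}
    (hT : T ∈ Submodule.span K (g '' U)) :
    ∃ y : Fin q → X, Function.Injective y ∧ (∀ i, y i ∈ U) ∧
      ∃ c : Fin q → K, ∑ i, c i • g (y i) = T := by
  -- Choose a basis of the span among the values and one preimage for each of its members. Then add
  -- elements of U until there are exactly q; repeated values of the added ones do no harm.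
  obtain ⟨b, hb, hbspan, hli⟩ := exists_linearIndependent K (g '' U)
  have hbfin : b.Finite := (hU.image g).subset hb
  obtain ⟨U', hU'U, hbij⟩ := Set.SurjOn.exists_bijOn_subset (f := g) (s := U) (t := b) hb
  have hcard : U'.ncard ≤ q := by
    have h1 : U'.ncard = b.ncard := by
      rw [← hbij.image_eq, Set.InjOn.ncard_image hbij.injOn]
    have := hbfin.fintype
    have h2 := finrank_span_set_eq_card hli
    rw [hbspan, ← Set.ncard_eq_toFinset_card'] at h2
    omega
  obtain ⟨W, hU'W, hWU, hW⟩ := Set.exists_subsuperset_card_eq hU'U hcard hq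
  have : Finite W := hU.subset hWU
  let e : Fin q ≃ W := (Finite.equivFinOfCardEq (by rw [Nat.card_coe_set_eq, hW])).symm
  refine ⟨fun i => (e i).1, fun i j h => e.injective (Subtype.ext h), fun i => hWU (e i).2, ?_⟩
  have hmem : T ∈ Submodule.span K (Set.range fun i => g (e i).1) := by
    rw [← hbspan] at hT
    refine Submodule.span_mono ?_ hT
    intro x hx
    obtain ⟨u, hu, rfl⟩ := hbij.surjOn hx
    exact ⟨e.symm ⟨u, hU'W hu⟩, by simp⟩
  exact (Submodule.mem_span_range_iff_exists_fun K).1 hmem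

theorem exists_trace_mul_standardPoly_ne_zero_of_image {X : Type*} {n : ℕ} (hn : 0 < n) {U : Set X}
    (g : X → Matrix (Fin n) (Fin n) K) (hU : Submodule.span K (g '' U) = ⊤) :
    ∃ v₀ ∈ U, ∃ v : Fin (2 * (n - 1)) → X, Function.Injective v ∧ (∀ i, v i ∈ U) ∧
      Matrix.trace (g v₀ * standardPoly fun i => g (v i)) ≠ 0 := by
  obtain ⟨_, ⟨v₀, hv₀, rfl⟩, a, ha, htr⟩ := exists_trace_mul_standardPoly_ne_zero hn hU
  choose v hv hva using ha
  obtain rfl : (fun i => g (v i)) = a := funext hva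
  refine ⟨v₀, hv₀, v, ?_, hv, htr⟩
  have hinj : Function.Injective fun i => g (v i) :=
    injective_of_standardPoly_ne_zero (K := K) fun h => htr (by rw [h, mul_zero, Matrix.trace_zero])
  exact fun i j h => hinj (congrArg g h)

/-- After normalization the matrices Y_r provide the values of the x_{ij}(r). The values of U span
their algebra, so suitable products for the traces and for SupDiag exist in U. -/
theorem exists_hasCommonZero_of_hasNonsplitExtension [IsAlgClosed K] (hℓ : 0 < ℓ) (hm : 0 < m)
    (f : Fin t → FreeAlgebra k (Fin s)) (h : HasNonsplitExtension k K (FPAlgebra f) ℓ m) :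
    ∃ c : Choice k K ℓ m s r₀, HasCommonZero K (testSystem f c) := by
  have hn : 2 ≤ ℓ + m := by omega
  obtain ⟨Y, hY, hf, hT, hB, hS⟩ := h.exists_matrices hℓ hm r₀
  have hinf : Infinite K := IsAlgClosed.instInfinite
  have hcard := blockDim_le_ncard (k := k) (r₀ := r₀) hℓ hm hY.1 hT hB hS
  have hspan := span_evalMatrix_productSet (k := k) hn hY
  have hfin := productSet_finite (k := k) (K := K) (s := s) (r₀ := r₀) hn
  have hle : Algebra.adjoin K (Set.range Y) ≤ blockUpper K ℓ m := by
    refine Algebra.adjoin_le ?_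
    rintro _ ⟨r, rfl⟩
    exact hY.1 r
  obtain ⟨v₀, hv₀, v, hvinj, hv, hvtr⟩ := exists_trace_mul_standardPoly_ne_zero_of_image hℓ
    (U := topLeft '' productSet k K ℓ m s r₀) (evalMatrix (point Y 0 0 0)) (by
      rw [eq_top_iff]
      intro a _
      obtain ⟨M, hM, rfl⟩ := hT a
      rw [← Subalgebra.mem_toSubmodule, ← hspan] at hM
      have h1 := Submodule.mem_map_of_mem
        (f := (LinearMap.mk ⟨topLeft, fun _ _ => rfl⟩ fun _ _ => rfl :
          Matrix (Fin (ℓ + m)) (Fin (ℓ + m)) K →ₗ[K] Matrix (Fin ℓ) (Fin ℓ) K)) hM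
      rw [Submodule.map_span] at h1
      refine Submodule.span_mono ?_ h1
      rintro _ ⟨_, ⟨u, hu, rfl⟩, rfl⟩
      exact ⟨_, ⟨u, hu, rfl⟩, rfl⟩)
  obtain ⟨w₀, hw₀, w, hwinj, hw, hwtr⟩ := exists_trace_mul_standardPoly_ne_zero_of_image hm
    (U := bottomRight '' productSet k K ℓ m s r₀) (evalMatrix (point Y 0 0 0)) (by
      rw [eq_top_iff]
      intro a _
      obtain ⟨M, hM, rfl⟩ := hB a
      rw [← Subalgebra.mem_toSubmodule, ← hspan] at hM
      have h1 := Submodule.mem_map_of_mem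
        (f := (LinearMap.mk ⟨bottomRight, fun _ _ => rfl⟩ fun _ _ => rfl :
          Matrix (Fin (ℓ + m)) (Fin (ℓ + m)) K →ₗ[K] Matrix (Fin m) (Fin m) K)) hM
      rw [Submodule.map_span] at h1
      refine Submodule.span_mono ?_ h1
      rintro _ ⟨_, ⟨u, hu, rfl⟩, rfl⟩
      exact ⟨_, ⟨u, hu, rfl⟩, rfl⟩)
  obtain ⟨y, hyinj, hy, d, hd⟩ := exists_injective_sum_smul_eq hfin (evalMatrix (point Y 0 0 0)) hcard
    (by
      rw [hspan, ← finrank_blockUpper K]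
      exact Submodule.finrank_mono (t := Subalgebra.toSubmodule (blockUpper K ℓ m)) hle)
    (by
      rw [hspan]
      exact hS)
  have hevT : ∀ a b e, ∀ u ∈ topLeft '' productSet k K ℓ m s r₀,
      evalMatrix (point Y a b e) u = evalMatrix (point Y 0 0 0) u := by
    rintro a b e _ ⟨u, hu, rfl⟩
    exact congrArg topLeft (evalMatrix_mem_productSet hn hY a b e hu)
  have hevB : ∀ a b e, ∀ u ∈ bottomRight '' productSet k K ℓ m s r₀,
      evalMatrix (point Y a b e) u = evalMatrix (point Y 0 0 0) u := by
    rintro a b e _ ⟨u, hu, rfl⟩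
    exact congrArg bottomRight (evalMatrix_mem_productSet hn hY a b e hu)
  -- The values of v and w are the inverses of the two nonzero traces, computed with v = w = y = 0
  -- since they do not depend on those coordinates.
  refine ⟨⟨v₀, hv₀, v, hvinj, hv, w₀, hw₀, w, hwinj, hw, y, hyinj, hy⟩,
    point Y (evalMatrix (point Y 0 0 0) v₀ * standardPoly fun i =>
      evalMatrix (point Y 0 0 0) (v i)).trace⁻¹ (evalMatrix (point Y 0 0 0) w₀ * standardPoly fun i =>
      evalMatrix (point Y 0 0 0) (w i)).trace⁻¹ d, ?_⟩
  rw [isZero_testSystem_iff]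
  refine ⟨?_, ?_, ?_, ?_⟩
  · simp only [hevT _ _ _ _ hv₀, hevT _ _ _ _ (hv _)]
    exact inv_mul_cancel₀ hvtr
  · simp only [hevB _ _ _ _ hw₀, hevB _ _ _ _ (hw _)]
    exact inv_mul_cancel₀ hwtr
  · simp only [evalMatrix_mem_productSet hn hY _ _ _ (hy _)]
    exact hd
  · simp only [evalMatrix_point_genericBlock hY]
    exact hf

end Test

end NonsplitTest

namespace NonsplitTest

/-! ### Computable operations on lists -/

section ComputableLists

variable {α β γ σ : Type*} [Primcodable α] [Primcodable β] [Primcodable γ] [Primcodable σ]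

/-- Primitive recursion on the number of entries consumed. Reading past the end would leave the
accumulator unchanged, but the recursion stops at the length of the list. -/
theorem computable_list_foldl {f : α → List β} {g : α → σ} {h : α → σ → β → σ}
    (hf : Computable f) (hg : Computable g)
    (hh : Computable fun x : α × σ × β => h x.1 x.2.1 x.2.2) :
    Computable fun a => (f a).foldl (h a) (g a) := by
  have hstep : Computable₂ fun (a : α) (x : ℕ × σ) =>
      Option.casesOn (motive := fun _ => σ) ((f a)[x.1]?) x.2 (fun b => h a x.2 b) := by
    refine Computable.option_casesOn ?_ ?_ ?_
    · exact Computable.list_getElem?.comp (hf.comp Computable.fst)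
        (Computable.fst.comp Computable.snd)
    · exact Computable.snd.comp Computable.snd
    · exact hh.comp ((Computable.fst.comp Computable.fst).pair
        (((Computable.snd.comp Computable.snd).comp Computable.fst).pair Computable.snd))
  refine (Computable.nat_rec (Computable.list_length.comp hf) hg hstep).of_eq fun a => ?_
  have key : ∀ n ≤ (f a).length, (Nat.rec (motive := fun _ => σ) (g a) (fun n acc =>
      Option.casesOn (motive := fun _ => σ) ((f a)[n]?) acc (fun b => h a acc b)) n) =
      ((f a).take n).foldl (h a) (g a) := by
    intro n
    induction n with
    | zero => simp
    | succ n ih =>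
      intro hn
      have hlt : n < (f a).length := hn
      simp only [ih hlt.le, List.getElem?_eq_getElem hlt, List.take_succ_eq_append_getElem hlt,
        List.foldl_append, List.foldl_cons, List.foldl_nil]
  simpa using key _ le_rfl

theorem computable_list_map {f : α → List β} {h : α → β → σ} (hf : Computable f)
    (hh : Computable₂ h) : Computable fun a => (f a).map (h a) := by
  refine (computable_list_foldl (h := fun a l b => l ++ [h a b]) hf
    (Computable.const ([] : List σ)) ?_).of_eq fun a => ?_
  · exact Computable.list_concat.comp (Computable.fst.comp Computable.snd)
      (hh.comp Computable.fst (Computable.snd.comp Computable.snd))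
  · have key : ∀ (L : List β) (l : List σ),
        L.foldl (fun l b => l ++ [h a b]) l = l ++ L.map (h a) := by
      intro L
      induction L with
      | nil => simp
      | cons b L ih => simp [ih]
    simpa using key (f a) []

theorem computable_list_all {f : α → List β} {h : α → β → Bool} (hf : Computable f)
    (hh : Computable₂ h) : Computable fun a => (f a).all (h a) := by
  refine (computable_list_foldl (h := fun a l b => l && h a b) hf
    (Computable.const true) ?_).of_eq fun a => ?_
  · exact Primrec.and.to_comp.comp (Computable.fst.comp Computable.snd)
      (hh.comp Computable.fst (Computable.snd.comp Computable.snd))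
  · have key : ∀ (L : List β) (l : Bool),
        L.foldl (fun l b => l && h a b) l = (l && L.all (h a)) := by
      intro L
      induction L with
      | nil => simp
      | cons b L ih => simp [ih, Bool.and_assoc]
    simpa using key (f a) true

theorem computable_list_flatMap {f : α → List β} {h : α → β → List σ} (hf : Computable f)
    (hh : Computable₂ h) : Computable fun a => (f a).flatMap (h a) := by
  refine (Primrec.list_flatten.to_comp.comp (computable_list_map hf hh)).of_eq fun a => ?_
  rw [List.flatMap_def]

theorem computable_list_sum [AddMonoid β] (hadd : Computable₂ fun a b : β => a + b)
    {f : α → List β} (hf : Computable f) : Computable fun a => (f a).sum := by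
  refine (computable_list_foldl (h := fun _ b c => b + c) hf (Computable.const 0) ?_).of_eq
    fun a => ?_
  · exact hadd.comp (Computable.fst.comp Computable.snd) (Computable.snd.comp Computable.snd)
  · rw [List.sum_eq_foldl]

/-- Projection of a decidable relation is recursively enumerable. -/
theorem rePred_exists {R : α → β → Bool} (hR : Computable₂ R) :
    REPred fun a => ∃ b, R a b = true := by
  have h : Computable₂ fun (a : α) (n : ℕ) =>
      Option.casesOn (motive := fun _ => Bool) (Encodable.decode (α := β) n) false
        (fun b => R a b) := by
    refine Computable.option_casesOn ?_ ?_ ?_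
    · exact Computable.decode.comp Computable.snd
    · exact Computable.const false
    · exact hR.comp (Computable.fst.comp Computable.fst) Computable.snd
  -- Unbounded search through the codes of β; numbers that code nothing count as failures.
  refine (Partrec.rfind h.partrec₂).dom_re.of_eq fun a => ?_
  rw [Nat.rfind_dom]
  constructor
  · rintro ⟨n, hn, -⟩
    rw [PFun.coe_val, Part.mem_some_iff] at hn
    cases hd : (Encodable.decode (α := β) n) with
    | none => simp [hd] at hn
    | some b => exact ⟨b, by simpa [hd] using hn.symm⟩
  · rintro ⟨b, hb⟩
    refine ⟨Encodable.encode b, ?_, fun _ => trivial⟩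
    rw [PFun.coe_val, Part.mem_some_iff]
    simp [Encodable.encodek, hb]

end ComputableLists

/-! ### Points of commutative quotients -/

section Points

variable {k : Type*} (K : Type*) [Field k] [Field K] [Algebra k K]

/-- A nontrivial algebra of finite type over `k` has a point over every algebraically closed
extension. -/
theorem nonempty_algHom_of_finiteType [IsAlgClosed K] (S : Type*) [CommRing S] [Algebra k S]
    [Nontrivial S] [Algebra.FiniteType k S] : Nonempty (S →ₐ[k] K) := by
  -- The residue field at a maximal ideal is finite over k by Zariski's lemma, hence embeds in K.
  obtain ⟨I, hI⟩ := Ideal.exists_maximal S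
  let _ : Field (S ⧸ I) := Ideal.Quotient.field I
  have : Algebra.FiniteType k (S ⧸ I) :=
    Algebra.FiniteType.of_surjective (Ideal.Quotient.mkₐ k I) (Ideal.Quotient.mkₐ_surjective k I)
  have : Module.Finite k (S ⧸ I) := finite_of_finite_type_of_isJacobsonRing k (S ⧸ I)
  exact ⟨(IsAlgClosed.lift (R := k) (S := S ⧸ I) (M := K)).comp (Ideal.Quotient.mkₐ k I)⟩

/-- The value of a list of terms at a family of elements of an algebra. -/
def termsEval {A : Type*} [Ring A] [Algebra k A] (x : ℕ → A) (T : List (k × List ℕ)) : A :=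
  (T.map fun c => c.1 • (c.2.map x).prod).sum

@[simp]
theorem termsEval_nil {A : Type*} [Ring A] [Algebra k A] (x : ℕ → A) :
    termsEval x ([] : List (k × List ℕ)) = 0 := rfl

@[simp]
theorem termsEval_cons {A : Type*} [Ring A] [Algebra k A] (x : ℕ → A) (c : k × List ℕ)
    (T : List (k × List ℕ)) :
    termsEval x (c :: T) = c.1 • (c.2.map x).prod + termsEval x T := rfl

@[simp]
theorem termsEval_append {A : Type*} [Ring A] [Algebra k A] (x : ℕ → A)
    (T T' : List (k × List ℕ)) :
    termsEval x (T ++ T') = termsEval x T + termsEval x T' := by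
  simp [termsEval]

theorem map_termsEval {A B : Type*} [Ring A] [Algebra k A] [Ring B] [Algebra k B]
    (φ : A →ₐ[k] B) (x : ℕ → A) (T : List (k × List ℕ)) :
    φ (termsEval x T) = termsEval (fun a => φ (x a)) T := by
  induction T with
  | nil => simp
  | cons c T ih => simp [ih, map_list_prod, Function.comp_def]

theorem termsEval_congr {A : Type*} [Ring A] [Algebra k A] {x y : ℕ → A}
    {T : List (k × List ℕ)} (h : ∀ c ∈ T, ∀ a ∈ c.2, x a = y a) :
    termsEval x T = termsEval y T := by
  rw [termsEval, termsEval]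
  congr 1
  refine List.map_congr_left fun c hc => ?_
  rw [List.map_congr_left (h c hc)]

/-- The letters that occur in a system. -/
def letters {k : Type*} (H : List (List (k × List ℕ))) : List ℕ :=
  H.flatMap fun T => T.flatMap fun c => c.2

theorem mem_letters {k : Type*} {H : List (List (k × List ℕ))} {T : List (k × List ℕ)} (hT : T ∈ H)
    {c : k × List ℕ} (hc : c ∈ T) {a : ℕ} (ha : a ∈ c.2) : a ∈ letters H :=
  List.mem_flatMap.2 ⟨T, hT, List.mem_flatMap.2 ⟨c, hc, ha⟩⟩

/-- The system `H` together with the commutators of its letters. -/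
def withCommutators (H : List (List (k × List ℕ))) : List (List (k × List ℕ)) :=
  H ++ (letters H).flatMap fun a => (letters H).map fun b => [(1, [a, b]), (-1, [b, a])]

theorem forall_withCommutators {A : Type*} [Ring A] [Algebra k A]
    {H : List (List (k × List ℕ))} {x : ℕ → A} :
    (∀ T ∈ withCommutators H, termsEval x T = 0) ↔
      (∀ T ∈ H, termsEval x T = 0) ∧
        ∀ a ∈ letters H, ∀ b ∈ letters H, x a * x b = x b * x a := by
  simp only [withCommutators, List.mem_append, or_imp, forall_and, List.mem_flatMap, List.mem_map]
  refine and_congr_right fun _ => ⟨fun h a ha b hb => ?_, ?_⟩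
  · have := h _ ⟨a, ha, b, hb, rfl⟩
    simpa [sub_eq_zero, ← sub_eq_add_neg] using this
  · rintro h _ ⟨a, ha, b, hb, rfl⟩
    simp [h a ha b hb]

open scoped IsMulCommutative in
/-- A system that is satisfied by commuting elements of a nontrivial algebra has a common zero
over an algebraically closed field. -/
theorem exists_zero_of_commute [IsAlgClosed K] {A : Type*} [Ring A] [Algebra k A] [Nontrivial A]
    {H : List (List (k × List ℕ))} (x : ℕ → A)
    (hx : ∀ T ∈ withCommutators H, termsEval x T = 0) :
    ∃ z : ℕ → K, ∀ T ∈ H, termsEval z T = 0 := by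
  classical
  obtain ⟨hH, hcomm⟩ := forall_withCommutators.1 hx
  -- The values of the finitely many letters that occur generate a commutative algebra of finite
  -- type, which has a K-point. Letters that do not occur are irrelevant and are given the value 0.
  let s : Set A := x '' {a | a ∈ letters H}
  have hs : ∀ a ∈ s, ∀ b ∈ s, a * b = b * a := by
    rintro _ ⟨a, ha, rfl⟩ _ ⟨b, hb, rfl⟩
    exact hcomm a ha b hb
  have hfin : s.Finite := (List.finite_toSet (letters H)).image x
  have := Algebra.isMulCommutative_adjoin k hs
  have : Algebra.FiniteType k (Algebra.adjoin k s) :=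
    (Subalgebra.fg_iff_finiteType _).1 ⟨hfin.toFinset, by simp⟩
  obtain ⟨φ⟩ := nonempty_algHom_of_finiteType (k := k) K (Algebra.adjoin k s)
  let x' : ℕ → Algebra.adjoin k s := fun a =>
    if h : a ∈ letters H then ⟨x a, Algebra.subset_adjoin ⟨a, h, rfl⟩⟩ else 0
  refine ⟨fun a => φ (x' a), fun T hT => ?_⟩
  rw [← map_termsEval φ x' T]
  have : termsEval x' T = 0 := by
    apply Subtype.val_injective
    have h1 := map_termsEval (Algebra.adjoin k s).val x' T
    refine h1.trans (Eq.trans ?_ (hH T hT))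
    refine termsEval_congr fun c hc a ha => ?_
    have : a ∈ letters H := mem_letters hT hc ha
    simp [x', this]
  rw [this, map_zero]

end Points

end NonsplitTest

namespace NonsplitTest

/-! ### Certificates of unsolvability -/

section Refutation

variable {k : Type*} [Field k]

theorem termsEval_flatMap {ι A : Type*} [Ring A] [Algebra k A] (x : ℕ → A)
    (E : List ι) (f : ι → List (k × List ℕ)) :
    termsEval x (E.flatMap f) = (E.map fun e => termsEval x (f e)).sum := by
  induction E with
  | nil => simp
  | cons e E ih => simp [ih]

theorem termsEval_map_mul {A : Type*} [Ring A] [Algebra k A] (x : ℕ → A) (a : k) (u v : List ℕ)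
    (T : List (k × List ℕ)) :
    termsEval x (T.map fun c => (a * c.1, u ++ c.2 ++ v)) =
      a • ((u.map x).prod * termsEval x T * (v.map x).prod) := by
  induction T with
  | nil => simp
  | cons c T ih =>
    simp only [List.map_cons, termsEval_cons, ih, List.map_append, List.prod_append, mul_add,
      add_mul, smul_add, mul_smul, mul_smul_comm, smul_mul_assoc]

/-- The coefficient of a word in a list of terms. -/
def termsCoeff [DecidableEq k] (T : List (k × List ℕ)) (w : List ℕ) : k :=
  (T.map fun c => if c.2 = w then c.1 else 0).sum

/-- All words have coefficient zero in the list of terms. -/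
def termsVanish [DecidableEq k] (T : List (k × List ℕ)) : Bool :=
  T.all fun c => termsCoeff T c.2 == 0

/-- The generators of the free algebra on countably many letters. -/
noncomputable def freeGen (k : Type*) [Field k] (a : ℕ) : MonoidAlgebra k (FreeMonoid ℕ) :=
  MonoidAlgebra.of k (FreeMonoid ℕ) (FreeMonoid.of a)

theorem prod_freeGen (w : List ℕ) :
    (w.map (freeGen k)).prod = MonoidAlgebra.single (FreeMonoid.ofList w) (1 : k) := by
  induction w with
  | nil => rfl
  | cons a w ih =>
    rw [List.map_cons, List.prod_cons, ih, freeGen, MonoidAlgebra.of_apply,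
      MonoidAlgebra.single_mul_single, one_mul]
    rfl

theorem termsEval_freeGen_apply [DecidableEq k] (T : List (k × List ℕ)) (w : List ℕ) :
    (termsEval (freeGen k) T).coeff (FreeMonoid.ofList w) = termsCoeff T w := by
  induction T with
  | nil => rfl
  | cons c T ih =>
    rw [termsEval_cons, prod_freeGen, termsCoeff, List.map_cons, List.sum_cons, ← termsCoeff,
      ← ih]
    by_cases h : c.2 = w
    · subst h
      simp
    · have h1 : FreeMonoid.ofList w ≠ FreeMonoid.ofList c.2 := fun hc => h hc.symm
      simp [h, h1]

/-- A word that does not occur in the list has coefficient 0 anyway, so finitely many coefficients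
decide. -/
theorem termsVanish_iff [DecidableEq k] (T : List (k × List ℕ)) :
    termsVanish T = true ↔ termsEval (freeGen k) T = 0 := by
  simp only [termsVanish, List.all_eq_true, beq_iff_eq]
  constructor
  · intro h
    ext w
    obtain ⟨w, rfl⟩ := FreeMonoid.ofList.surjective w
    rw [termsEval_freeGen_apply]
    by_cases hw : ∃ c ∈ T, c.2 = w
    · obtain ⟨c, hc, rfl⟩ := hw
      exact h c hc
    · push Not at hw
      rw [termsCoeff, List.map_congr_left (g := fun _ => (0 : k)) fun c hc => if_neg (hw c hc)]
      simp
  · intro h c _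
    rw [← termsEval_freeGen_apply, h]
    rfl

/-- Universal property of the free algebra. -/
theorem termsEval_eq_zero_of_freeGen {A : Type*} [Ring A] [Algebra k A] {T : List (k × List ℕ)}
    (h : termsEval (freeGen k) T = 0) (x : ℕ → A) : termsEval x T = 0 := by
  let φ := MonoidAlgebra.lift k A (FreeMonoid ℕ) (FreeMonoid.lift x)
  have hφ : (fun a => φ (freeGen k a)) = x := by
    funext a
    simp [φ, freeGen]
  rw [← hφ, ← map_termsEval, h, map_zero]

/-- The combination of the members of `H` with the given coefficients and cofactors. -/
def combination (H : List (List (k × List ℕ))) (E : List (k × List ℕ × ℕ × List ℕ)) :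
    List (k × List ℕ) :=
  E.flatMap fun e => (H.getD e.2.2.1 []).map fun c => (e.1 * c.1, e.2.1 ++ c.2 ++ e.2.2.2)

theorem termsEval_combination {A : Type*} [Ring A] [Algebra k A] (x : ℕ → A)
    (H : List (List (k × List ℕ))) (E : List (k × List ℕ × ℕ × List ℕ)) :
    termsEval x (combination H E) = (E.map fun e =>
      e.1 • ((e.2.1.map x).prod * termsEval x (H.getD e.2.2.1 []) * (e.2.2.2.map x).prod)).sum := by
  rw [combination, termsEval_flatMap]
  simp only [termsEval_map_mul]

/-- Check of a certificate that `1` lies in the two-sided ideal generated by `H`. -/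
def refutes [DecidableEq k] (H : List (List (k × List ℕ)))
    (E : List (k × List ℕ × ℕ × List ℕ)) : Bool :=
  termsVanish ((-1, []) :: combination H E)

theorem refutes_iff [DecidableEq k] (H : List (List (k × List ℕ)))
    (E : List (k × List ℕ × ℕ × List ℕ)) :
    refutes H E = true ↔ termsEval (freeGen k) (combination H E) = 1 := by
  rw [refutes, termsVanish_iff, termsEval_cons]
  simp only [neg_smul, one_smul, List.map_nil, List.prod_nil]
  rw [neg_add_eq_zero, eq_comm]

/-- Evaluated at a solution in a nontrivial algebra, the certified identity would read 1 = 0. -/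
theorem not_refutes_of_zero [DecidableEq k] {A : Type*} [Ring A] [Algebra k A] [Nontrivial A]
    {H : List (List (k × List ℕ))} (x : ℕ → A) (hx : ∀ T ∈ H, termsEval x T = 0)
    (E : List (k × List ℕ × ℕ × List ℕ)) : ¬ refutes H E = true := by
  intro h
  have h1 := termsEval_eq_zero_of_freeGen ((termsVanish_iff _).1 h) x
  have h2 : termsEval x (combination H E) = 0 := by
    rw [termsEval_combination]
    refine List.sum_eq_zero fun y hy => ?_
    obtain ⟨e, -, rfl⟩ := List.mem_map.1 hy
    have h3 : termsEval x (H.getD e.2.2.1 []) = 0 := by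
      rw [List.getD_eq_getElem?_getD]
      cases h4 : H[e.2.2.1]? with
      | none => rfl
      | some T => exact hx T (List.mem_of_getElem? h4)
    rw [h3]
    simp
  rw [termsEval_cons, h2] at h1
  simp at h1

/-- The two-sided ideal of the free algebra generated by `H`, as a subspace. -/
noncomputable def combinations (H : List (List (k × List ℕ))) :
    Submodule k (MonoidAlgebra k (FreeMonoid ℕ)) where
  carrier := Set.range fun E => termsEval (freeGen k) (combination H E)
  zero_mem' := ⟨[], rfl⟩
  add_mem' := by
    rintro _ _ ⟨E, rfl⟩ ⟨E', rfl⟩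
    exact ⟨E ++ E', by simp [combination]⟩
  smul_mem' := by
    rintro a _ ⟨E, rfl⟩
    refine ⟨E.map fun e => (a * e.1, e.2), ?_⟩
    simp only [termsEval_combination, List.map_map, Function.comp_def, mul_smul, List.smul_sum]

theorem freeGen_mul_mem (H : List (List (k × List ℕ))) (a : ℕ)
    {p : MonoidAlgebra k (FreeMonoid ℕ)} (hp : p ∈ combinations H) :
    freeGen k a * p ∈ combinations H := by
  obtain ⟨E, rfl⟩ := hp
  refine ⟨E.map fun e => (e.1, a :: e.2.1, e.2.2), ?_⟩
  simp only [termsEval_combination, List.map_map, Function.comp_def, List.map_cons,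
    List.prod_cons, ← List.sum_map_mul_left, mul_smul_comm, mul_assoc]

/-- This and closure under left multiplication by the letters are all that is needed to let the free
algebra act on its quotient by the ideal, with the members of H acting as 0. -/
theorem termsEval_mul_mem {H : List (List (k × List ℕ))} {T : List (k × List ℕ)} (hT : T ∈ H)
    (p : MonoidAlgebra k (FreeMonoid ℕ)) : termsEval (freeGen k) T * p ∈ combinations H := by
  induction p using MonoidAlgebra.induction_linear with
  | zero => simp
  | add p q hp hq => rw [mul_add]; exact add_mem hp hq
  | single w c =>
    obtain ⟨i, hi, rfl⟩ := List.getElem_of_mem hT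
    obtain ⟨w, rfl⟩ := FreeMonoid.ofList.surjective w
    refine ⟨[(c, [], i, w)], ?_⟩
    simp only [termsEval_combination, List.map_cons, List.map_nil, List.sum_cons, List.sum_nil,
      add_zero, prod_freeGen]
    rw [← mul_smul_comm, List.getD_eq_getElem _ _ hi, FreeMonoid.ofList_nil,
      ← MonoidAlgebra.one_def, one_mul]
    simp

/-- If `1` is not in the two-sided ideal generated by `H`, then `H` is satisfied by elements of a
nontrivial algebra. -/
theorem exists_zero_of_not_refutes [DecidableEq k] {H : List (List (k × List ℕ))}
    (hH : ∀ E, ¬ refutes H E = true) :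
    ∃ x : ℕ → Module.End k (MonoidAlgebra k (FreeMonoid ℕ) ⧸ combinations H),
      Nontrivial (Module.End k (MonoidAlgebra k (FreeMonoid ℕ) ⧸ combinations H)) ∧
        ∀ T ∈ H, termsEval x T = 0 := by
  set J := combinations H
  -- The letters act by left multiplication on the quotient space. Working in its endomorphism
  -- algebra avoids the quotient ring; it is nontrivial because 1 is not in the ideal.
  let x : ℕ → Module.End k (MonoidAlgebra k (FreeMonoid ℕ) ⧸ J) := fun a =>
    J.mapQ J (LinearMap.mulLeft k (freeGen k a)) fun p hp => freeGen_mul_mem H a hp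
  have hw : ∀ (w : List ℕ) (p : MonoidAlgebra k (FreeMonoid ℕ)),
      (w.map x).prod (J.mkQ p) = J.mkQ ((w.map (freeGen k)).prod * p) := by
    intro w p
    induction w with
    | nil => simp
    | cons a w ih =>
      rw [List.map_cons, List.prod_cons, Module.End.mul_apply, ih, List.map_cons, List.prod_cons,
        mul_assoc]
      rfl
  have hT : ∀ (T : List (k × List ℕ)) (p : MonoidAlgebra k (FreeMonoid ℕ)),
      termsEval x T (J.mkQ p) = J.mkQ (termsEval (freeGen k) T * p) := by
    intro T p
    induction T with
    | nil => simp
    | cons c T ih =>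
      rw [termsEval_cons, LinearMap.add_apply, LinearMap.smul_apply, hw, ih, termsEval_cons,
        add_mul, smul_mul_assoc, map_add, map_smul]
  have h1 : (1 : MonoidAlgebra k (FreeMonoid ℕ)) ∉ J := by
    rintro ⟨E, hE⟩
    exact hH E ((refutes_iff H E).2 hE)
  have : Nontrivial (MonoidAlgebra k (FreeMonoid ℕ) ⧸ J) :=
    Submodule.Quotient.nontrivial_iff.2 fun h => h1 (h ▸ Submodule.mem_top)
  refine ⟨x, inferInstance, fun T hTH => LinearMap.ext fun p => ?_⟩
  obtain ⟨p, rfl⟩ := J.mkQ_surjective p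
  rw [hT, LinearMap.zero_apply, Submodule.mkQ_apply, Submodule.Quotient.mk_eq_zero]
  exact termsEval_mul_mem hTH p

end Refutation

end NonsplitTest

namespace NonsplitTest

/-! ### Certificates of solvability -/

section Witness

variable {k : Type*} [Field k]

/-- The square matrix of size `d` listed at position `a` of a table. -/
def tableMatrix (d : ℕ) (C : List (List (List k))) (a : ℕ) : Matrix (Fin d) (Fin d) k :=
  Matrix.of fun i j => ((C.getD a []).getD i []).getD j 0

/-- The product of a row, given as a list, with a matrix of a table. -/
def rowStep (d : ℕ) (C : List (List (List k))) (v : List k) (a : ℕ) : List k :=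
  (List.range d).map fun j =>
    ((List.range d).map fun i => v.getD i 0 * ((C.getD a []).getD i []).getD j 0).sum

theorem map_range_eq_ofFn {β : Type*} (d : ℕ) (g : ℕ → β) :
    (List.range d).map g = List.ofFn fun i : Fin d => g i := by
  apply List.ext_getElem <;> simp

theorem rowStep_ofFn (d : ℕ) (C : List (List (List k))) (v : Fin d → k) (a : ℕ) :
    rowStep d C (List.ofFn v) a = List.ofFn (Matrix.vecMul v (tableMatrix d C a)) := by
  rw [rowStep, map_range_eq_ofFn]
  congr 1
  funext j
  rw [map_range_eq_ofFn, List.sum_ofFn]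
  simp [Matrix.vecMul, dotProduct, tableMatrix]

/-- Row `i` of the value of a word at the matrices of a table. -/
def wordRow (d : ℕ) (C : List (List (List k))) (i : ℕ) (w : List ℕ) : List k :=
  w.foldl (rowStep d C) ((List.range d).map fun l => if l = i then 1 else 0)

/-- A unit row vector is multiplied through the word letter by letter. Matrices whose size is part
of the data are thus evaluated by list operations alone. -/
theorem wordRow_getD (d : ℕ) (C : List (List (List k))) (i j : Fin d) (w : List ℕ) :
    (wordRow d C i w).getD j 0 = (w.map (tableMatrix d C)).prod i j := by
  have key : ∀ (w : List ℕ) (v : Fin d → k), w.foldl (rowStep d C) (List.ofFn v) =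
      List.ofFn (Matrix.vecMul v (w.map (tableMatrix d C)).prod) := by
    intro w
    induction w with
    | nil => simp
    | cons a w ih =>
      intro v
      rw [List.foldl_cons, rowStep_ofFn, ih, List.map_cons, List.prod_cons,
        Matrix.vecMul_vecMul]
  have h : (List.range d).map (fun l => if l = (i : ℕ) then (1 : k) else 0) =
      List.ofFn (Pi.single i 1 : Fin d → k) := by
    rw [map_range_eq_ofFn]
    congr 1
    funext l
    simp [Pi.single_apply, Fin.ext_iff]
  rw [wordRow, h, key]
  simp

/-- Check that the matrices of size `d` of a table satisfy a system. -/
def tableSatisfies [DecidableEq k] (H : List (List (k × List ℕ)))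
    (x : ℕ × List (List (List k))) : Bool :=
  -- Size 0 is excluded: matrices of size 0 satisfy every system.
  !(x.1 == 0) && (List.range x.1).all fun i => (List.range x.1).all fun j => H.all fun T =>
    (T.map fun c => c.1 * (wordRow x.1 x.2 i c.2).getD j 0).sum == 0

theorem termsEval_matrix_apply {d : ℕ} (M : ℕ → Matrix (Fin d) (Fin d) k) (T : List (k × List ℕ))
    (i j : Fin d) :
    termsEval M T i j = (T.map fun c => c.1 * (c.2.map M).prod i j).sum := by
  induction T with
  | nil => rfl
  | cons c T ih => simp [ih]

theorem tableSatisfies_iff [DecidableEq k] (H : List (List (k × List ℕ))) (d : ℕ)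
    (C : List (List (List k))) :
    tableSatisfies H (d, C) = true ↔ d ≠ 0 ∧ ∀ T ∈ H, termsEval (tableMatrix d C) T = 0 := by
  simp only [tableSatisfies, Bool.and_eq_true, Bool.not_eq_true', beq_eq_false_iff_ne,
    List.all_eq_true, List.mem_range, beq_iff_eq]
  refine and_congr_right fun _ => ⟨fun h T hT => ?_, fun h i hi j hj T hT => ?_⟩
  · ext i j
    rw [termsEval_matrix_apply, Matrix.zero_apply, ← h i i.2 j j.2 T hT]
    simp only [wordRow_getD]
  · have h1 := congrFun (congrFun (h T hT) ⟨i, hi⟩) ⟨j, hj⟩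
    rw [termsEval_matrix_apply, Matrix.zero_apply] at h1
    refine Eq.trans ?_ h1
    congr 1
    exact List.map_congr_left fun c _ =>
      congrArg (c.1 * ·) (wordRow_getD d C ⟨i, hi⟩ ⟨j, hj⟩ c.2)

/-- Finitely many matrices can be listed in a table. -/
theorem exists_tableMatrix_eq {d : ℕ} (M : ℕ → Matrix (Fin d) (Fin d) k) (N : ℕ) :
    ∃ C, ∀ a < N, tableMatrix d C a = M a := by
  refine ⟨(List.range N).map fun a => List.ofFn fun i => List.ofFn fun j => M a i j,
    fun a ha => ?_⟩
  ext i j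
  simp [tableMatrix, ha]

variable (K : Type*) [Field K] [Algebra k K]

/-- A system with a common zero over an algebraic extension is satisfied by commuting matrices
over the ground field. -/
theorem exists_tableSatisfies [DecidableEq k] [Algebra.IsAlgebraic k K]
    {H : List (List (k × List ℕ))} (z : ℕ → K) (hz : ∀ T ∈ H, termsEval z T = 0) :
    ∃ x, tableSatisfies (withCommutators H) x = true := by
  -- Generated by finitely many algebraic elements, hence finite dimensional over k; its regular
  -- representation turns the coordinates into commuting matrices over k.
  let S := Algebra.adjoin k (z '' {a | a ∈ letters H})
  have hfin : (z '' {a | a ∈ letters H}).Finite := (List.finite_toSet (letters H)).image z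
  have : Module.Finite k S := Module.Finite.iff_fg.2
    (fg_adjoin_of_finite hfin fun y _ => (Algebra.IsAlgebraic.isAlgebraic y).isIntegral)
  let b := Module.finBasis k S
  classical
  let z' : ℕ → S := fun a =>
    if h : a ∈ letters H then ⟨z a, Algebra.subset_adjoin ⟨a, h, rfl⟩⟩ else 0
  let M : ℕ → Matrix _ _ k := fun a => Algebra.leftMulMatrix b (z' a)
  have hz' : ∀ T ∈ withCommutators H, termsEval z' T = 0 := by
    refine forall_withCommutators.2 ⟨fun T hT => ?_, fun a _ b _ => mul_comm _ _⟩
    apply Subtype.val_injective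
    refine (map_termsEval S.val z' T).trans (Eq.trans ?_ (hz T hT))
    refine termsEval_congr fun c hc a ha => ?_
    have : a ∈ letters H := mem_letters hT hc ha
    simp [z', this]
  -- The sum of all letters bounds each of them, so the table covers every letter that occurs.
  obtain ⟨C, hC⟩ := exists_tableMatrix_eq M ((letters (withCommutators H)).sum + 1)
  refine ⟨(Module.finrank k S, C), (tableSatisfies_iff _ _ _).2
    ⟨Module.finrank_pos.ne', fun T hT => ?_⟩⟩
  rw [termsEval_congr (y := M) fun c hc a ha => hC a (Nat.lt_succ_of_le
    (List.single_le_sum (by simp) a (mem_letters hT hc ha))),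
    ← map_termsEval (Algebra.leftMulMatrix b) z' T, hz' T hT, map_zero]

/-- The semidecidable form of solvability: a search over tables of commuting matrices with entries
in k, so that no computation in K is needed. -/
theorem exists_zero_iff_tableSatisfies [DecidableEq k] [IsAlgClosed K] [Algebra.IsAlgebraic k K]
    (H : List (List (k × List ℕ))) :
    (∃ z : ℕ → K, ∀ T ∈ H, termsEval z T = 0) ↔
      ∃ x, tableSatisfies (withCommutators H) x = true := by
  constructor
  · rintro ⟨z, hz⟩
    exact exists_tableSatisfies K z hz
  · rintro ⟨⟨d, C⟩, h⟩
    obtain ⟨hd, h⟩ := (tableSatisfies_iff _ _ _).1 h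
    have : Nonempty (Fin d) := ⟨⟨0, Nat.pos_of_ne_zero hd⟩⟩
    exact exists_zero_of_commute K _ h

/-- The semidecidable form of unsolvability, a Nullstellensatz: if 1 is not in the ideal, the
equations hold for commuting elements of a nontrivial algebra, which yields a zero in K. -/
theorem not_exists_zero_iff_refutes [DecidableEq k] [IsAlgClosed K]
    (H : List (List (k × List ℕ))) :
    (¬ ∃ z : ℕ → K, ∀ T ∈ H, termsEval z T = 0) ↔
      ∃ E, refutes (withCommutators H) E = true := by
  constructor
  · intro h
    by_contra hE
    push Not at hE
    obtain ⟨x, hnt, hx⟩ := exists_zero_of_not_refutes hE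
    exact h (exists_zero_of_commute K x hx)
  · rintro ⟨E, hE⟩ ⟨z, hz⟩
    exact not_refutes_of_zero z
      (forall_withCommutators.2 ⟨hz, fun a _ b _ => mul_comm _ _⟩) E hE

end Witness

/-! ### Decidability of systems -/

section Decision

variable {k : Type*} [Field k] [Primcodable k]

theorem computable_list_getD {α β : Type*} [Primcodable α] [Primcodable β] {f : α → List β}
    {g : α → ℕ} (d : β) (hf : Computable f) (hg : Computable g) :
    Computable fun a => (f a).getD (g a) d :=
  (Primrec.list_getD d).to_comp.comp hf hg

theorem computable_refutes [DecidableEq k] (hk : IsComputableField k) :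
    Computable₂ (refutes (k := k)) := by
  have hcoeff : Computable₂ (termsCoeff (k := k)) := by
    refine computable_list_sum hk.computable_add (computable_list_map Computable.fst ?_)
    have : Primrec fun x : (List (k × List ℕ) × List ℕ) × k × List ℕ =>
        if x.2.2 = x.1.2 then x.2.1 else 0 :=
      Primrec.ite (Primrec.eq.comp (Primrec.snd.comp Primrec.snd) (Primrec.snd.comp Primrec.fst))
        (Primrec.fst.comp Primrec.snd) (Primrec.const 0)
    exact this.to_comp
  have hvanish : Computable (termsVanish (k := k)) := by
    refine computable_list_all Computable.id ?_
    exact Primrec.beq.to_comp.comp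
      (hcoeff.comp Computable.fst (Computable.snd.comp Computable.snd)) (Computable.const 0)
  have hcomb : Computable₂ (combination (k := k)) := by
    refine computable_list_flatMap Computable.snd ?_
    refine computable_list_map (computable_list_getD _ (Computable.fst.comp Computable.fst)
      (Computable.fst.comp (Computable.snd.comp (Computable.snd.comp Computable.snd)))) ?_
    refine Computable.pair ?_ ?_
    · exact hk.computable_mul.comp
        (Computable.fst.comp (Computable.snd.comp Computable.fst))
        (Computable.fst.comp Computable.snd)
    · have he : Computable fun x : ((List (List (k × List ℕ)) ×
          List (k × List ℕ × ℕ × List ℕ)) × k × List ℕ × ℕ × List ℕ) × k × List ℕ =>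
            x.1.2.2 := Computable.snd.comp (Computable.snd.comp Computable.fst)
      exact Computable.list_append.comp (Computable.list_append.comp
        (Computable.fst.comp he) (Computable.snd.comp Computable.snd))
        (Computable.snd.comp (Computable.snd.comp he))
  exact hvanish.comp (Computable.list_cons.comp (Computable.const _) hcomb)

theorem computable_rowStep (hk : IsComputableField k) :
    Computable fun x : (ℕ × List (List (List k))) × List k × ℕ =>
      rowStep x.1.1 x.1.2 x.2.1 x.2.2 := by
  unfold rowStep
  have hd : Computable fun x : (ℕ × List (List (List k))) × List k × ℕ => List.range x.1.1 :=
    Primrec.list_range.to_comp.comp (Computable.fst.comp Computable.fst)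
  have h1 : Computable fun x : (((ℕ × List (List (List k))) × List k × ℕ) × ℕ) × ℕ =>
      x.1.1.2.1.getD x.2 0 :=
    computable_list_getD _ (Computable.fst.comp (Computable.snd.comp
      (Computable.fst.comp Computable.fst))) Computable.snd
  have h2 : Computable fun x : (((ℕ × List (List (List k))) × List k × ℕ) × ℕ) × ℕ =>
      ((x.1.1.1.2.getD x.1.1.2.2 []).getD x.2 []).getD x.1.2 0 :=
    computable_list_getD _ (computable_list_getD _ (computable_list_getD _
      (Computable.snd.comp (Computable.fst.comp (Computable.fst.comp Computable.fst)))
      (Computable.snd.comp (Computable.snd.comp (Computable.fst.comp Computable.fst))))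
      Computable.snd) (Computable.snd.comp Computable.fst)
  have h3 := hk.computable_mul.comp h1 h2
  have h4 := computable_list_map (hd.comp Computable.fst) h3.to₂
  exact computable_list_map hd (computable_list_sum hk.computable_add h4).to₂

theorem computable_wordRow (hk : IsComputableField k) :
    Computable fun x : (ℕ × List (List (List k))) × ℕ × List ℕ =>
      wordRow x.1.1 x.1.2 x.2.1 x.2.2 := by
  unfold wordRow
  have hunit : Computable fun x : ((ℕ × List (List (List k))) × ℕ × List ℕ) × ℕ =>
      if x.2 = x.1.2.1 then (1 : k) else 0 :=
    (Primrec.ite (Primrec.eq.comp Primrec.snd (Primrec.fst.comp (Primrec.snd.comp Primrec.fst)))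
      (Primrec.const 1) (Primrec.const 0)).to_comp
  have hr : Computable fun x : (ℕ × List (List (List k))) × ℕ × List ℕ => List.range x.1.1 :=
    Primrec.list_range.to_comp.comp (Computable.fst.comp Computable.fst)
  have hinit := computable_list_map hr hunit.to₂
  have harg : Computable fun x : ((ℕ × List (List (List k))) × ℕ × List ℕ) × List k × ℕ =>
      (x.1.1, x.2) := (Computable.fst.comp Computable.fst).pair Computable.snd
  have hstep := (computable_rowStep hk).comp harg
  have hw : Computable fun x : (ℕ × List (List (List k))) × ℕ × List ℕ => x.2.2 :=
    Computable.snd.comp Computable.snd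
  exact computable_list_foldl (h := fun (x : (ℕ × List (List (List k))) × ℕ × List ℕ) v a =>
    rowStep x.1.1 x.1.2 v a) hw hinit hstep

theorem computable_tableSatisfies [DecidableEq k] (hk : IsComputableField k) :
    Computable₂ (tableSatisfies (k := k)) := by
  have hword : Computable fun x : ((ℕ × List (List (List k))) × (ℕ × ℕ) × List (k × List ℕ)) ×
      k × List ℕ => (x.1.1, x.1.2.1.1, x.2.2) :=
    (Computable.fst.comp Computable.fst).pair
      ((Computable.fst.comp (Computable.fst.comp (Computable.snd.comp Computable.fst))).pair
        (Computable.snd.comp Computable.snd))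
  have hrow := (computable_wordRow hk).comp hword
  have hj : Computable fun x : ((ℕ × List (List (List k))) × (ℕ × ℕ) × List (k × List ℕ)) ×
      k × List ℕ => x.1.2.1.2 :=
    Computable.snd.comp (Computable.fst.comp (Computable.snd.comp Computable.fst))
  have hentry := computable_list_getD 0 hrow hj
  have hcoeff : Computable fun x : ((ℕ × List (List (List k))) × (ℕ × ℕ) × List (k × List ℕ)) ×
      k × List ℕ => x.2.1 := Computable.fst.comp Computable.snd
  have hterm := hk.computable_mul.comp hcoeff hentry
  have hT : Computable fun x : (ℕ × List (List (List k))) × (ℕ × ℕ) × List (k × List ℕ) =>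
      x.2.2 := Computable.snd.comp Computable.snd
  have hsum := computable_list_sum hk.computable_add (computable_list_map hT hterm.to₂)
  have harg : Computable fun x : (((List (List (k × List ℕ)) × ℕ × List (List (List k))) × ℕ) ×
      ℕ) × List (k × List ℕ) => (x.1.1.1.2, (x.1.1.2, x.1.2), x.2) :=
    (Computable.snd.comp (Computable.fst.comp (Computable.fst.comp Computable.fst))).pair
      (((Computable.snd.comp (Computable.fst.comp Computable.fst)).pair
        (Computable.snd.comp Computable.fst)).pair Computable.snd)
  have hzero := Primrec.beq.to_comp.comp (hsum.comp harg) (Computable.const 0)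
  have hH : Computable fun x : ((List (List (k × List ℕ)) × ℕ × List (List (List k))) × ℕ) × ℕ =>
      x.1.1.1 := Computable.fst.comp (Computable.fst.comp Computable.fst)
  have hall := computable_list_all hH hzero.to₂
  have hd : Computable fun x : List (List (k × List ℕ)) × ℕ × List (List (List k)) =>
      List.range x.2.1 :=
    Primrec.list_range.to_comp.comp (Computable.fst.comp Computable.snd)
  have hd0 : Computable fun x : List (List (k × List ℕ)) × ℕ × List (List (List k)) =>
      !(x.2.1 == 0) :=
    Primrec.not.to_comp.comp (Primrec.beq.to_comp.comp
      (Computable.fst.comp Computable.snd) (Computable.const 0))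
  have hall' := computable_list_all hd (computable_list_all (hd.comp Computable.fst) hall.to₂).to₂
  exact (Primrec.and.to_comp.comp hd0 hall').to₂

theorem primrec_letters {k : Type*} [Primcodable k] : Primrec (letters (k := k)) :=
  Primrec.list_flatMap Primrec.id
    (Primrec.list_flatMap Primrec.snd (Primrec.snd.comp Primrec.snd).to₂).to₂

theorem computable_withCommutators : Computable (withCommutators (k := k)) := by
  have hl : Primrec (letters (k := k)) := primrec_letters
  have hw : ∀ c : k, Primrec fun x : ℕ × ℕ => (c, [x.1, x.2]) := fun c =>
    (Primrec.const c).pair (Primrec.list_cons.comp Primrec.fst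
      (Primrec.list_cons.comp Primrec.snd (Primrec.const [])))
  have h1 : Primrec fun x : (List (List (k × List ℕ)) × ℕ) × ℕ => (x.1.2, x.2) :=
    (Primrec.snd.comp Primrec.fst).pair Primrec.snd
  have h2 : Primrec fun x : (List (List (k × List ℕ)) × ℕ) × ℕ => (x.2, x.1.2) :=
    Primrec.snd.pair (Primrec.snd.comp Primrec.fst)
  have h3 : Primrec fun x : (List (List (k × List ℕ)) × ℕ) × ℕ =>
      [((1 : k), [x.1.2, x.2]), (-1, [x.2, x.1.2])] :=
    Primrec.list_cons.comp ((hw 1).comp h1)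
      (Primrec.list_cons.comp ((hw (-1)).comp h2) (Primrec.const []))
  have h4 : Primrec fun x : List (List (k × List ℕ)) × ℕ =>
      (letters x.1).map fun b => [((1 : k), [x.2, b]), (-1, [b, x.2])] :=
    Primrec.list_map (hl.comp Primrec.fst) h3.to₂
  exact (Primrec.list_append.comp Primrec.id (Primrec.list_flatMap hl h4.to₂)).to_comp

/-- Solvability of polynomial systems over the algebraic closure of a computable field is
decidable. -/
theorem computablePred_exists_zero (K : Type*) [Field K] [Algebra k K] [IsAlgClosed K]
    [Algebra.IsAlgebraic k K] (hk : IsComputableField k) :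
    ComputablePred fun H : List (List (k × List ℕ)) =>
      ∃ z : ℕ → K, ∀ T ∈ H, termsEval z T = 0 := by
  classical
  -- Post's theorem: the set of solvable systems and its complement are both recursively enumerable.
  refine ComputablePred.computable_iff_re_compl_re'.2 ⟨?_, ?_⟩
  · refine REPred.of_eq (rePred_exists
      (R := fun (H : List (List (k × List ℕ))) x => tableSatisfies (withCommutators H) x) ?_)
      fun H => (exists_zero_iff_tableSatisfies K H).symm
    exact (computable_tableSatisfies hk).comp
      (computable_withCommutators.comp Computable.fst) Computable.snd
  · refine REPred.of_eq (rePred_exists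
      (R := fun (H : List (List (k × List ℕ))) E => refutes (withCommutators H) E) ?_)
      fun H => (not_exists_zero_iff_refutes K H).symm
    exact (computable_refutes hk).comp
      (computable_withCommutators.comp Computable.fst) Computable.snd

end Decision

end NonsplitTest

namespace NonsplitTest

/-! ### A system of polynomials for nonsplit extensions -/

/-- The words of length at most `p` in the letters `0, …, s - 1`. -/
def wordsUpTo (s : ℕ) : ℕ → List (List ℕ)
  | 0 => [[]]
  | p + 1 => [] :: (wordsUpTo s p).flatMap fun w => (List.range s).map fun r => r :: w

theorem mem_wordsUpTo {s p : ℕ} {w : List ℕ} :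
    w ∈ wordsUpTo s p ↔ w.length ≤ p ∧ ∀ r ∈ w, r < s := by
  induction p generalizing w with
  | zero =>
    rw [wordsUpTo, List.mem_singleton]
    constructor
    · rintro rfl
      simp
    · rintro ⟨h, -⟩
      exact List.eq_nil_of_length_eq_zero (Nat.le_zero.1 h)
  | succ p ih =>
    cases w with
    | nil => simp [wordsUpTo]
    | cons r w =>
      simp only [wordsUpTo, List.mem_cons, reduceCtorEq, List.mem_flatMap, List.mem_map,
        List.mem_range, List.cons.injEq, false_or, List.length_cons, Nat.add_le_add_iff_right,
        forall_eq_or_imp, ih]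
      constructor
      · rintro ⟨w', ⟨h1, h2⟩, r', h3, rfl, rfl⟩
        exact ⟨h1, h3, h2⟩
      · rintro ⟨h1, h3, h2⟩
        exact ⟨w, ⟨h1, h2⟩, r, h3, rfl, rfl⟩

/-- Allows sums over the list of words to be identified with sums over the finite set of words. -/
theorem nodup_wordsUpTo (s p : ℕ) : (wordsUpTo s p).Nodup := by
  induction p with
  | zero => simp [wordsUpTo]
  | succ p ih =>
    rw [wordsUpTo, List.nodup_cons]
    refine ⟨by simp, List.nodup_flatMap.2 ⟨fun w _ => ?_, ?_⟩⟩
    · exact List.nodup_range.map fun a b h => (List.cons.inj h).1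
    · refine ih.imp fun {w w'} hne => ?_
      rw [Function.onFun, List.disjoint_left]
      intro x hx hx'
      obtain ⟨r, -, rfl⟩ := List.mem_map.1 hx
      obtain ⟨r', -, h⟩ := List.mem_map.1 hx'
      exact hne (List.cons.inj h).2.symm

/-- The pairs of numbers less than `n`. -/
def indexPairs (n : ℕ) : List (ℕ × ℕ) :=
  (List.range n).flatMap fun i => (List.range n).map fun j => (i, j)

theorem mem_indexPairs {n : ℕ} {p : ℕ × ℕ} : p ∈ indexPairs n ↔ p.1 < n ∧ p.2 < n := by
  obtain ⟨i, j⟩ := p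
  simp [indexPairs]

/-- The four indices all belong to the first `ℓ` ones, or none of them does. -/
abbrev SameBlock (ℓ : ℕ) (p q : ℕ × ℕ) : Prop :=
  ((p.1 < ℓ ∧ p.2 < ℓ) ∧ q.1 < ℓ ∧ q.2 < ℓ) ∨ (ℓ ≤ p.1 ∧ ℓ ≤ p.2) ∧ ℓ ≤ q.1 ∧ ℓ ≤ q.2

section System

variable {k : Type*} [Field k]

/-- The polynomial system which says that the variables `(0, w, i, j)` are the entries of the
products of block upper triangular matrices which satisfy the relations `F`, and that the linear
combinations of these products with coefficients `(1, w, p)` and `(2, w, 0, 0)` are matrix units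
on the diagonal blocks, respectively the superdiagonal matrix. -/
def extensionSystem (s ℓ n : ℕ) (W : List (List ℕ)) (F : List (List (k × List ℕ))) :
    List (List (k × List ℕ)) :=
  ((indexPairs n).map fun p =>
    [(1, [Encodable.encode (0, ([] : List ℕ), p)]), (if p.1 = p.2 then -1 else 0, [])]) ++
  -- The recursion also defines variables for words one letter longer than those in W; these do not
  -- disturb solvability.
  (W.flatMap fun w => (List.range s).flatMap fun r => (indexPairs n).map fun p =>
    (-1, [Encodable.encode (0, r :: w, p)]) :: (List.range n).map fun l =>
      (1, [Encodable.encode (0, [r], p.1, l), Encodable.encode (0, w, l, p.2)])) ++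
  ((List.range s).flatMap fun r => (indexPairs n).map fun p =>
    if ℓ ≤ p.1 ∧ p.2 < ℓ then [(1, [Encodable.encode (0, [r], p)])] else []) ++
  -- For p in a diagonal block, some combination of the words must have the matrix unit at p in that
  -- block; the rest of the matrix is left free. This expresses full diagonal blocks without any
  -- choice of products.
  ((indexPairs n).flatMap fun p => (indexPairs n).map fun q =>
    if SameBlock ℓ p q then (if p = q then -1 else 0, []) :: W.map fun w =>
      (1, [Encodable.encode (1, w, p), Encodable.encode (0, w, q)]) else []) ++
  ((indexPairs n).map fun p => (if p.1 + 1 = p.2 then -1 else 0, []) :: W.map fun w =>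
    (1, [Encodable.encode (2, w, 0, 0), Encodable.encode (0, w, p)])) ++
  F.flatMap fun g => (indexPairs n).map fun p => g.map fun c =>
    (c.1, [Encodable.encode (0, c.2, p)])

variable {K : Type*} [Field K] [Algebra k K]

/-- The values `x` of the variables solve the system. -/
def SolvesExtension (s ℓ n : ℕ) (W : List (List ℕ)) (F : List (List (k × List ℕ)))
    (x : ℕ × List ℕ × ℕ × ℕ → K) : Prop :=
  (∀ p ∈ indexPairs n, x (0, [], p) = if p.1 = p.2 then 1 else 0) ∧
  (∀ w ∈ W, ∀ r < s, ∀ p ∈ indexPairs n, x (0, r :: w, p) =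
    ((List.range n).map fun l => x (0, [r], p.1, l) * x (0, w, l, p.2)).sum) ∧
  (∀ r < s, ∀ p ∈ indexPairs n, ℓ ≤ p.1 ∧ p.2 < ℓ → x (0, [r], p) = 0) ∧
  (∀ p ∈ indexPairs n, ∀ q ∈ indexPairs n, SameBlock ℓ p q →
    (W.map fun w => x (1, w, p) * x (0, w, q)).sum = if p = q then 1 else 0) ∧
  (∀ p ∈ indexPairs n,
    (W.map fun w => x (2, w, 0, 0) * x (0, w, p)).sum = if p.1 + 1 = p.2 then 1 else 0) ∧
  ∀ g ∈ F, ∀ p ∈ indexPairs n, (g.map fun c => algebraMap k K c.1 * x (0, c.2, p)).sum = 0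

theorem termsEval_map_pair {ι : Type*} (z : ℕ → K) (L : List ι) (a b : ι → ℕ) :
    termsEval z (L.map fun i => ((1 : k), [a i, b i])) =
      (L.map fun i => z (a i) * z (b i)).sum := by
  induction L with
  | nil => simp
  | cons i L ih => simp [ih]

theorem termsEval_map_single {ι : Type*} (z : ℕ → K) (L : List ι) (c : ι → k) (a : ι → ℕ) :
    termsEval z (L.map fun i => (c i, [a i])) =
      (L.map fun i => algebraMap k K (c i) * z (a i)).sum := by
  induction L with
  | nil => simp
  | cons i L ih => simp [ih, Algebra.smul_def]

theorem extensionSystem_iff (s ℓ n : ℕ) (W : List (List ℕ)) (F : List (List (k × List ℕ)))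
    (z : ℕ → K) :
    (∀ T ∈ extensionSystem s ℓ n W F, termsEval z T = 0) ↔
      SolvesExtension s ℓ n W F fun y => z (Encodable.encode y) := by
  have hδ : ∀ (P : Prop) [Decidable P] (a : K),
      (if P then (-1 : k) else 0) • (1 : K) + a = 0 ↔ a = if P then 1 else 0 := by
    intro P _ a
    split_ifs
    · rw [neg_smul, one_smul, neg_add_eq_zero, eq_comm]
    · simp
  simp only [extensionSystem, SolvesExtension, List.forall_mem_append, List.forall_mem_map,
    List.forall_mem_flatMap, List.mem_range, and_assoc]
  refine and_congr (forall₂_congr fun p _ => ?_) (and_congr (forall₄_congr fun w _ r _ =>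
    forall₂_congr fun p _ => ?_) (and_congr (forall₄_congr fun r _ p _ => ?_)
    (and_congr (forall₄_congr fun p _ q _ => ?_) (and_congr (forall₂_congr fun p _ => ?_)
    (forall₄_congr fun g _ p _ => ?_)))))
  · rw [← hδ]
    simp [add_comm]
  · rw [termsEval_cons, termsEval_map_pair]
    simp only [List.map_cons, List.map_nil, List.prod_cons, List.prod_nil, mul_one, neg_smul,
      one_smul]
    rw [neg_add_eq_zero]
  · by_cases h : ℓ ≤ p.1 ∧ p.2 < ℓ <;> simp [h]
  · by_cases h : SameBlock ℓ p q
    · rw [if_pos h, termsEval_cons, termsEval_map_pair, List.map_nil, List.prod_nil, hδ]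
      exact ⟨fun h1 _ => h1, fun h1 => h1 h⟩
    · rw [if_neg h, termsEval_nil]
      exact ⟨fun _ h1 => absurd h1 h, fun _ => rfl⟩
  · rw [termsEval_cons, termsEval_map_pair, List.map_nil, List.prod_nil, hδ]
  · rw [termsEval_map_single]

theorem exists_zero_extensionSystem_iff (s ℓ n : ℕ) (W : List (List ℕ))
    (F : List (List (k × List ℕ))) :
    (∃ z : ℕ → K, ∀ T ∈ extensionSystem s ℓ n W F, termsEval z T = 0) ↔
      ∃ x : ℕ × List ℕ × ℕ × ℕ → K, SolvesExtension s ℓ n W F x := by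
  constructor
  · rintro ⟨z, hz⟩
    exact ⟨_, (extensionSystem_iff s ℓ n W F z).1 hz⟩
  · rintro ⟨x, hx⟩
    -- The coding of the variables is bijective, so every assignment comes from a sequence indexed
    -- by ℕ.
    refine ⟨fun v => x (Denumerable.ofNat _ v), (extensionSystem_iff s ℓ n W F _).2 ?_⟩
    simpa only [Denumerable.ofNat_encode] using hx

end System

/-! ### Computability of the system -/

section PrimrecSystem

variable {k : Type*} [Field k] [Primcodable k]

theorem primrec_wordsUpTo : Primrec₂ wordsUpTo := by
  have h1 : Primrec fun x : ((ℕ × ℕ) × ℕ × List (List ℕ)) × List ℕ =>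
      (List.range x.1.1.1).map fun r => r :: x.2 :=
    Primrec.list_map (Primrec.list_range.comp
      (Primrec.fst.comp (Primrec.fst.comp Primrec.fst)))
      (Primrec.list_cons.comp Primrec.snd (Primrec.snd.comp Primrec.fst)).to₂
  have h2 : Primrec fun x : (ℕ × ℕ) × ℕ × List (List ℕ) =>
      [] :: x.2.2.flatMap fun w => (List.range x.1.1).map fun r => r :: w :=
    Primrec.list_cons.comp (Primrec.const [])
      (Primrec.list_flatMap (Primrec.snd.comp Primrec.snd) h1.to₂)
  refine (Primrec.nat_rec' (f := fun x : ℕ × ℕ => x.2) (g := fun _ => [[]]) Primrec.snd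
    (Primrec.const _) h2.to₂).of_eq fun x => ?_
  obtain ⟨s, p⟩ := x
  induction p with
  | zero => rfl
  | succ p ih =>
    rw [wordsUpTo, ← ih]

theorem primrec_indexPairs : Primrec indexPairs := by
  have h : Primrec fun x : ℕ × ℕ => (List.range x.1).map fun j => (x.2, j) :=
    Primrec.list_map (Primrec.list_range.comp Primrec.fst)
      (Primrec.pair (Primrec.snd.comp Primrec.fst) Primrec.snd).to₂
  exact Primrec.list_flatMap Primrec.list_range h.to₂

section Aux

variable {α β : Type*} [Primcodable α] [Primcodable β]

theorem primrec_var (t : ℕ) {f : α → List ℕ} {g : α → ℕ × ℕ} (hf : Primrec f) (hg : Primrec g) :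
    Primrec fun a => Encodable.encode (t, f a, g a) :=
  Primrec.encode.comp ((Primrec.const t).pair (hf.pair hg))

theorem primrec_singleton {f : α → β} (hf : Primrec f) : Primrec fun a => [f a] :=
  Primrec.list_cons.comp hf (Primrec.const [])

theorem primrec_term_single (c : β) {f : α → ℕ} (hf : Primrec f) : Primrec fun a => (c, [f a]) :=
  (Primrec.const c).pair (primrec_singleton hf)

theorem primrec_term_pair (c : β) {f g : α → ℕ} (hf : Primrec f) (hg : Primrec g) :
    Primrec fun a => (c, [f a, g a]) :=
  (Primrec.const c).pair (Primrec.list_cons.comp hf (primrec_singleton hg))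

theorem primrec_term_delta {p : α → Prop} [DecidablePred p] (hp : PrimrecPred p) :
    Primrec fun a => ((if p a then -1 else 0 : k), ([] : List ℕ)) :=
  (Primrec.ite hp (Primrec.const _) (Primrec.const _)).pair (Primrec.const [])

end Aux

/-- Coefficients are only copied from F or are among 0, 1, -1. No arithmetic of k takes part, which
is why the construction is primitive recursive although the field operations are merely computable.
-/
theorem primrec_extensionSystem :
    Primrec fun x : ℕ × ℕ × ℕ × List (List ℕ) × List (List (k × List ℕ)) =>
      extensionSystem x.1 x.2.1 x.2.2.1 x.2.2.2.1 x.2.2.2.2 := by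
  let γ := ℕ × ℕ × ℕ × List (List ℕ) × List (List (k × List ℕ))
  have hs : Primrec fun x : γ => List.range x.1 := Primrec.list_range.comp Primrec.fst
  have hℓ : Primrec fun x : γ => x.2.1 := Primrec.fst.comp Primrec.snd
  have hn : Primrec fun x : γ => x.2.2.1 := Primrec.fst.comp (Primrec.snd.comp Primrec.snd)
  have hp : Primrec fun x : γ => indexPairs x.2.2.1 := primrec_indexPairs.comp hn
  have hW : Primrec fun x : γ => x.2.2.2.1 :=
    Primrec.fst.comp (Primrec.snd.comp (Primrec.snd.comp Primrec.snd))
  have hF : Primrec fun x : γ => x.2.2.2.2 :=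
    Primrec.snd.comp (Primrec.snd.comp (Primrec.snd.comp Primrec.snd))
  have hA : Primrec fun x : γ => (indexPairs x.2.2.1).map fun p =>
      [((1 : k), [Encodable.encode (0, ([] : List ℕ), p)]),
        (if p.1 = p.2 then -1 else 0, [])] := by
    have h1 : Primrec fun y : γ × ℕ × ℕ => ((1 : k), [Encodable.encode (0, ([] : List ℕ), y.2)]) :=
      primrec_term_single 1 (primrec_var 0 (Primrec.const []) Primrec.snd)
    have h2 : Primrec fun y : γ × ℕ × ℕ =>
        ((if y.2.1 = y.2.2 then -1 else 0 : k), ([] : List ℕ)) :=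
      primrec_term_delta (Primrec.eq.comp (Primrec.fst.comp Primrec.snd)
        (Primrec.snd.comp Primrec.snd))
    exact Primrec.list_map hp (Primrec.list_cons.comp h1 (primrec_singleton h2)).to₂
  have hB : Primrec fun x : γ => x.2.2.2.1.flatMap fun w => (List.range x.1).flatMap fun r =>
      (indexPairs x.2.2.1).map fun p =>
        ((-1 : k), [Encodable.encode (0, r :: w, p)]) :: (List.range x.2.2.1).map fun l =>
          (1, [Encodable.encode (0, [r], p.1, l), Encodable.encode (0, w, l, p.2)]) := by
    have hc : Primrec fun y : ((γ × List ℕ) × ℕ) × ℕ × ℕ => y.1.1.1 :=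
      Primrec.fst.comp (Primrec.fst.comp Primrec.fst)
    have hw : Primrec fun y : ((γ × List ℕ) × ℕ) × ℕ × ℕ => y.1.1.2 :=
      Primrec.snd.comp (Primrec.fst.comp Primrec.fst)
    have hr : Primrec fun y : ((γ × List ℕ) × ℕ) × ℕ × ℕ => y.1.2 :=
      Primrec.snd.comp Primrec.fst
    have h1 : Primrec fun y : ((γ × List ℕ) × ℕ) × ℕ × ℕ =>
        ((-1 : k), [Encodable.encode (0, y.1.2 :: y.1.1.2, y.2)]) :=
      primrec_term_single (-1) (primrec_var 0 (Primrec.list_cons.comp hr hw) Primrec.snd)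
    have h2 : Primrec fun u : (((γ × List ℕ) × ℕ) × ℕ × ℕ) × ℕ =>
        Encodable.encode (0, [u.1.1.2], u.1.2.1, u.2) :=
      primrec_var 0 (primrec_singleton (hr.comp Primrec.fst))
        ((Primrec.fst.comp (Primrec.snd.comp Primrec.fst)).pair Primrec.snd)
    have h3 : Primrec fun u : (((γ × List ℕ) × ℕ) × ℕ × ℕ) × ℕ =>
        Encodable.encode (0, u.1.1.1.2, u.2, u.1.2.2) :=
      primrec_var 0 (hw.comp Primrec.fst)
        (Primrec.snd.pair (Primrec.snd.comp (Primrec.snd.comp Primrec.fst)))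
    have h4 : Primrec fun y : ((γ × List ℕ) × ℕ) × ℕ × ℕ => (List.range y.1.1.1.2.2.1).map
        fun l => ((1 : k), [Encodable.encode (0, [y.1.2], y.2.1, l),
          Encodable.encode (0, y.1.1.2, l, y.2.2)]) :=
      Primrec.list_map (Primrec.list_range.comp (hn.comp hc)) (primrec_term_pair 1 h2 h3).to₂
    have h5 := Primrec.list_map (hp.comp (Primrec.fst.comp Primrec.fst))
      (Primrec.list_cons.comp h1 h4).to₂
    exact Primrec.list_flatMap hW (Primrec.list_flatMap (hs.comp Primrec.fst) h5.to₂).to₂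
  have hC : Primrec fun x : γ => (List.range x.1).flatMap fun r => (indexPairs x.2.2.1).map
      fun p => if x.2.1 ≤ p.1 ∧ p.2 < x.2.1 then
        [((1 : k), [Encodable.encode (0, [r], p)])] else [] := by
    have hℓ' : Primrec fun y : (γ × ℕ) × ℕ × ℕ => y.1.1.2.1 :=
      hℓ.comp (Primrec.fst.comp Primrec.fst)
    have h1 : PrimrecPred fun y : (γ × ℕ) × ℕ × ℕ => y.1.1.2.1 ≤ y.2.1 ∧ y.2.2 < y.1.1.2.1 :=
      (Primrec.nat_le.comp hℓ' (Primrec.fst.comp Primrec.snd)).and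
        (Primrec.nat_lt.comp (Primrec.snd.comp Primrec.snd) hℓ')
    have h2 : Primrec fun y : (γ × ℕ) × ℕ × ℕ => [((1 : k), [Encodable.encode (0, [y.1.2], y.2)])] :=
      primrec_singleton (primrec_term_single 1 (primrec_var 0
        (primrec_singleton (Primrec.snd.comp Primrec.fst)) Primrec.snd))
    have h3 := Primrec.list_map (hp.comp Primrec.fst) (Primrec.ite h1 h2 (Primrec.const [])).to₂
    exact Primrec.list_flatMap hs h3.to₂
  have hD : Primrec fun x : γ => (indexPairs x.2.2.1).flatMap fun p => (indexPairs x.2.2.1).map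
      fun q => if SameBlock x.2.1 p q then ((if p = q then -1 else 0 : k), []) ::
        x.2.2.2.1.map fun w =>
          (1, [Encodable.encode (1, w, p), Encodable.encode (0, w, q)]) else [] := by
    have hℓ' : Primrec fun y : (γ × ℕ × ℕ) × ℕ × ℕ => y.1.1.2.1 :=
      hℓ.comp (Primrec.fst.comp Primrec.fst)
    have hp' : Primrec fun y : (γ × ℕ × ℕ) × ℕ × ℕ => y.1.2 := Primrec.snd.comp Primrec.fst
    have hlt : ∀ {f : (γ × ℕ × ℕ) × ℕ × ℕ → ℕ}, Primrec f →
        PrimrecPred fun y : (γ × ℕ × ℕ) × ℕ × ℕ => f y < y.1.1.2.1 :=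
      fun hf => Primrec.nat_lt.comp hf hℓ'
    have hle : ∀ {f : (γ × ℕ × ℕ) × ℕ × ℕ → ℕ}, Primrec f →
        PrimrecPred fun y : (γ × ℕ × ℕ) × ℕ × ℕ => y.1.1.2.1 ≤ f y :=
      fun hf => Primrec.nat_le.comp hℓ' hf
    have hp1 := Primrec.fst.comp hp'
    have hp2 := Primrec.snd.comp hp'
    have hq1 : Primrec fun y : (γ × ℕ × ℕ) × ℕ × ℕ => y.2.1 := Primrec.fst.comp Primrec.snd
    have hq2 : Primrec fun y : (γ × ℕ × ℕ) × ℕ × ℕ => y.2.2 := Primrec.snd.comp Primrec.snd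
    have h1 : PrimrecPred fun y : (γ × ℕ × ℕ) × ℕ × ℕ => SameBlock y.1.1.2.1 y.1.2 y.2 :=
      (((hlt hp1).and (hlt hp2)).and ((hlt hq1).and (hlt hq2))).or
        (((hle hp1).and (hle hp2)).and ((hle hq1).and (hle hq2)))
    have h2 : Primrec fun y : (γ × ℕ × ℕ) × ℕ × ℕ =>
        ((if y.1.2 = y.2 then -1 else 0 : k), ([] : List ℕ)) :=
      primrec_term_delta (Primrec.eq.comp hp' Primrec.snd)
    have h3 : Primrec fun u : ((γ × ℕ × ℕ) × ℕ × ℕ) × List ℕ =>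
        ((1 : k), [Encodable.encode (1, u.2, u.1.1.2), Encodable.encode (0, u.2, u.1.2)]) :=
      primrec_term_pair 1 (primrec_var 1 Primrec.snd (hp'.comp Primrec.fst))
        (primrec_var 0 Primrec.snd (Primrec.snd.comp Primrec.fst))
    have h4 := Primrec.list_cons.comp h2
      (Primrec.list_map (hW.comp (Primrec.fst.comp Primrec.fst)) h3.to₂)
    have h5 := Primrec.list_map (hp.comp Primrec.fst) (Primrec.ite h1 h4 (Primrec.const [])).to₂
    exact Primrec.list_flatMap hp h5.to₂
  have hE : Primrec fun x : γ => (indexPairs x.2.2.1).map fun p =>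
      ((if p.1 + 1 = p.2 then -1 else 0 : k), []) :: x.2.2.2.1.map fun w =>
        (1, [Encodable.encode (2, w, 0, 0), Encodable.encode (0, w, p)]) := by
    have h1 : Primrec fun y : γ × ℕ × ℕ =>
        ((if y.2.1 + 1 = y.2.2 then -1 else 0 : k), ([] : List ℕ)) :=
      primrec_term_delta (Primrec.eq.comp (Primrec.succ.comp (Primrec.fst.comp Primrec.snd))
        (Primrec.snd.comp Primrec.snd))
    have h2 : Primrec fun u : (γ × ℕ × ℕ) × List ℕ =>
        ((1 : k), [Encodable.encode (2, u.2, 0, 0), Encodable.encode (0, u.2, u.1.2)]) :=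
      primrec_term_pair 1 (primrec_var 2 Primrec.snd (Primrec.const (0, 0)))
        (primrec_var 0 Primrec.snd (Primrec.snd.comp Primrec.fst))
    have h3 := Primrec.list_cons.comp h1 (Primrec.list_map (hW.comp Primrec.fst) h2.to₂)
    exact Primrec.list_map hp h3.to₂
  have hR : Primrec fun x : γ => x.2.2.2.2.flatMap fun g => (indexPairs x.2.2.1).map fun p =>
      g.map fun c => (c.1, [Encodable.encode (0, c.2, p)]) := by
    have h1 : Primrec fun u : ((γ × List (k × List ℕ)) × ℕ × ℕ) × k × List ℕ =>
        (u.2.1, [Encodable.encode (0, u.2.2, u.1.2)]) :=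
      (Primrec.fst.comp Primrec.snd).pair (primrec_singleton (primrec_var 0
        (Primrec.snd.comp Primrec.snd) (Primrec.snd.comp Primrec.fst)))
    have h2 := Primrec.list_map (Primrec.snd.comp Primrec.fst) h1.to₂
    exact Primrec.list_flatMap hF (Primrec.list_map (hp.comp Primrec.fst) h2.to₂).to₂
  exact Primrec.list_append.comp (Primrec.list_append.comp (Primrec.list_append.comp
    (Primrec.list_append.comp (Primrec.list_append.comp hA hB) hC) hD) hE) hR

end PrimrecSystem

end NonsplitTest

namespace NonsplitTest

/-! ### Solutions of the system and nonsplit extensions -/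

section Correctness

variable {k K : Type*} [Field k] [Field K] [Algebra k K] {s ℓ m : ℕ}

theorem list_sum_map_range (n : ℕ) (g : ℕ → K) :
    ((List.range n).map g).sum = ∑ i : Fin n, g i := by
  rw [map_range_eq_ofFn, List.sum_ofFn]

theorem list_sum_apply {ι : Type*} {n : ℕ} (L : List ι) (A : ι → Matrix (Fin n) (Fin n) K)
    (i j : Fin n) : (L.map A).sum i j = (L.map fun a => A a i j).sum := by
  induction L with
  | nil => rfl
  | cons a L ih => simp [ih]

theorem lift_ofTerms_apply {n : ℕ} (Y : Fin s → Matrix (Fin n) (Fin n) K)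
    (g : List (k × List (Fin s))) (i j : Fin n) :
    FreeAlgebra.lift k Y (ofTerms g) i j =
      (g.map fun c => algebraMap k K c.1 * (c.2.map Y).prod i j).sum := by
  induction g with
  | nil => simp [ofTerms]
  | cons c g ih =>
    have h : ofTerms (c :: g) = c.1 • (c.2.map (FreeAlgebra.ι k)).prod + ofTerms g := rfl
    rw [h, map_add, Matrix.add_apply, ih, map_smul, Matrix.smul_apply, Algebra.smul_def,
      map_list_prod, List.map_map, List.map_cons, List.sum_cons]
    have h1 : ⇑(FreeAlgebra.lift k Y) ∘ FreeAlgebra.ι k = Y := by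
      funext r
      simp
    rw [h1]

/-- In the definition the coercion is applied to a whole list of letters through `bind`; this is the
plain form. -/
theorem rawTerms_eq_map {k : Type*} {s : ℕ} (F : List (List (k × List (Fin s)))) :
    rawTerms F = F.map fun g => g.map fun c => (c.1, c.2.map Fin.val) := by
  have h : ∀ w : List (Fin s),
      (List.map (fun i : ℕ => i) do let a ← w; pure (a : ℕ)) = w.map Fin.val := by
    intro w
    rw [List.map_id', List.bind_eq_flatMap]
    exact (List.map_eq_flatMap).symm
  simp only [rawTerms, h]

theorem exists_list_fin {w : List ℕ} (h : ∀ r ∈ w, r < s) :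
    ∃ v : List (Fin s), v.map Fin.val = w := by
  lift w to List (Fin s) using h
  exact ⟨w, rfl⟩

/-- A solution of the system yields the matrices of a nonsplit extension. -/
theorem hasNonsplitExtension_of_solvesExtension (hℓ : 0 < ℓ) (hm : 0 < m)
    {F : List (List (k × List (Fin s)))} {N : ℕ} (hF : ∀ g ∈ F, ∀ c ∈ g, c.2.length ≤ N)
    {x : ℕ × List ℕ × ℕ × ℕ → K}
    (hx : SolvesExtension s ℓ (ℓ + m) (wordsUpTo s N) (rawTerms F) x) :
    HasNonsplitExtension k K (FPAlgebra fun j : Fin F.length => ofTerms (F.get j)) ℓ m := by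
  rw [rawTerms_eq_map] at hx
  obtain ⟨hA, hB, hC, hD, hE, hR⟩ := hx
  let Y : Fin s → Matrix (Fin (ℓ + m)) (Fin (ℓ + m)) K := fun r =>
    Matrix.of fun i j => x (0, [(r : ℕ)], i, j)
  have hmem : ∀ i j : Fin (ℓ + m), ((i : ℕ), (j : ℕ)) ∈ indexPairs (ℓ + m) := fun i j =>
    mem_indexPairs.2 ⟨i.2, j.2⟩
  -- By the recursion equations, the variables of a word of length at most N are the entries of the
  -- corresponding product of the Y_r.
  have hword : ∀ w : List (Fin s), w.length ≤ N → ∀ i j : Fin (ℓ + m),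
      (w.map Y).prod i j = x (0, w.map Fin.val, i, j) := by
    intro w
    induction w with
    | nil =>
      intro _ i j
      rw [List.map_nil, List.map_nil, List.prod_nil, Matrix.one_apply, hA _ (hmem i j)]
      simp [Fin.ext_iff]
    | cons r w ih =>
      intro hw i j
      have hw' : w.length ≤ N := (Nat.le_succ _).trans hw
      rw [List.map_cons, List.prod_cons, List.map_cons, hB _ (mem_wordsUpTo.2
        ⟨by simpa using hw', by simp⟩) r r.2 _ (hmem i j), Matrix.mul_apply, list_sum_map_range]
      exact Finset.sum_congr rfl fun l _ => by rw [ih hw']; rfl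
  have hcomb : ∀ d : List ℕ → K, ∃ M ∈ Algebra.adjoin K (Set.range Y), ∀ i j : Fin (ℓ + m),
      M i j = ((wordsUpTo s N).map fun w => d w * x (0, w, i, j)).sum := by
    intro d
    let A : List ℕ → Matrix (Fin (ℓ + m)) (Fin (ℓ + m)) K := fun w =>
      Matrix.of fun i j => d w * x (0, w, i, j)
    refine ⟨((wordsUpTo s N).map A).sum, list_sum_mem fun M hM => ?_, fun i j => ?_⟩
    · obtain ⟨w, hw, rfl⟩ := List.mem_map.1 hM
      obtain ⟨hlen, hlt⟩ := mem_wordsUpTo.1 hw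
      obtain ⟨v, rfl⟩ := exists_list_fin hlt
      have h : A (v.map Fin.val) = d (v.map Fin.val) • (v.map Y).prod := by
        ext i j
        rw [Matrix.smul_apply, hword v (by simpa using hlen)]
        rfl
      rw [h]
      refine Subalgebra.smul_mem _ (list_prod_mem fun y hy => ?_) _
      obtain ⟨r, -, rfl⟩ := List.mem_map.1 hy
      exact Algebra.subset_adjoin ⟨r, rfl⟩
    · exact list_sum_apply _ A i j
  have hY : ∀ r, Y r ∈ blockUpper K ℓ m := fun r i j =>
    hC r r.2 _ (hmem (Fin.natAdd ℓ i) (Fin.castAdd m j)) (by simp)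
  refine hasNonsplitExtension_of_matrices hℓ hm _ hY (fun j => ?_) ?_ ?_ ?_
  · ext i i'
    have hj : F.get j ∈ F := List.get_mem F j
    have h1 := hR _ (List.mem_map.2 ⟨_, hj, rfl⟩) _ (hmem i i')
    rw [List.map_map] at h1
    rw [lift_ofTerms_apply, Matrix.zero_apply, ← h1]
    congr 1
    exact List.map_congr_left fun c hc => by rw [hword c.2 (hF _ hj c hc)]; rfl
  · refine eq_top_iff.2 fun a _ => ?_
    rw [Matrix.matrix_eq_sum_single a]
    refine sum_mem fun i _ => sum_mem fun j _ => ?_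
    obtain ⟨M, hM, hMe⟩ := hcomb fun w => x (1, w, i, j)
    have h1 : topLeft M = Matrix.single i j 1 := by
      ext i' j'
      have h2 := hD _ (hmem (Fin.castAdd m i) (Fin.castAdd m j)) _
        (hmem (Fin.castAdd m i') (Fin.castAdd m j')) (Or.inl (by simp))
      refine ((hMe _ _).trans h2).trans ?_
      simp [Matrix.single_apply, Fin.ext_iff]
    have h2 : Matrix.single i j (a i j) = a i j • topLeft M := by
      rw [h1, Matrix.smul_single, smul_eq_mul, mul_one]
    rw [h2]
    exact Subalgebra.smul_mem _ (topLeft_mem_adjoin hY hM) _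
  · refine eq_top_iff.2 fun a _ => ?_
    rw [Matrix.matrix_eq_sum_single a]
    refine sum_mem fun i _ => sum_mem fun j _ => ?_
    obtain ⟨M, hM, hMe⟩ := hcomb fun w => x (1, w, ℓ + i, ℓ + j)
    have h1 : bottomRight M = Matrix.single i j 1 := by
      ext i' j'
      have h2 := hD _ (hmem (Fin.natAdd ℓ i) (Fin.natAdd ℓ j)) _
        (hmem (Fin.natAdd ℓ i') (Fin.natAdd ℓ j')) (Or.inr (by simp))
      refine ((hMe _ _).trans h2).trans ?_
      simp [Matrix.single_apply, Fin.ext_iff]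
    have h2 : Matrix.single i j (a i j) = a i j • bottomRight M := by
      rw [h1, Matrix.smul_single, smul_eq_mul, mul_one]
    rw [h2]
    exact Subalgebra.smul_mem _ (bottomRight_mem_adjoin hY hM) _
  · obtain ⟨M, hM, hMe⟩ := hcomb fun w => x (2, w, 0, 0)
    convert hM using 1
    ext i j
    rw [hMe, hE _ (hmem i j)]
    rfl

/-- Elements of a matrix algebra are linear combinations of the products of generators indexed by
the words up to a sufficiently large length. -/
theorem exists_coefficients {n N : ℕ} (hN : n ^ 2 ≤ N) {Y : Fin s → Matrix (Fin n) (Fin n) K}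
    {P : List ℕ → Matrix (Fin n) (Fin n) K}
    (hP : ∀ w : List (Fin s), P (w.map Fin.val) = (w.map Y).prod)
    {M : Matrix (Fin n) (Fin n) K} (hM : M ∈ Algebra.adjoin K (Set.range Y)) :
    ∃ d : List ℕ → K, ∀ i j, ((wordsUpTo s N).map fun w => d w * P w i j).sum = M i j := by
  classical
  rw [← Subalgebra.mem_toSubmodule, ← wordSpan_eq_adjoin Y hN, wordSpan] at hM
  have h : {M | ∃ L : List (Fin s), L.length ≤ N ∧ M = (L.map Y).prod} =
      P '' ((wordsUpTo s N).toFinset : Set (List ℕ)) := by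
    ext M
    constructor
    · rintro ⟨L, hL, rfl⟩
      refine ⟨L.map Fin.val, ?_, hP L⟩
      rw [Finset.mem_coe, List.mem_toFinset, mem_wordsUpTo]
      exact ⟨by simpa using hL, by simp⟩
    · rintro ⟨w, hw, rfl⟩
      rw [Finset.mem_coe, List.mem_toFinset, mem_wordsUpTo] at hw
      obtain ⟨v, rfl⟩ := exists_list_fin hw.2
      exact ⟨v, by simpa using hw.1, hP v⟩
  rw [h, Submodule.mem_span_image_finset_iff_exists_fun'] at hM
  obtain ⟨d, rfl⟩ := hM
  refine ⟨d, fun i j => ?_⟩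
  rw [List.sum_toFinset _ (nodup_wordsUpTo s N), list_sum_apply]
  rfl

/-- The matrices of a nonsplit extension yield a solution of the system. -/
theorem exists_solvesExtension_of_hasNonsplitExtension [IsAlgClosed K] (hℓ : 0 < ℓ) (hm : 0 < m)
    {F : List (List (k × List (Fin s)))} {N : ℕ} (hN : (ℓ + m) ^ 2 ≤ N)
    (h : HasNonsplitExtension k K (FPAlgebra fun j : Fin F.length => ofTerms (F.get j)) ℓ m) :
    ∃ x : ℕ × List ℕ × ℕ × ℕ → K,
      SolvesExtension s ℓ (ℓ + m) (wordsUpTo s N) (rawTerms F) x := by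
  rw [rawTerms_eq_map]
  obtain ⟨Y, hY, hf, hT, hB, hS⟩ := h.exists_matrices hℓ hm none
  let Y' : ℕ → Matrix (Fin (ℓ + m)) (Fin (ℓ + m)) K := fun r => if h : r < s then Y ⟨r, h⟩ else 0
  have hYY' : ∀ r : Fin s, Y' r = Y r := fun r => dif_pos r.2
  have hP : ∀ w : List (Fin s), ((w.map Fin.val).map Y').prod = (w.map Y).prod := by
    intro w
    rw [List.map_map]
    congr 2
    funext r
    exact hYY' r
  -- Entries of the word products, with value 0 outside the index range.
  let e : List ℕ → ℕ × ℕ → K := fun w p =>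
    if h : p.1 < ℓ + m ∧ p.2 < ℓ + m then (w.map Y').prod ⟨p.1, h.1⟩ ⟨p.2, h.2⟩ else 0
  have he : ∀ (w : List ℕ) {p : ℕ × ℕ} (hp : p ∈ indexPairs (ℓ + m)), e w p =
      (w.map Y').prod ⟨p.1, (mem_indexPairs.1 hp).1⟩ ⟨p.2, (mem_indexPairs.1 hp).2⟩ :=
    fun w p hp => dif_pos (mem_indexPairs.1 hp)
  have hsum : ∀ M ∈ Algebra.adjoin K (Set.range Y), ∃ d : List ℕ → K,
      ∀ (q : ℕ × ℕ) (hq : q ∈ indexPairs (ℓ + m)),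
        ((wordsUpTo s N).map fun w => d w * e w q).sum =
          M ⟨q.1, (mem_indexPairs.1 hq).1⟩ ⟨q.2, (mem_indexPairs.1 hq).2⟩ := by
    intro M hM
    obtain ⟨d, hd⟩ := exists_coefficients hN (P := fun w => (w.map Y').prod) hP hM
    refine ⟨d, fun q hq => ?_⟩
    simp only [he _ hq]
    exact hd _ _
  -- Coefficients that produce the matrix unit at p inside the diagonal block that contains p.
  have hu : ∀ p : ℕ × ℕ, ∃ d : List ℕ → K, p ∈ indexPairs (ℓ + m) →
      ∀ q ∈ indexPairs (ℓ + m), SameBlock ℓ p q →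
        ((wordsUpTo s N).map fun w => d w * e w q).sum = if p = q then 1 else 0 := by
    rintro ⟨p₁, p₂⟩
    by_cases htop : p₁ < ℓ ∧ p₂ < ℓ
    · obtain ⟨M, hM, hMp⟩ := hT (Matrix.single ⟨p₁, htop.1⟩ ⟨p₂, htop.2⟩ 1)
      obtain ⟨d, hd⟩ := hsum M hM
      refine ⟨d, fun hp q hq hpq => ?_⟩
      obtain ⟨q₁, q₂⟩ := q
      have hq' : q₁ < ℓ ∧ q₂ < ℓ := by
        rcases hpq with h | h
        · exact h.2
        · exact absurd h.1.1 (not_le.2 htop.1)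
      rw [hd _ hq]
      have h1 := congrFun (congrFun hMp ⟨q₁, hq'.1⟩) ⟨q₂, hq'.2⟩
      refine Eq.trans h1 ?_
      simp [Matrix.single_apply, Prod.ext_iff]
    · by_cases hbot : (ℓ ≤ p₁ ∧ ℓ ≤ p₂) ∧ p₁ < ℓ + m ∧ p₂ < ℓ + m
      · obtain ⟨⟨h1, h2⟩, h3, h4⟩ := hbot
        obtain ⟨M, hM, hMp⟩ := hB (Matrix.single ⟨p₁ - ℓ, by omega⟩ ⟨p₂ - ℓ, by omega⟩ 1)
        obtain ⟨d, hd⟩ := hsum M hM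
        refine ⟨d, fun hp q hq hpq => ?_⟩
        obtain ⟨q₁, q₂⟩ := q
        have hq' : ℓ ≤ q₁ ∧ ℓ ≤ q₂ := by
          rcases hpq with h | h
          · exact absurd h.1 htop
          · exact h.2
        have hq'' := mem_indexPairs.1 hq
        rw [hd _ hq]
        obtain ⟨a, rfl⟩ := Nat.exists_eq_add_of_le hq'.1
        obtain ⟨b, rfl⟩ := Nat.exists_eq_add_of_le hq'.2
        simp only [Nat.add_lt_add_iff_left] at hq''
        have h5 := congrFun (congrFun hMp ⟨a, hq''.1⟩) ⟨b, hq''.2⟩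
        refine Eq.trans h5 ?_
        have h6 : p₁ - ℓ = a ↔ p₁ = ℓ + a := by omega
        have h7 : p₂ - ℓ = b ↔ p₂ = ℓ + b := by omega
        simp [Matrix.single_apply, Prod.ext_iff, h6, h7]
      -- Here p lies in no diagonal block or out of range, so nothing is required.
      · refine ⟨0, fun hp q hq hpq => ?_⟩
        rcases hpq with h | h
        · exact absurd h.1 htop
        · exact absurd ⟨h.1, mem_indexPairs.1 hp⟩ hbot
  choose u hu using hu
  obtain ⟨c, hc⟩ := hsum _ hS
  let x : ℕ × List ℕ × ℕ × ℕ → K := fun y =>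
    if y.1 = 0 then e y.2.1 y.2.2 else if y.1 = 1 then u y.2.2 y.2.1 else c y.2.1
  have hx₀ : ∀ w p, x (0, w, p) = e w p := fun _ _ => rfl
  have hx₁ : ∀ w p, x (1, w, p) = u p w := fun _ _ => rfl
  have hx₂ : ∀ w p, x (2, w, p) = c w := fun _ _ => rfl
  refine ⟨x, ?_⟩
  simp only [SolvesExtension, hx₀, hx₁, hx₂]
  refine ⟨fun p hp => ?_, fun w _ r _ p hp => ?_, fun r hr p hp hpb => ?_,
    fun p hp q hq hpq => hu p hp q hq hpq, fun p hp => ?_, fun g hg p hp => ?_⟩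
  · rw [he _ hp, List.map_nil, List.prod_nil, Matrix.one_apply]
    simp
  · have hp' := mem_indexPairs.1 hp
    rw [he _ hp, List.map_cons, List.prod_cons, Matrix.mul_apply, list_sum_map_range]
    refine Finset.sum_congr rfl fun l _ => ?_
    rw [he [r] (p := (p.1, (l : ℕ))) (mem_indexPairs.2 ⟨hp'.1, l.2⟩),
      he w (p := ((l : ℕ), p.2)) (mem_indexPairs.2 ⟨l.2, hp'.2⟩)]
    simp
  · obtain ⟨p₁, p₂⟩ := p
    have hp' := mem_indexPairs.1 hp
    obtain ⟨a, rfl⟩ := Nat.exists_eq_add_of_le hpb.1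
    rw [he _ hp, List.map_singleton, List.prod_singleton, hYY' ⟨r, hr⟩]
    exact hY.1 ⟨r, hr⟩ ⟨a, Nat.lt_of_add_lt_add_left hp'.1⟩ ⟨p₂, hpb.2⟩
  · rw [hc p hp]
    rfl
  · obtain ⟨g', hg', rfl⟩ := List.mem_map.1 hg
    obtain ⟨j, rfl⟩ := List.get_of_mem hg'
    have h1 := congrFun (congrFun (hf j) ⟨p.1, (mem_indexPairs.1 hp).1⟩)
      ⟨p.2, (mem_indexPairs.1 hp).2⟩
    rw [lift_ofTerms_apply, Matrix.zero_apply] at h1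
    rw [List.map_map, ← h1]
    congr 1
    refine List.map_congr_left fun c _ => ?_
    rw [Function.comp_apply, he _ hp, hP]

/-- The total number of letters of the presentation is a computable bound for the length of each of
its words. -/
theorem length_le_length_letters {k : Type*} {F : List (List (k × List ℕ))} {g : List (k × List ℕ)} (hg : g ∈ F)
    {c : k × List ℕ} (hc : c ∈ g) : c.2.length ≤ (letters F).length := by
  refine (List.Sublist.length_le ?_).trans (List.Sublist.length_le
    (List.sublist_flatten_of_mem (List.mem_map.2 ⟨g, hg, rfl⟩)))
  exact List.sublist_flatten_of_mem (List.mem_map.2 ⟨c, hc, rfl⟩)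

/-- The length bound has two summands: (ℓ+m)² makes the words span the generated algebra, and the
number of letters ensures that every word in the relations is listed. Both are computed from the
input. -/
theorem hasNonsplitExtension_iff_exists_zero [IsAlgClosed K] (hℓ : 0 < ℓ) (hm : 0 < m)
    (F : List (List (k × List (Fin s)))) :
    HasNonsplitExtension k K (FPAlgebra fun j : Fin F.length => ofTerms (F.get j)) ℓ m ↔
      ∃ z : ℕ → K, ∀ T ∈ extensionSystem s ℓ (ℓ + m)
        (wordsUpTo s ((ℓ + m) * (ℓ + m) + (letters (rawTerms F)).length)) (rawTerms F),
          termsEval z T = 0 := by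
  rw [exists_zero_extensionSystem_iff]
  constructor
  · refine exists_solvesExtension_of_hasNonsplitExtension hℓ hm ?_
    rw [sq]
    exact Nat.le_add_right _ _
  · rintro ⟨x, hx⟩
    refine hasNonsplitExtension_of_solvesExtension hℓ hm (fun g hg c hc => ?_) hx
    rw [rawTerms_eq_map]
    have h1 := length_le_length_letters (F := F.map fun g => g.map fun c => (c.1, c.2.map Fin.val))
      (List.mem_map.2 ⟨g, hg, rfl⟩)
      (List.mem_map.2 ⟨c, hc, rfl⟩)
    rw [List.length_map] at h1
    omega

end Correctness

/-- The existence of nonsplit extensions is decidable. -/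
theorem exists_computable_hasNonsplitExtension {k : Type*} (K : Type*) [Field k] [Field K]
    [Algebra k K] [IsAlgClosed K] [Algebra.IsAlgebraic k K] [Primcodable k]
    (hk : IsComputableField k) :
    ∃ D : ℕ × ℕ × ℕ × List (List (k × List ℕ)) → Bool, Computable D ∧
      ∀ (s ℓ m : ℕ), 0 < ℓ → 0 < m → ∀ F : List (List (k × List (Fin s))),
        (D (s, ℓ, m, rawTerms F) = true ↔
          HasNonsplitExtension k K (FPAlgebra fun j : Fin F.length => ofTerms (F.get j)) ℓ m) := by
  obtain ⟨D₀, hD₀, hD₀'⟩ := ComputablePred.computable_iff.1 (computablePred_exists_zero K hk)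
  let γ := ℕ × ℕ × ℕ × List (List (k × List ℕ))
  have hs : Primrec fun x : γ => x.1 := Primrec.fst
  have hℓ : Primrec fun x : γ => x.2.1 := Primrec.fst.comp Primrec.snd
  have hm : Primrec fun x : γ => x.2.2.1 := Primrec.fst.comp (Primrec.snd.comp Primrec.snd)
  have hF : Primrec fun x : γ => x.2.2.2 := Primrec.snd.comp (Primrec.snd.comp Primrec.snd)
  have hn : Primrec fun x : γ => x.2.1 + x.2.2.1 := Primrec.nat_add.comp hℓ hm
  have hN : Primrec fun x : γ =>
      (x.2.1 + x.2.2.1) * (x.2.1 + x.2.2.1) + (letters x.2.2.2).length :=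
    Primrec.nat_add.comp (Primrec.nat_mul.comp hn hn)
      (Primrec.list_length.comp (primrec_letters.comp hF))
  have hW : Primrec fun x : γ => wordsUpTo x.1
      ((x.2.1 + x.2.2.1) * (x.2.1 + x.2.2.1) + (letters x.2.2.2).length) :=
    primrec_wordsUpTo.comp hs hN
  have hG := primrec_extensionSystem.comp (hs.pair (hℓ.pair (hn.pair (hW.pair hF))))
  refine ⟨_, hD₀.comp hG.to_comp, fun s ℓ m hℓ hm F => ?_⟩
  rw [hasNonsplitExtension_iff_exists_zero hℓ hm F]
  exact (iff_of_eq (congrFun hD₀' _)).symm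

end NonsplitTest

/-! ### The splitting criterion, the test and decidability together -/

theorem mainTheorem4 {k : Type*} {K : Type*} [Field k] [Field K] [Algebra k K] :
    -- criterion for splitting, for an arbitrary algebra and an arbitrary extension field
    (∀ (A : Type*) [Ring A] [Algebra k A] (ℓ m : ℕ), 0 < ℓ → 0 < m →
      ∀ ρ : A →ₐ[k] blockUpper K ℓ m,
        (IsSemisimpleRep (toRep ρ) →
          ∀ τ : Matrix (Fin (ℓ + m)) (Fin (ℓ + m)) K ≃ₐ[K] Matrix (Fin (ℓ + m)) (Fin (ℓ + m)) K,
            IsInner τ → (∀ M ∈ blockUpper K ℓ m, τ M ∈ blockUpper K ℓ m) →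
              ¬ ∃ M ∈ imageAlgebra (toRep ρ), τ M = supDiag K (ℓ + m)) ∧
        (IsExtensionOfIrreducibles ρ →
          (¬ IsSemisimpleRep (toRep ρ) ↔
            ∃ τ : Matrix (Fin (ℓ + m)) (Fin (ℓ + m)) K ≃ₐ[K]
                Matrix (Fin (ℓ + m)) (Fin (ℓ + m)) K,
              IsInner τ ∧ (∀ M ∈ blockUpper K ℓ m, τ M ∈ blockUpper K ℓ m) ∧
                ∃ M ∈ imageAlgebra (toRep ρ), τ M = supDiag K (ℓ + m)))) ∧
    -- the test: finitely many choices, each with a finite system of commutative polynomials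
    (∀ [IsAlgClosure k K] (s t : ℕ) (f : Fin t → FreeAlgebra k (Fin s)) (ℓ m : ℕ),
      0 < ℓ → 0 < m → ∀ r₀ : Option (Fin s),
        (productSet k K ℓ m s r₀).Finite ∧
        (∀ c : Choice k K ℓ m s r₀, (testSystem f c).Finite) ∧
        (HasNonsplitExtension k K (FPAlgebra f) ℓ m ↔
          ∃ c : Choice k K ℓ m s r₀, HasCommonZero K (testSystem f c))) ∧
    -- decidability, uniformly in the presentation and in the two dimensions
    (∀ [IsAlgClosure k K] [Primcodable k], IsComputableField k →
      ∃ D : ℕ × ℕ × ℕ × List (List (k × List ℕ)) → Bool, Computable D ∧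
        ∀ (s ℓ m : ℕ), 0 < ℓ → 0 < m → ∀ F : List (List (k × List (Fin s))),
          (D (s, ℓ, m, rawTerms F) = true ↔
            HasNonsplitExtension k K (FPAlgebra fun j : Fin F.length => ofTerms (F.get j)) ℓ m))
    := by
  refine ⟨fun A _ _ ℓ m hℓ hm ρ => ⟨fun hs τ hτ hE => ?_, fun hρ => ?_⟩, ?_, ?_⟩
  · exact supDiag_notMem_of_isSemisimpleRep hℓ hm ρ hs τ hτ hE
  · exact not_isSemisimpleRep_iff hℓ hm ρ hρ
  · intro _ s t f ℓ m hℓ hm r₀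
    have hK : IsAlgClosed K := IsAlgClosure.isAlgClosed k
    refine ⟨productSet_finite (by omega), testSystem_finite f, ?_, ?_⟩
    · exact exists_hasCommonZero_of_hasNonsplitExtension hℓ hm f
    · rintro ⟨c, h⟩
      exact hasNonsplitExtension_of_hasCommonZero hℓ hm f c h
  · intro _ _ hk
    have hK : IsAlgClosed K := IsAlgClosure.isAlgClosed k
    have halg : Algebra.IsAlgebraic k K := IsAlgClosure.isAlgebraic
    exact exists_computable_hasNonsplitExtension K hk
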